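/- Let $0<q<1$, $0\le s\le 1$, and let $N\in\frac12\mathbb{Z}$, $N\neq 0$. Let $\mathcal{A}(S^2_{qs})$ be the complex $*$-algebra generated by $A=A^*$, $B$, $B^*$ with relations $$AB=q^2BA,\qquad BB^*+(A+s^2)(A-1)=0,\qquad B^*B+(q^2A+s^2)(q^2A-1)=0,$$ and let $\sigma_s:\mathcal{A}(S^2_{qs})\to C(S^1)$ be the $*$-homomorphism with $\sigma_s(A)=0$, $\sigma_s(B)=su$, where $u(\theta)=e^{i\theta}$. Write $[x]=(q^x-q^{-x})/(q-q^{-1})$, and put $x_1=(q[2])^{1/2}B$ and $x_0=-q[2]A+(1-s^2)$. For $M=\pm N$ let $\mathcal{H}_M$ be the Hilbert space with orthonormal basis $|l,m;M\rangle$, $l-|M|\in\mathbb{N}$, $l-|m|\in\mathbb{N}$ (with $\mathbb{N}\ni 0$), and let $\mathcal{H}=\mathcal{H}_N\oplus\mathcal{H}_{-N}$. There is a unique $*$-representation of $\mathcal{A}(S^2_{qs})$ by bounded operators on $\mathcal{H}$ such that, for $M=\pm N$, $$x_0|l,m;M\rangle=A^+_{l,m}|l+1,m;M\rangle+A^0_{l,m}|l,m;M\rangle+A^+_{l-1,m}|l-1,m;M\rangle,$$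 $$x_1|l,m;M\rangle=B^+_{l,m}|l+1,m+1;M\rangle+B^0_{l,m}|l,m+1;M\rangle+B^-_{l,m}|l-1,m+1;M\rangle,$$ where vectors with inadmissible labels are read as $0$ and $$A^+_{l,m}=q^m\sqrt{[2][l-m+1][l+m+1]}\,\alpha_{M,l+1},\qquad A^0_{l,m}=\bigl([2l]-q^{l+m+1}[2][l-m]\bigr)\beta_{M,l},$$ $$B^+_{l,m}=q^{-l+m}\sqrt{[l+m+1][l+m+2]}\,\alpha_{M,l+1},\qquad B^0_{l,m}=-q^{m+2}\sqrt{[2][l-m][l+m+1]}\,\beta_{M,l},$$ $$B^-_{l,m}=-q^{l+m+1}\sqrt{[l-m][l-m-1]}\,\alpha_{M,l},$$ $$\alpha_{M,l}=\frac{1}{[2l]}\sqrt{\frac{[2][l+M][l-M]}{[2l-1][2l+1]}}\,\sqrt{(q^{l+M}+q^{-(l+M)}s^2)(q^{l-M}s^2+q^{-(l-M)})},$$ $$\beta_{M,l}=\frac{\bigl([2l]-q^{l+M+1}[2][l-M]\bigr)(1-s^2)+q[2][2M]s^2}{q^2[2l][2l+2]}.$$ Let $D$ be the self-adjoint operator $D|l,m;\pm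 N\rangle=(l-|N|+1)|l,m;\mp N\rangle$ on $\mathcal{H}$, so that $|D|\,|l,m;\pm N\rangle=(l-|N|+1)|l,m;\pm N\rangle$. Then for every $a\in\mathcal{A}(S^2_{qs})$, acting on $\mathcal{H}$ through this representation, the operator $a|D|^{-z}$ is of trace class for $\mathrm{Re}\,z>2$, the function $\zeta_a(z)=\mathrm{Tr}_{\mathcal{H}}(a|D|^{-z})$ has a meromorphic extension to $\mathbb{C}$, and the noncommutative integral $⨍ a|D|^{-2}:=\mathrm{Res}_{z=2}\zeta_a(z)$ is $$⨍ a|D|^{-2}=\frac{2}{\pi}\int_{S^1}\sigma_s(a)(\theta)\,\mathrm{d}\theta .$$ If $s=0$, then $\sigma_0(a)$ is a constant and $⨍ a|D|^{-2}=4\,\sigma_0(a)$. -/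

import Mathlib

/-! ### The coordinate algebra of the Podles sphere -/

namespace Podles

/-- The three generators `A`, `B`, `B*`. -/
inductive Gen where
  | A
  | B
  | Bstar

/-- The involution on generators: `A* = A`, and `B`, `B*` are exchanged. -/
def Gen.conj : Gen → Gen
  | .A => .A
  | .B => .Bstar
  | .Bstar => .B

/-- The free complex algebra on `A`, `B`, `B*`. -/
abbrev Free : Type := FreeAlgebra ℂ Gen

/-- A generator as an element of the free algebra. -/
abbrev gen (g : Gen) : Free := FreeAlgebra.ι ℂ g

/-- The defining relations `A B = q² B A`, `B B* + (A + s²)(A - 1) = 0`,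
`B* B + (q² A + s²)(q² A - 1) = 0`. Being relations of a `*`-algebra, they come with their adjoints;
the second and third are self-adjoint, the adjoint of the first is `B* A = q² A B*`. -/
inductive Rel (q s : ℝ) : Free → Free → Prop
  | comm : Rel q s (gen .A * gen .B) (((q : ℂ) ^ 2) • (gen .B * gen .A))
  | comm_star : Rel q s (gen .Bstar * gen .A) (((q : ℂ) ^ 2) • (gen .A * gen .Bstar))
  | B_Bstar : Rel q s (gen .B * gen .Bstar
      + (gen .A + algebraMap ℂ Free ((s : ℂ) ^ 2)) * (gen .A - 1)) 0
  | Bstar_B : Rel q s (gen .Bstar * gen .B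
      + (((q : ℂ) ^ 2) • gen .A + algebraMap ℂ Free ((s : ℂ) ^ 2))
        * (((q : ℂ) ^ 2) • gen .A - 1)) 0

/-- The coordinate algebra `𝒜(S²_{qs})` of the Podles sphere. -/
def Sphere (q s : ℝ) : Type := RingQuot (Rel q s)

noncomputable instance (q s : ℝ) : Ring (Sphere q s) := inferInstanceAs (Ring (RingQuot (Rel q s)))

noncomputable instance (q s : ℝ) : Algebra ℂ (Sphere q s) :=
  inferInstanceAs (Algebra ℂ (RingQuot (Rel q s)))

/-- The quotient map from the free algebra. -/
noncomputable def mk (q s : ℝ) : Free →ₐ[ℂ] Sphere q s := RingQuot.mkAlgHom ℂ (Rel q s)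

/-- The generator `A` of `𝒜(S²_{qs})`. -/
noncomputable def A (q s : ℝ) : Sphere q s := mk q s (gen .A)

/-- The generator `B` of `𝒜(S²_{qs})`. -/
noncomputable def B (q s : ℝ) : Sphere q s := mk q s (gen .B)

theorem mk_eq_of_rel {q s : ℝ} {x y : Free} (h : Rel q s x y) : mk q s x = mk q s y :=
  RingQuot.mkAlgHom_rel ℂ h

/-- The involution as an (antimultiplicative, conjugate linear) map on the free algebra. -/
noncomputable def preStar (q s : ℝ) : Free →+* (Sphere q s)ᵐᵒᵖ :=
  letI : Algebra ℂ (Sphere q s)ᵐᵒᵖ := Algebra.compHom (Sphere q s)ᵐᵒᵖ (starRingEnd ℂ)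
  (FreeAlgebra.lift ℂ (fun g : Gen => MulOpposite.op (mk q s (gen g.conj)))).toRingHom

theorem preStar_gen (q s : ℝ) (g : Gen) :
    preStar q s (gen g) = MulOpposite.op (mk q s (gen g.conj)) := by
  let _ : Algebra ℂ (Sphere q s)ᵐᵒᵖ := Algebra.compHom (Sphere q s)ᵐᵒᵖ (starRingEnd ℂ)
  exact FreeAlgebra.lift_ι_apply (R := ℂ)
    (fun g : Gen => MulOpposite.op (mk q s (gen g.conj))) g

theorem preStar_algebraMap (q s : ℝ) (c : ℂ) :
    preStar q s (algebraMap ℂ Free c)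
      = MulOpposite.op (algebraMap ℂ (Sphere q s) (starRingEnd ℂ c)) := by
  let _ : Algebra ℂ (Sphere q s)ᵐᵒᵖ := Algebra.compHom (Sphere q s)ᵐᵒᵖ (starRingEnd ℂ)
  exact (FreeAlgebra.lift ℂ
    (fun g : Gen => MulOpposite.op (mk q s (gen g.conj)))).commutes c

theorem preStar_smul (q s : ℝ) (c : ℂ) (x : Free) :
    preStar q s (c • x) = MulOpposite.op (starRingEnd ℂ c • (preStar q s x).unop) := by
  rw [Algebra.smul_def, map_mul, preStar_algebraMap, Algebra.smul_def,
    Algebra.commutes, MulOpposite.op_mul, MulOpposite.op_unop]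

theorem preStar_rel (q s : ℝ) {x y : Free} (h : Rel q s x y) :
    preStar q s x = preStar q s y := by
  have e1 := mk_eq_of_rel (Rel.comm (q := q) (s := s))
  have e2 := mk_eq_of_rel (Rel.comm_star (q := q) (s := s))
  have e3 := mk_eq_of_rel (Rel.B_Bstar (q := q) (s := s))
  have e4 := mk_eq_of_rel (Rel.Bstar_B (q := q) (s := s))
  apply MulOpposite.unop_injective
  simp only [map_mul, map_smul, map_add, map_sub, map_one, map_zero, AlgHom.commutes]
    at e1 e2 e3 e4
  cases h with
  | comm =>
    simpa [preStar_smul, preStar_gen, Gen.conj] using e2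
  | comm_star =>
    simpa [preStar_smul, preStar_gen, Gen.conj] using e1
  | B_Bstar =>
    rw [← sub_eq_zero] at e3 ⊢
    rw [← e3]
    simp only [map_add, map_mul, map_sub, map_one, map_zero, preStar_gen, preStar_algebraMap,
      Gen.conj, MulOpposite.unop_add, MulOpposite.unop_mul, MulOpposite.unop_sub,
      MulOpposite.unop_op, MulOpposite.unop_one, MulOpposite.unop_zero, map_pow,
      MulOpposite.unop_pow,
      Complex.conj_ofReal]
    have hc := Algebra.commutes ((s : ℂ) ^ 2) (mk q s (gen .A))
    simp only [map_pow] at hc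
    simp only [sub_mul, mul_add, mul_sub, add_mul, mul_one, one_mul, hc]
    abel
  | Bstar_B =>
    rw [← sub_eq_zero] at e4 ⊢
    rw [← e4]
    simp only [map_add, map_mul, map_sub, map_one, map_zero, preStar_gen, preStar_algebraMap,
      preStar_smul,
      Gen.conj, MulOpposite.unop_add, MulOpposite.unop_mul, MulOpposite.unop_sub,
      MulOpposite.unop_op, MulOpposite.unop_one, MulOpposite.unop_zero, map_pow,
      MulOpposite.unop_pow,
      Complex.conj_ofReal]
    have hc := Algebra.commutes ((s : ℂ) ^ 2) (((q : ℂ) ^ 2) • mk q s (gen .A))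
    simp only [map_pow] at hc
    simp only [sub_mul, mul_add, mul_sub, add_mul, mul_one, one_mul, hc]
    abel

/-- The involution of `𝒜(S²_{qs})` as a ring homomorphism to the opposite ring. -/
noncomputable def starHom (q s : ℝ) : Sphere q s →+* (Sphere q s)ᵐᵒᵖ :=
  RingQuot.lift ⟨preStar q s, fun _ _ h => preStar_rel q s h⟩

theorem starHom_mk (q s : ℝ) (x : Free) : starHom q s (mk q s x) = preStar q s x := by
  have h := RingQuot.lift_mkRingHom_apply (preStar q s) (fun _ _ h => preStar_rel q s h) x
  have h2 : mk q s x = RingQuot.mkRingHom (Rel q s) x := by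
    rw [← RingQuot.mkAlgHom_coe ℂ (Rel q s)]; rfl
  rw [h2]
  exact h

theorem mk_surjective (q s : ℝ) : Function.Surjective (mk q s) :=
  RingQuot.mkAlgHom_surjective ℂ (Rel q s)

theorem starHom_starHom (q s : ℝ) (x : Sphere q s) :
    (starHom q s (starHom q s x).unop).unop = x := by
  obtain ⟨x, rfl⟩ := mk_surjective q s x
  induction x using FreeAlgebra.induction with
  | grade0 c =>
    rw [starHom_mk, preStar_algebraMap, MulOpposite.unop_op, ← AlgHom.commutes (mk q s),
      starHom_mk, preStar_algebraMap, MulOpposite.unop_op, AlgHom.commutes, Complex.conj_conj]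
  | grade1 g =>
    rw [starHom_mk, preStar_gen, MulOpposite.unop_op, starHom_mk, preStar_gen]
    cases g <;> rfl
  | mul x y hx hy => simp only [map_mul, MulOpposite.unop_mul, hx, hy]
  | add x y hx hy => simp only [map_add, MulOpposite.unop_add, hx, hy]

/-- The involution: conjugate linear, antimultiplicative, `A* = A`, `B ↦ B*`. -/
noncomputable instance (q s : ℝ) : StarRing (Sphere q s) where
  star x := (starHom q s x).unop
  star_involutive := starHom_starHom q s
  star_mul x y := by simp
  star_add x y := by simp

theorem star_def (q s : ℝ) (x : Sphere q s) : star x = (starHom q s x).unop := rfl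

instance (q s : ℝ) : StarModule ℂ (Sphere q s) where
  star_smul c x := by
    rw [Algebra.smul_def, star_mul, Algebra.smul_def, Algebra.commutes]
    congr 1
    rw [star_def, ← AlgHom.commutes (mk q s), starHom_mk, preStar_algebraMap]
    rfl

theorem star_mk_gen (q s : ℝ) (g : Gen) : star (mk q s (gen g)) = mk q s (gen g.conj) := by
  rw [star_def, starHom_mk, preStar_gen]
  rfl

/-! ### The character map -/

/-- The function `u(θ) = e^{iθ}` on the circle. -/
noncomputable def u : C(Circle, ℂ) := ⟨fun w => (w : ℂ), by fun_prop⟩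

/-- Images of the generators under the character map: `A ↦ 0`, `B ↦ s u`, `B* ↦ s u*`. -/
noncomputable def charGen (s : ℝ) : Gen → C(Circle, ℂ)
  | .A => 0
  | .B => (s : ℂ) • u
  | .Bstar => (s : ℂ) • star u

theorem u_mul_star : u * star u = 1 := by
  ext w
  change (w : ℂ) * starRingEnd ℂ (w : ℂ) = 1
  simp [Complex.mul_conj]

theorem charGen_rel (q s : ℝ) {x y : Free} (h : Rel q s x y) :
    FreeAlgebra.lift ℂ (charGen s) x = FreeAlgebra.lift ℂ (charGen s) y := by
  have h1 : u * star u = 1 := u_mul_star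
  have h2 : star u * u = 1 := by rw [mul_comm, h1]
  cases h <;>
    simp only [map_mul, map_add, map_sub, map_smul, map_one, map_zero, charGen,
      FreeAlgebra.lift_ι_apply, Algebra.smul_mul_assoc, Algebra.mul_smul_comm, h1, h2, smul_smul,
      pow_two, Algebra.algebraMap_eq_smul_one, mul_zero, zero_mul, smul_zero, zero_add, zero_sub,
      mul_neg, mul_one, add_neg_cancel]

/-- The character map as an algebra homomorphism. -/
noncomputable def charHom (q s : ℝ) : Sphere q s →ₐ[ℂ] C(Circle, ℂ) :=
  RingQuot.liftAlgHom ℂ ⟨FreeAlgebra.lift ℂ (charGen s), fun _ _ h => charGen_rel q s h⟩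

theorem charHom_mk (q s : ℝ) (x : Free) :
    charHom q s (mk q s x) = FreeAlgebra.lift ℂ (charGen s) x :=
  RingQuot.liftAlgHom_mkAlgHom_apply ℂ _ (fun _ _ h => charGen_rel q s h) x

theorem charHom_star (q s : ℝ) (x : Sphere q s) :
    charHom q s (star x) = star (charHom q s x) := by
  obtain ⟨x, rfl⟩ := mk_surjective q s x
  induction x using FreeAlgebra.induction with
  | grade0 c =>
    rw [AlgHom.commutes, AlgHom.commutes, ← algebraMap_star_comm, AlgHom.commutes,
      ← algebraMap_star_comm]
  | grade1 g =>
    rw [star_mk_gen, charHom_mk, charHom_mk, FreeAlgebra.lift_ι_apply, FreeAlgebra.lift_ι_apply]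
    cases g <;> simp [charGen, Gen.conj]
  | mul x y hx hy => simp only [map_mul, star_mul, hx, hy]
  | add x y hx hy => simp only [map_add, star_add, hx, hy]

/-- The character map `σ_s : 𝒜(S²_{qs}) → C(S¹)`, the `*`-homomorphism with `A ↦ 0`, `B ↦ s u`;
its values are trigonometric polynomials. -/
noncomputable def sigma (q s : ℝ) : Sphere q s →⋆ₐ[ℂ] C(Circle, ℂ) :=
  { charHom q s with map_star' := charHom_star q s }

theorem sigma_A (q s : ℝ) : sigma q s (A q s) = 0 := by
  refine (charHom_mk q s (gen .A)).trans ?_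
  rw [FreeAlgebra.lift_ι_apply]; rfl

theorem sigma_B (q s : ℝ) : sigma q s (B q s) = (s : ℂ) • u := by
  refine (charHom_mk q s (gen .B)).trans ?_
  rw [FreeAlgebra.lift_ι_apply]; rfl

/-! ### The Hilbert space of spinors and the Dirac operator -/

/-- The labels `(l, m)` of the basis `|l,m;N⟩`: `l - |N| ∈ ℕ` and `l - |m| ∈ ℕ`. -/
def Valid (N l m : ℝ) : Prop := (∃ n : ℕ, l - |N| = n) ∧ ∃ n : ℕ, l - |m| = n

/-- The labels `(l, m, ε)` of the basis `|l,m;εN⟩` of `ℋ_N ⊕ ℋ_{-N}`, with `ε = +` for `true` and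
`ε = -` for `false`. -/
abbrev Label (N : ℝ) : Type := {p : ℝ × ℝ // Valid N p.1 p.2} × Bool

/-- The quantum number `l` of a label. -/
def Label.l {N : ℝ} (x : Label N) : ℝ := x.1.1.1

/-- The label with the opposite sign of `N`. -/
def Label.flip {N : ℝ} (x : Label N) : Label N := (x.1, !x.2)

/-- The Hilbert space `ℋ = ℋ_N ⊕ ℋ_{-N}` with orthonormal basis `|l,m;±N⟩`. -/
abbrev Spinors (N : ℝ) : Type := lp (fun _ : Label N => ℂ) 2

open Classical in
/-- The basis vector `|l,m;±N⟩`, and `0` if `(l, m)` is not an admissible label. -/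
noncomputable def ket (N : ℝ) (ε : Bool) (l m : ℝ) : Spinors N :=
  if h : Valid N l m then lp.single 2 ((⟨(l, m), h⟩, ε) : Label N) (1 : ℂ) else 0

/-- The eigenvalue `l - |N| + 1` of `|D|` on `|l,m;±N⟩`. -/
noncomputable def eigenvalue {N : ℝ} (x : Label N) : ℝ := x.l - |N| + 1

theorem one_le_eigenvalue {N : ℝ} (x : Label N) : 1 ≤ eigenvalue x := by
  obtain ⟨n, hn⟩ := x.1.2.1
  have : eigenvalue x = n + 1 := by rw [← hn]; rfl
  rw [this]
  have := n.cast_nonneg (α := ℝ)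
  linarith

/-- The isospectral Dirac operator `D |l,m;±N⟩ = (l - |N| + 1) |l,m;∓N⟩`, self-adjoint on its
maximal domain. -/
noncomputable def dirac (N : ℝ) : Spinors N →ₗ.[ℂ] Spinors N where
  domain :=
    { carrier := {v | Memℓp (fun x => (eigenvalue x : ℂ) * v x.flip) 2}
      add_mem' := fun {v w} hv hw => by
        have h := Memℓp.add hv hw
        refine (iff_of_eq (congrArg (fun f => Memℓp f 2) ?_)).mp h
        funext x
        exact (mul_add _ _ _).symm
      zero_mem' := by
        refine (iff_of_eq (congrArg (fun f => Memℓp f 2) ?_)).mp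
          (zero_memℓp (E := fun _ : Label N => ℂ))
        funext x
        exact (mul_zero _).symm
      smul_mem' := fun c v hv => by
        have h := Memℓp.const_smul hv c
        refine (iff_of_eq (congrArg (fun f => Memℓp f 2) ?_)).mp h
        funext x
        exact (mul_left_comm _ _ _).symm }
  toFun :=
    { toFun := fun v => ⟨fun x => (eigenvalue x : ℂ) * v.1 x.flip, v.2⟩
      map_add' := fun v w => by
        ext x
        exact mul_add _ _ _
      map_smul' := fun c v => by
        ext x
        exact mul_left_comm _ _ _ }

theorem norm_eigenvalue_cpow_le {N : ℝ} (z : ℂ) (hz : 0 ≤ z.re) (x : Label N) :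
    ‖(eigenvalue x : ℂ) ^ (-z)‖ ≤ 1 := by
  have h := one_le_eigenvalue x
  rw [Complex.norm_cpow_eq_rpow_re_of_pos (by linarith)]
  exact Real.rpow_le_one_of_one_le_of_nonpos h (by simpa using hz)

theorem memℓp_mul_of_norm_le_one {ι : Type} (c : ι → ℂ) (hc : ∀ i, ‖c i‖ ≤ 1)
    (v : lp (fun _ : ι => ℂ) 2) : Memℓp (fun i => c i * v i) 2 := by
  refine (lp.memℓp v).mono' fun i => ?_
  rw [norm_mul]
  exact mul_le_of_le_one_left (norm_nonneg _) (hc i)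

/-- The complex power `|D|^{-z}`, `Re z ≥ 0`, of the absolute value of the Dirac operator:
the bounded operator `|l,m;±N⟩ ↦ (l - |N| + 1)^{-z} |l,m;±N⟩`. -/
noncomputable def absDiracPow (N : ℝ) (z : ℂ) (hz : 0 ≤ z.re) : Spinors N →L[ℂ] Spinors N :=
  LinearMap.mkContinuous
    { toFun := fun v => ⟨fun x => (eigenvalue x : ℂ) ^ (-z) * v x,
        memℓp_mul_of_norm_le_one _ (norm_eigenvalue_cpow_le z hz) v⟩
      map_add' := fun v w => by
        ext x
        exact mul_add _ _ _
      map_smul' := fun c v => by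
        ext x
        exact mul_left_comm _ _ _ } 1 (fun v => by
      rw [one_mul]
      refine lp.norm_mono two_ne_zero fun x => ?_
      refine (norm_mul _ _).le.trans ?_
      exact mul_le_of_le_one_left (norm_nonneg _) (norm_eigenvalue_cpow_le z hz x))

theorem absDiracPow_apply (N : ℝ) (z : ℂ) (hz : 0 ≤ z.re) (v : Spinors N) (x : Label N) :
    absDiracPow N z hz v x = (eigenvalue x : ℂ) ^ (-z) * v x := rfl

/-- `|D|^{-z}` is the function `|·|^{-z}` of `D`: it multiplies an eigenvector of `D` with
eigenvalue `μ` by `|μ|^{-z}`. -/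
theorem absDiracPow_of_eigenvector (N : ℝ) (z : ℂ) (hz : 0 ≤ z.re) (v : (dirac N).domain) (μ : ℂ)
    (hv : dirac N v = μ • (v : Spinors N)) :
    absDiracPow N z hz v = ((‖μ‖ : ℂ) ^ (-z)) • (v : Spinors N) := by
  ext x
  have key : ∀ y : Label N, (eigenvalue y : ℂ) * (v : Spinors N) y.flip = μ * (v : Spinors N) y :=
    fun y => congrArg (fun w : Spinors N => w y) hv
  have h1 := key x
  have h2 := key x.flip
  have hf : x.flip.flip = x := by
    obtain ⟨p, b⟩ := x
    exact congrArg (Prod.mk p) (Bool.not_not b)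
  have he : eigenvalue x.flip = eigenvalue x := rfl
  rw [hf, he] at h2
  rw [absDiracPow_apply]
  change _ = _ * (v : Spinors N) x
  by_cases h0 : (v : Spinors N) x = 0
  · rw [h0, mul_zero, mul_zero]
  · have h3 : (eigenvalue x : ℂ) ^ 2 = μ ^ 2 := by
      apply mul_right_cancel₀ h0
      linear_combination (eigenvalue x : ℂ) * h2 + μ * h1
    have h4 : eigenvalue x = ‖μ‖ := by
      have h5 := congrArg norm h3
      rw [norm_pow, norm_pow, Complex.norm_real, Real.norm_eq_abs] at h5
      have h6 := (pow_left_inj₀ (abs_nonneg _) (norm_nonneg _) two_ne_zero).mp h5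
      rwa [abs_of_nonneg (by linarith [one_le_eigenvalue x])] at h6
    rw [h4]

/-! ### The equivariant representation -/

/-- The `q`-number `[x] = (q^x - q^{-x}) / (q - q^{-1})`. -/
noncomputable def qNum (q x : ℝ) : ℝ := (q ^ x - q ^ (-x)) / (q - q⁻¹)

/-- The coefficient `α_{N,l}(s)`. -/
noncomputable def alphaCoeff (q s N l : ℝ) : ℝ :=
  1 / qNum q (2 * l)
    * √(qNum q 2 * qNum q (l + N) * qNum q (l - N) / (qNum q (2 * l - 1) * qNum q (2 * l + 1)))
    * √((q ^ (l + N) + q ^ (-(l + N)) * s ^ 2) * (q ^ (l - N) * s ^ 2 + q ^ (-(l - N))))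

/-- The coefficient `β_{N,l}(s)`. -/
noncomputable def betaCoeff (q s N l : ℝ) : ℝ :=
  ((qNum q (2 * l) - q ^ (l + N + 1) * qNum q 2 * qNum q (l - N)) * (1 - s ^ 2)
      + q * qNum q 2 * qNum q (2 * N) * s ^ 2)
    / (q ^ 2 * qNum q (2 * l) * qNum q (2 * l + 2))

/-- `A⁺_{l,m}` -/
noncomputable def coeffAPlus (q s N l m : ℝ) : ℝ :=
  q ^ m * √(qNum q 2 * qNum q (l - m + 1) * qNum q (l + m + 1)) * alphaCoeff q s N (l + 1)

/-- `A⁰_{l,m}` -/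
noncomputable def coeffAZero (q s N l m : ℝ) : ℝ :=
  (qNum q (2 * l) - q ^ (l + m + 1) * qNum q 2 * qNum q (l - m)) * betaCoeff q s N l

/-- `B⁺_{l,m}` -/
noncomputable def coeffBPlus (q s N l m : ℝ) : ℝ :=
  q ^ (-l + m) * √(qNum q (l + m + 1) * qNum q (l + m + 2)) * alphaCoeff q s N (l + 1)

/-- `B⁰_{l,m}` -/
noncomputable def coeffBZero (q s N l m : ℝ) : ℝ :=
  -(q ^ (m + 2) * √(qNum q 2 * qNum q (l - m) * qNum q (l + m + 1)) * betaCoeff q s N l)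

/-- `B⁻_{l,m}` -/
noncomputable def coeffBMinus (q s N l m : ℝ) : ℝ :=
  -(q ^ (l + m + 1) * √(qNum q (l - m) * qNum q (l - m - 1)) * alphaCoeff q s N l)

/-- The generator `x₁ = (q[2])^{1/2} B`. -/
noncomputable def xOne (q s : ℝ) : Sphere q s := ((√(q * qNum q 2) : ℝ) : ℂ) • B q s

/-- The generator `x₀ = -q[2] A + (1 - s²)`. -/
noncomputable def xZero (q s : ℝ) : Sphere q s :=
  algebraMap ℂ _ (1 - (s : ℂ) ^ 2) - ((q * qNum q 2 : ℝ) : ℂ) • A q s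

/-- The value `N` or `-N` according to the sign. -/
def signed (N : ℝ) (ε : Bool) : ℝ := if ε then N else -N

/-- `π` is the direct sum on `ℋ_N ⊕ ℋ_{-N}` of the equivariant representations of `𝒜(S²_{qs})`,
given on the generators `x₀`, `x₁` by their matrix coefficients. These determine `π`, since it is a
`*`-homomorphism into bounded operators. -/
structure IsEquivariantRep (q s N : ℝ)
    (π : Sphere q s →⋆ₐ[ℂ] (Spinors N →L[ℂ] Spinors N)) : Prop where
  x_zero : ∀ (ε : Bool) (l m : ℝ), Valid N l m →
    π (xZero q s) (ket N ε l m)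
      = (coeffAPlus q s (signed N ε) l m : ℂ) • ket N ε (l + 1) m
        + (coeffAZero q s (signed N ε) l m : ℂ) • ket N ε l m
        + (coeffAPlus q s (signed N ε) (l - 1) m : ℂ) • ket N ε (l - 1) m
  x_one : ∀ (ε : Bool) (l m : ℝ), Valid N l m →
    π (xOne q s) (ket N ε l m)
      = (coeffBPlus q s (signed N ε) l m : ℂ) • ket N ε (l + 1) (m + 1)
        + (coeffBZero q s (signed N ε) l m : ℂ) • ket N ε l (m + 1)
        + (coeffBMinus q s (signed N ε) l m : ℂ) • ket N ε (l - 1) (m + 1)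

/-! ### Traces, zeta functions and the noncommutative integral -/

/-- `T` is of trace class: it is a sum `∑ₙ ⟨yₙ, ·⟩ xₙ` with `∑ₙ ‖xₙ‖ ‖yₙ‖ < ∞`. -/
def IsTraceClass {H : Type} [NormedAddCommGroup H] [InnerProductSpace ℂ H] (T : H →L[ℂ] H) :
    Prop :=
  ∃ x y : ℕ → H, Summable (fun n => ‖x n‖ * ‖y n‖) ∧
    ∀ v, HasSum (fun n => inner ℂ (y n) v • x n) (T v)

/-- `T` is of trace class with trace `t`, the sum of the diagonal matrix elements in every
orthonormal basis. -/
def HasTrace {H : Type} [NormedAddCommGroup H] [InnerProductSpace ℂ H] (T : H →L[ℂ] H) (t : ℂ) :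
    Prop :=
  IsTraceClass T ∧
    ∀ (ι : Type) (b : HilbertBasis ι ℂ H), HasSum (fun i => inner ℂ (b i) (T (b i))) t

/-- `ζ` is the zeta function `ζ_T(z) = Tr(T |D|^{-z})`: a meromorphic function on `ℂ` that for
`Re z > 2` is the trace of the trace class operator `T |D|^{-z}`. -/
def IsZetaFunction (N : ℝ) (T : Spinors N →L[ℂ] Spinors N) (ζ : ℂ → ℂ) : Prop :=
  Meromorphic ζ ∧
    ∀ (z : ℂ) (hz : 2 < z.re), HasTrace (T ∘L absDiracPow N z (by linarith)) (ζ z)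

/-- `f` has residue `r` at `z₀`: the integral of `f` over every small circle around `z₀` is
`2πi r`. -/
def HasResidue (f : ℂ → ℂ) (z₀ r : ℂ) : Prop :=
  ∀ᶠ ρ : ℝ in nhdsWithin 0 (Set.Ioi 0),
    (∮ z in C(z₀, ρ), f z) = 2 * Real.pi * Complex.I * r

/-- The noncommutative integral `⨍ T |D|^{-2} = Res_{z=2} Tr(T |D|^{-z})` exists and equals `r`. -/
def HasNCIntegral (N : ℝ) (T : Spinors N →L[ℂ] Spinors N) (r : ℂ) : Prop :=
  ∃ ζ : ℂ → ℂ, IsZetaFunction N T ζ ∧ HasResidue ζ 2 r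

end Podles

set_option linter.unusedSimpArgs false

namespace Podles

/-! Why the integral formula holds. Let the n-th shell consist of the basis vectors with l = |N| +
n, on which |D| is n + 1; with K = 2|N| it has dimension 2(2n + K + 1). The whole question is the
size of the trace of π(a) over this shell. If it equals c(n + 1) + c' + O(rⁿ) with r < 1, then
ζ_a(z) = c ζ(z − 1) + c' ζ(z) + (entire function), so ζ_a is meromorphic and its residue at z = 2 is
c (`IsAsymptoticallyAffine.exists_zeta`). It remains to identify c with (2/π)∫σ_s(a).

The relations allow every element to be written as a combination of Aᵏ Bʲ and Aᵏ B*ʲ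
(`mem_monomialSpan`). For j ≠ 0 such a monomial changes the weight m, so its diagonal is zero, and
its symbol is either zero or a nontrivial Fourier mode, so its integral is zero. For the unit, the
shell trace is the dimension 4(n + 1) + 2K − 2, and (2/π)·2π = 4. For Aᵏ with k ≥ 1 the symbol is
zero, and the point is that the shell trace stays bounded with an exponentially small error. In the
basis, A is a symmetric tridiagonal operator in l at fixed m. With i = l + m, its coefficients agree
up to O(q^l) with limits that depend on i only and decay like q^i
(`IsEquivariantRep.isAsymptoticJacobi_A`). By induction on k the diagonal of Aᵏ is F(i) + O(q^l)
with F(i) = O(q^i) (`IsAsymptoticJacobi.exists_limit`). Summed over i this gives ∑F up to an error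
O(√qⁿ), hence c = 0 (`isAsymptoticallyAffine_sum_of_limit`).

Existence of the representation is a separate computation. In terms of x₀ and x₁ each relation is an
identity between operators that are banded in l, so it amounts to finitely many coefficient
identities; these rest on a recursion for β, a recursion for α², and the two diagonal identities
`diag_star_mul` and `diag_mul_star`. Boundedness is a consequence of the relation for B*B: its
diagonal coefficient is a positive combination of the squares of all matrix elements in a column,
plus a linear term and a constant (`exists_coeff_bound`). Uniqueness holds because the basis vectors
determine a bounded operator, and A and B generate the *-algebra. -/

/-! ### Identities for α and β as rational functions of powers of q. -/

theorem qNum_eq {q : ℝ} (hq : 0 < q) (x : ℝ) : qNum q x = (q ^ x - (q ^ x)⁻¹) / (q - q⁻¹) := by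
  rw [qNum, Real.rpow_neg hq.le]

theorem pow_mul_pow_sub_one_ne_zero {q x : ℝ} (hq : 0 < q) (hq1 : q < 1) (hx : 0 < x) (hx1 : x < 1)
    (a b : ℕ) (hb : b ≠ 0) : q ^ a * x ^ b - 1 ≠ 0 := by
  have h1 := pow_le_one₀ hq.le hq1.le (n := a)
  have h2 := pow_lt_one₀ hx.le hx1 hb
  have := mul_lt_mul_of_pos_left h2 (pow_pos hq a)
  linarith

/-- With X = q^l and T = q^M this is an identity of rational functions, whose denominators 1 −
q^(4j) X⁴ are nonzero because 0 < X < 1. It settles the coefficients that change l by one, in all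
three relations. -/
theorem betaCoeff_rec {q s M l : ℝ} (hq : 0 < q) (hq1 : q < 1) (hl : 0 < l) :
    q ^ 2 * qNum q (2 * l + 4) * betaCoeff q s M (l + 1) - q ^ 2 * qNum q (2 * l) *
      betaCoeff q s M l
      = (1 - q ^ 2) * (1 - s ^ 2) := by
  have hX1 : q ^ l < 1 := Real.rpow_lt_one hq.le hq1 hl
  have hX : 0 < q ^ l := Real.rpow_pos_of_pos hq _
  have hT : 0 < q ^ M := Real.rpow_pos_of_pos hq _
  simp only [betaCoeff, qNum_eq hq, two_mul, Real.rpow_add hq, Real.rpow_sub hq, Real.rpow_one,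
    Real.rpow_ofNat, mul_add]
  generalize q ^ l = X at *
  generalize q ^ M = T at *
  have h1 : q ^ 2 - 1 ≠ 0 := by nlinarith
  have h2 : X ^ 4 - 1 ≠ 0 := by simpa using pow_mul_pow_sub_one_ne_zero hq hq1 hX hX1 0 4 (by simp)
  have h3 := pow_mul_pow_sub_one_ne_zero hq hq1 hX hX1 4 4 (by simp)
  have h4 := pow_mul_pow_sub_one_ne_zero hq hq1 hX hX1 8 4 (by simp)
  field_simp
  ring

/-- The value of `[2l-1] α_l²`. -/
noncomputable def alphaLow (q s M l : ℝ) : ℝ :=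
  qNum q 2 * qNum q (l + M) * qNum q (l - M) * ((q ^ (l + M) + q ^ (-(l + M)) * s ^ 2) *
    (q ^ (l - M) * s ^ 2 + q ^ (-(l - M)))) / (qNum q (2 * l) ^ 2 * qNum q (2 * l + 1))
/-- The value of `[2l+1] α_l²`. -/
noncomputable def alphaHigh (q s M l : ℝ) : ℝ :=
  qNum q 2 * qNum q (l + M) * qNum q (l - M) * ((q ^ (l + M) + q ^ (-(l + M)) * s ^ 2) *
    (q ^ (l - M) * s ^ 2 + q ^ (-(l - M)))) / (qNum q (2 * l) ^ 2 * qNum q (2 * l - 1))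

/-- This is `diag_star_mul` at the highest weight m = l, where the terms with the factor [l − m]
drop out and only α at l + 1 survives. The right side is the quadratic polynomial of the relation
for B*B, taken at the diagonal entry of x₀. -/
theorem alphaHigh_eq {q s M l : ℝ} (hq : 0 < q) (hq1 : q < 1) (hl : 0 < l) :
    alphaHigh q s M (l + 1) = -(q ^ 2 * (1 - s ^ 2 - qNum q (2 * l) * betaCoeff q s M l) + q *
      qNum q 2 * s ^ 2) *
      (q * (1 - s ^ 2 - qNum q (2 * l) * betaCoeff q s M l) - qNum q 2) / (q * qNum q 2 *
        qNum q (2 * l + 1)) := by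
  have hX1 : q ^ l < 1 := Real.rpow_lt_one hq.le hq1 hl
  have hX : 0 < q ^ l := Real.rpow_pos_of_pos hq _
  have hT : 0 < q ^ M := Real.rpow_pos_of_pos hq _
  simp only [alphaHigh, betaCoeff, qNum_eq hq, two_mul, Real.rpow_add hq, Real.rpow_sub hq,
    Real.rpow_neg hq.le, Real.rpow_one, Real.rpow_ofNat, mul_add]
  generalize q ^ l = X at *
  generalize q ^ M = T at *
  have h1 : q ^ 2 - 1 ≠ 0 := by nlinarith
  have h0 : q ^ 4 - 1 ≠ 0 := by simpa using pow_mul_pow_sub_one_ne_zero hq hq1 hq hq1 0 4 (by simp)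
  have h2 : X ^ 4 - 1 ≠ 0 := by simpa using pow_mul_pow_sub_one_ne_zero hq hq1 hX hX1 0 4 (by simp)
  have h3 := pow_mul_pow_sub_one_ne_zero hq hq1 hX hX1 4 4 (by simp)
  have h4 := pow_mul_pow_sub_one_ne_zero hq hq1 hX hX1 2 4 (by simp)
  field_simp
  ring

/-- This is `diag_star_mul` at the formal value m = −l − 1, where [l + m + 1] = 0 and, since [2][2l
+ 1] = [2l] + [2l + 2], the diagonal entry of x₀ becomes −[2l + 2]β. -/
theorem alphaLow_eq {q s M l : ℝ} (hq : 0 < q) (hq1 : q < 1) (hl : 0 < l) :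
    alphaLow q s M l = -(q ^ 2 * (1 - s ^ 2 + qNum q (2 * l + 2) * betaCoeff q s M l) + q *
      qNum q 2 * s ^ 2) *
      (q * (1 - s ^ 2 + qNum q (2 * l + 2) * betaCoeff q s M l) - qNum q 2) / (q * qNum q 2 *
        qNum q (2 * l + 1)) := by
  have hX1 : q ^ l < 1 := Real.rpow_lt_one hq.le hq1 hl
  have hX : 0 < q ^ l := Real.rpow_pos_of_pos hq _
  have hT : 0 < q ^ M := Real.rpow_pos_of_pos hq _
  simp only [alphaLow, betaCoeff, qNum_eq hq, two_mul, Real.rpow_add hq, Real.rpow_sub hq,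
    Real.rpow_neg hq.le, Real.rpow_one, Real.rpow_ofNat, mul_add]
  generalize q ^ l = X at *
  generalize q ^ M = T at *
  have h1 : q ^ 2 - 1 ≠ 0 := by nlinarith
  have h0 : q ^ 4 - 1 ≠ 0 := by simpa using pow_mul_pow_sub_one_ne_zero hq hq1 hq hq1 0 4 (by simp)
  have h2 : X ^ 4 - 1 ≠ 0 := by simpa using pow_mul_pow_sub_one_ne_zero hq hq1 hX hX1 0 4 (by simp)
  have h3 := pow_mul_pow_sub_one_ne_zero hq hq1 hX hX1 4 4 (by simp)
  have h4 := pow_mul_pow_sub_one_ne_zero hq hq1 hX hX1 2 4 (by simp)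
  field_simp
  ring

/-- Needed for the coefficient of the commutation relation that keeps l, the only one there in which
α appears squared. -/
theorem alpha_rec {q s M l : ℝ} (hq : 0 < q) (hq1 : q < 1) (hl : 0 < l) :
    alphaHigh q s M (l + 1) - alphaLow q s M l = -(1 - q ^ 2) * (1 - s ^ 2) * betaCoeff q s M l
      + ((1 - q ^ 2) * qNum q (2 * l) + q ^ (2 * l) * q ^ 2 * qNum q 2) * betaCoeff q s M l ^ 2 :=
        by
  have hX1 : q ^ l < 1 := Real.rpow_lt_one hq.le hq1 hl
  have hX : 0 < q ^ l := Real.rpow_pos_of_pos hq _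
  have hT : 0 < q ^ M := Real.rpow_pos_of_pos hq _
  simp only [alphaHigh, alphaLow, betaCoeff, qNum_eq hq, two_mul, Real.rpow_add hq,
    Real.rpow_sub hq, Real.rpow_neg hq.le, Real.rpow_one, Real.rpow_ofNat, mul_add]
  generalize q ^ l = X at *
  generalize q ^ M = T at *
  have h1 : q ^ 2 - 1 ≠ 0 := by nlinarith
  have h2 : X ^ 4 - 1 ≠ 0 := by simpa using pow_mul_pow_sub_one_ne_zero hq hq1 hX hX1 0 4 (by simp)
  have h3 := pow_mul_pow_sub_one_ne_zero hq hq1 hX hX1 4 4 (by simp)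
  have h4 := pow_mul_pow_sub_one_ne_zero hq hq1 hX hX1 2 4 (by simp)
  field_simp
  ring

theorem qNum_two {q : ℝ} (hq : 0 < q) (hq1 : q < 1) : qNum q 2 = q + q⁻¹ := by
  have h1 : q ^ 2 - 1 ≠ 0 := by nlinarith
  rw [qNum_eq hq, Real.rpow_two]
  field_simp
  ring

theorem qNum_pos {q x : ℝ} (hq : 0 < q) (hq1 : q < 1) (hx : 0 < x) : 0 < qNum q x := by
  have h1 : q ^ x < q ^ (-x) := Real.rpow_lt_rpow_of_exponent_gt hq hq1 (by linarith)
  have h2 : q < q⁻¹ := hq1.trans ((one_lt_inv₀ hq).2 hq1)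
  exact div_pos_of_neg_of_neg (by linarith) (by linarith)

/-- The diagonal of the relation for B*B, after the contributions of A and B to each α² have been
merged and the relation divided by q[2]². Merging produces [2l + 3]α² at l + 1 and [2l − 1]α² at l,
hence the two normalizations `alphaHigh` and `alphaLow`. -/
theorem diag_star_mul {q s M l m : ℝ} (hq : 0 < q) (hq1 : q < 1) (hl : 0 < l) :
    q ^ (m - l + 1) * qNum q (l + m + 1) * alphaHigh q s M (l + 1)
      + q ^ (m + l + 2) * qNum q (l - m) * alphaLow q s M l
      + q ^ (2 * m + 4) * qNum q 2 * qNum q (l - m) * qNum q (l + m + 1) * betaCoeff q s M l ^ 2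
      + (q ^ 2 * (1 - s ^ 2 - coeffAZero q s M l m) + q * qNum q 2 * s ^ 2)
        * (q * (1 - s ^ 2 - coeffAZero q s M l m) - qNum q 2) / qNum q 2 = 0 := by
  have hb := (qNum_pos hq hq1 (show 0 < 2 * l + 1 by linarith)).ne'
  have h1 : q ^ 2 - 1 ≠ 0 := by nlinarith
  rw [alphaHigh_eq hq hq1 hl, alphaLow_eq hq hq1 hl, coeffAZero]
  -- With α² written through β, the claim holds for every value of β, so its definition can be
  -- forgotten.
  generalize betaCoeff q s M l = β
  -- All exponents that occur are integer combinations of l + m, l − m and 1, so p and r make the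
  -- claim rational; q^l alone would not be rational in them.
  obtain ⟨p, hp⟩ : ∃ p, p = q ^ (l + m) := ⟨_, rfl⟩
  obtain ⟨r, hr⟩ : ∃ r, r = q ^ (l - m) := ⟨_, rfl⟩
  have hp0 : 0 < p := hp ▸ Real.rpow_pos_of_pos hq _
  have hr0 : 0 < r := hr ▸ Real.rpow_pos_of_pos hq _
  have hX : 0 < q ^ l := Real.rpow_pos_of_pos hq _
  have hY : 0 < q ^ m := Real.rpow_pos_of_pos hq _
  rw [Real.rpow_add hq] at hp
  rw [Real.rpow_sub hq] at hr
  have e1 : q ^ (m - l + 1) = q / r := by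
    simp only [two_mul, Real.rpow_add hq, Real.rpow_sub hq, Real.rpow_ofNat, Real.rpow_one, hp, hr]
    field_simp
  have e2 : q ^ (m + l + 2) = p * q ^ 2 := by
    simp only [two_mul, Real.rpow_add hq, Real.rpow_sub hq, Real.rpow_ofNat, Real.rpow_one, hp, hr]
    field_simp
  have e3 : q ^ (2 * m + 4) = q ^ 4 * p / r := by
    simp only [two_mul, Real.rpow_add hq, Real.rpow_sub hq, Real.rpow_ofNat, Real.rpow_one, hp, hr]
    field_simp
  have e4 : q ^ (l + m + 1) = p * q := by
    simp only [two_mul, Real.rpow_add hq, Real.rpow_sub hq, Real.rpow_ofNat, Real.rpow_one, hp, hr]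
  have e5 : qNum q (l - m) = (r - (r)⁻¹) / (q - q⁻¹) := by
    simp only [qNum_eq hq, two_mul, Real.rpow_add hq, Real.rpow_sub hq, Real.rpow_ofNat,
      Real.rpow_one, hp, hr]
  have e6 : qNum q (l + m + 1) = (p * q - (p * q)⁻¹) / (q - q⁻¹) := by
    simp only [qNum_eq hq, two_mul, Real.rpow_add hq, Real.rpow_sub hq, Real.rpow_ofNat,
      Real.rpow_one, hp, hr]
  have e7 : qNum q (2 * l) = (p * r - (p * r)⁻¹) / (q - q⁻¹) := by
    simp only [qNum_eq hq, two_mul, Real.rpow_add hq, Real.rpow_sub hq, Real.rpow_ofNat,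
      Real.rpow_one, hp, hr]
    field_simp
  have e8 : qNum q (2 * l + 2) = (p * r * q ^ 2 - (p * r * q ^ 2)⁻¹) / (q - q⁻¹) := by
    simp only [qNum_eq hq, two_mul, Real.rpow_add hq, Real.rpow_sub hq, Real.rpow_ofNat,
      Real.rpow_one, hp, hr]
    field_simp
  have e9 : qNum q (2 * l + 1) = (p * r * q - (p * r * q)⁻¹) / (q - q⁻¹) := by
    simp only [qNum_eq hq, two_mul, Real.rpow_add hq, Real.rpow_sub hq, Real.rpow_ofNat,
      Real.rpow_one, hp, hr]
    field_simp
  have hk := qNum_two hq hq1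
  have hb' : q ^ 2 * r ^ 2 * p ^ 2 - 1 ≠ 0 := by
    intro h
    refine hb ?_
    rw [e9]
    field_simp
    linarith
  rw [e1, e2, e3, e4, e5, e6, e7, e8, e9, hk]
  have h0 : q ^ 2 + 1 ≠ 0 := by positivity
  field_simp
  ring

/-- The same for BB*, where the column is reached through the weight m − 1; the substitution of α²
by polynomials in β again makes it an identity valid for every β. -/
theorem diag_mul_star {q s M l m : ℝ} (hq : 0 < q) (hq1 : q < 1) (hl : 0 < l) :
    q ^ (m + l + 1) * qNum q (l - m + 1) * alphaHigh q s M (l + 1)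
      + q ^ (m - l) * qNum q (l + m) * alphaLow q s M l
      + q ^ (2 * m + 2) * qNum q 2 * qNum q (l - m + 1) * qNum q (l + m) * betaCoeff q s M l ^ 2
      + (1 - s ^ 2 - coeffAZero q s M l m + q * qNum q 2 * s ^ 2)
        * (1 - s ^ 2 - coeffAZero q s M l m - q * qNum q 2) / (q * qNum q 2) = 0 := by
  have hb := (qNum_pos hq hq1 (show 0 < 2 * l + 1 by linarith)).ne'
  have h1 : q ^ 2 - 1 ≠ 0 := by nlinarith
  rw [alphaHigh_eq hq hq1 hl, alphaLow_eq hq hq1 hl, coeffAZero]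
  generalize betaCoeff q s M l = β
  obtain ⟨p, hp⟩ : ∃ p, p = q ^ (l + m) := ⟨_, rfl⟩
  obtain ⟨r, hr⟩ : ∃ r, r = q ^ (l - m) := ⟨_, rfl⟩
  have hp0 : 0 < p := hp ▸ Real.rpow_pos_of_pos hq _
  have hr0 : 0 < r := hr ▸ Real.rpow_pos_of_pos hq _
  have hX : 0 < q ^ l := Real.rpow_pos_of_pos hq _
  have hY : 0 < q ^ m := Real.rpow_pos_of_pos hq _
  rw [Real.rpow_add hq] at hp
  rw [Real.rpow_sub hq] at hr
  have e1 : q ^ (m + l + 1) = p * q := by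
    simp only [two_mul, Real.rpow_add hq, Real.rpow_sub hq, Real.rpow_ofNat, Real.rpow_one, hp, hr]
    ring
  have e2 : q ^ (m - l) = r⁻¹ := by
    simp only [two_mul, Real.rpow_add hq, Real.rpow_sub hq, Real.rpow_ofNat, Real.rpow_one, hp, hr]
    field_simp
  have e3 : q ^ (2 * m + 2) = q ^ 2 * p / r := by
    simp only [two_mul, Real.rpow_add hq, Real.rpow_sub hq, Real.rpow_ofNat, Real.rpow_one, hp, hr]
    field_simp
  have e4 : q ^ (l + m + 1) = p * q := by
    simp only [two_mul, Real.rpow_add hq, Real.rpow_sub hq, Real.rpow_ofNat, Real.rpow_one, hp, hr]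
  have e10 : qNum q (l - m + 1) = (r * q - (r * q)⁻¹) / (q - q⁻¹) := by
    simp only [qNum_eq hq, Real.rpow_add hq, Real.rpow_sub hq, Real.rpow_one, hr]
  have e5 : qNum q (l - m) = (r - (r)⁻¹) / (q - q⁻¹) := by
    simp only [qNum_eq hq, two_mul, Real.rpow_add hq, Real.rpow_sub hq, Real.rpow_ofNat,
      Real.rpow_one, hp, hr]
  have e6 : qNum q (l + m) = (p - (p)⁻¹) / (q - q⁻¹) := by
    simp only [qNum_eq hq, two_mul, Real.rpow_add hq, Real.rpow_sub hq, Real.rpow_ofNat,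
      Real.rpow_one, hp, hr]
  have e7 : qNum q (2 * l) = (p * r - (p * r)⁻¹) / (q - q⁻¹) := by
    simp only [qNum_eq hq, two_mul, Real.rpow_add hq, Real.rpow_sub hq, Real.rpow_ofNat,
      Real.rpow_one, hp, hr]
    field_simp
  have e8 : qNum q (2 * l + 2) = (p * r * q ^ 2 - (p * r * q ^ 2)⁻¹) / (q - q⁻¹) := by
    simp only [qNum_eq hq, two_mul, Real.rpow_add hq, Real.rpow_sub hq, Real.rpow_ofNat,
      Real.rpow_one, hp, hr]
    field_simp
  have e9 : qNum q (2 * l + 1) = (p * r * q - (p * r * q)⁻¹) / (q - q⁻¹) := by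
    simp only [qNum_eq hq, two_mul, Real.rpow_add hq, Real.rpow_sub hq, Real.rpow_ofNat,
      Real.rpow_one, hp, hr]
    field_simp
  have hk := qNum_two hq hq1
  have hb' : p ^ 2 * q ^ 2 * r ^ 2 - 1 ≠ 0 := by
    intro h
    refine hb ?_
    rw [e9]
    field_simp
    linarith
  rw [e10, e1, e2, e3, e4, e5, e6, e7, e8, e9, hk]
  have h0 : q ^ 2 + 1 ≠ 0 := by positivity
  field_simp
  ring

/-! ### The relations, one matrix coefficient at a time. -/

/-- Normal form for the powers in the coefficients: monomials in q^l, q^(−l+m) and q. In these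
variables the identities become polynomial, apart from a few inverse powers of q. -/
theorem rpow_eq_mul {q x l m : ℝ} (hq : 0 < q) (a c : ℕ) (h : x = a * l + (-l + m) + c) :
    q ^ x = (q ^ l) ^ a * q ^ (-l + m) * q ^ c := by
  rw [h, Real.rpow_add hq, Real.rpow_add hq, Real.rpow_natCast, mul_comm (a : ℝ),
    Real.rpow_mul hq.le, Real.rpow_natCast]

/-- Each of these q-number identities is what a coefficient of a relation leaves for a single β or
α² after the common square roots are taken out. As Laurent polynomials in q^l, q^m and q they are
verified directly. -/
theorem qNum_up_comm {q l m : ℝ} (hq : 0 < q) (hq1 : q < 1) :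
    qNum q (2 * l + 2) - (q ^ l) ^ 2 * q ^ (-l + m) * q ^ 3 * qNum q 2 * qNum q (l - m) +
      (q ^ l) ^ 2 * q ^ (-l + m) * q ^ 4 * qNum q 2 * qNum q (l - m + 1)
      = q ^ 2 * qNum q (2 * l + 4) := by
  have h1 : q ^ 2 - 1 ≠ 0 := by nlinarith
  have hX : 0 < q ^ l := Real.rpow_pos_of_pos hq _
  have hY : 0 < q ^ m := Real.rpow_pos_of_pos hq _
  simp only [qNum_eq hq, two_mul, Real.rpow_add hq, Real.rpow_sub hq, Real.rpow_neg hq.le,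
    Real.rpow_one, Real.rpow_ofNat]
  field_simp
  ring

theorem qNum_alpha_up {q l m : ℝ} (hq : 0 < q) (hq1 : q < 1) :
    q * q ^ (-l + m) * qNum q (l + m + 2) + q ^ 4 * (q ^ l) ^ 2 * q ^ (-l + m) * qNum q (l - m + 1)
      = q ^ 2 * qNum q (2 * l + 3) := by
  have h1 : q ^ 2 - 1 ≠ 0 := by nlinarith
  have hX : 0 < q ^ l := Real.rpow_pos_of_pos hq _
  have hY : 0 < q ^ m := Real.rpow_pos_of_pos hq _
  simp only [qNum_eq hq, two_mul, Real.rpow_add hq, Real.rpow_sub hq, Real.rpow_neg hq.le,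
    Real.rpow_one, Real.rpow_ofNat]
  field_simp
  ring

theorem qNum_alpha_down {q l m : ℝ} (hq : 0 < q) (hq1 : q < 1) :
    q ^ 2 * (q ^ l) ^ 2 * q ^ (-l + m) * qNum q (l - m - 1) + q ^ 3 * q ^ (-l + m) * qNum q (l + m)
      = q ^ 2 * qNum q (2 * l - 1) := by
  have h1 : q ^ 2 - 1 ≠ 0 := by nlinarith
  have hX : 0 < q ^ l := Real.rpow_pos_of_pos hq _
  have hY : 0 < q ^ m := Real.rpow_pos_of_pos hq _
  simp only [qNum_eq hq, two_mul, Real.rpow_add hq, Real.rpow_sub hq, Real.rpow_neg hq.le,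
    Real.rpow_one, Real.rpow_ofNat]
  field_simp
  ring

theorem qNum_pred_sub {q l m : ℝ} (hq : 0 < q) (hq1 : q < 1) :
    q * qNum q (l - m) - qNum q (l - m - 1)
      = q ^ (l - m) := by
  have h1 : q ^ 2 - 1 ≠ 0 := by nlinarith
  have hX : 0 < q ^ l := Real.rpow_pos_of_pos hq _
  have hY : 0 < q ^ m := Real.rpow_pos_of_pos hq _
  simp only [qNum_eq hq, two_mul, Real.rpow_add hq, Real.rpow_sub hq, Real.rpow_neg hq.le,
    Real.rpow_one, Real.rpow_ofNat]
  field_simp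
  ring

theorem qNum_down_comm {q l m : ℝ} (hq : 0 < q) (hq1 : q < 1) :
    q ^ (-l + m) * q ^ 2 * qNum q 2 * qNum q (l + m + 1) - q ^ 2 * qNum q (2 * l) + q ^ 3 *
      (q ^ l) ^ 2 * q ^ (-l + m) * qNum q 2 * qNum q (l - m)
      = q ^ 2 * qNum q (2 * l + 2) := by
  have h1 : q ^ 2 - 1 ≠ 0 := by nlinarith
  have hX : 0 < q ^ l := Real.rpow_pos_of_pos hq _
  have hY : 0 < q ^ m := Real.rpow_pos_of_pos hq _
  simp only [qNum_eq hq, two_mul, Real.rpow_add hq, Real.rpow_sub hq, Real.rpow_neg hq.le,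
    Real.rpow_one, Real.rpow_ofNat]
  field_simp
  ring

theorem qNum_down_comm_pred {q l m : ℝ} (hq : 0 < q) (hq1 : q < 1) :
    qNum q (2 * l - 2) - (q ^ l) ^ 2 * q ^ (-l + m) * q * qNum q 2 * qNum q (l - m - 2) - q ^ 3 *
      q ^ (-l + m) * qNum q 2 * qNum q (l + m)
      = -(q ^ 2 * qNum q (2 * l - 2)) := by
  have h1 : q ^ 2 - 1 ≠ 0 := by nlinarith
  have hX : 0 < q ^ l := Real.rpow_pos_of_pos hq _
  have hY : 0 < q ^ m := Real.rpow_pos_of_pos hq _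
  simp only [qNum_eq hq, two_mul, Real.rpow_add hq, Real.rpow_sub hq, Real.rpow_neg hq.le,
    Real.rpow_one, Real.rpow_ofNat]
  field_simp
  ring

theorem qNum_up_starMul {q l m : ℝ} (hq : 0 < q) (hq1 : q < 1) :
    q ^ (-l + m) * q * qNum q 2 * qNum q (l + m + 2) - q ^ 2 * qNum q (2 * l + 2) + (q ^ l) ^ 2 *
      q ^ (-l + m) * q ^ 4 * qNum q 2 * qNum q (l - m + 1)
      = q ^ 2 * qNum q (2 * l + 4) := by
  have h1 : q ^ 2 - 1 ≠ 0 := by nlinarith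
  have hX : 0 < q ^ l := Real.rpow_pos_of_pos hq _
  have hY : 0 < q ^ m := Real.rpow_pos_of_pos hq _
  simp only [qNum_eq hq, two_mul, Real.rpow_add hq, Real.rpow_sub hq, Real.rpow_neg hq.le,
    Real.rpow_one, Real.rpow_ofNat]
  field_simp
  ring

theorem qNum_up_mulStar_succ {q l m : ℝ} (hq : 0 < q) (hq1 : q < 1) :
    (q ^ l) ^ 2 * q ^ (-l + m) * q ^ 3 * qNum q 2 * qNum q (l - m + 2) + qNum q (2 * l + 2) -
      (q ^ l) ^ 2 * q ^ (-l + m) * q ^ 2 * qNum q 2 * qNum q (l - m + 1)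
      = q ^ 2 * qNum q (2 * l + 4) := by
  have h1 : q ^ 2 - 1 ≠ 0 := by nlinarith
  have hX : 0 < q ^ l := Real.rpow_pos_of_pos hq _
  have hY : 0 < q ^ m := Real.rpow_pos_of_pos hq _
  simp only [qNum_eq hq, two_mul, Real.rpow_add hq, Real.rpow_sub hq, Real.rpow_neg hq.le,
    Real.rpow_one, Real.rpow_ofNat]
  field_simp
  ring

theorem qNum_up_mulStar {q l m : ℝ} (hq : 0 < q) (hq1 : q < 1) :
    q ^ (-l + m) * q * qNum q 2 * qNum q (l + m) - qNum q (2 * l) + (q ^ l) ^ 2 * q ^ (-l + m) *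
      q * qNum q 2 * qNum q (l - m)
      = q ^ 2 * qNum q (2 * l) := by
  have h1 : q ^ 2 - 1 ≠ 0 := by nlinarith
  have hX : 0 < q ^ l := Real.rpow_pos_of_pos hq _
  have hY : 0 < q ^ m := Real.rpow_pos_of_pos hq _
  simp only [qNum_eq hq, two_mul, Real.rpow_add hq, Real.rpow_sub hq, Real.rpow_neg hq.le,
    Real.rpow_one, Real.rpow_ofNat]
  field_simp
  ring

theorem qNum_nonneg {q x : ℝ} (hq : 0 < q) (hq1 : q < 1) (hx : 0 ≤ x) : 0 ≤ qNum q x := by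
  rcases hx.eq_or_lt with rfl | hx
  · simp [qNum]
  · exact (qNum_pos hq hq1 hx).le

/-- Splitting √(xy) needs the sign of one factor only. This matters at the boundary, where [l − m +
1] is evaluated at shifted labels for which it may be [−1] < 0. -/
theorem coeffAPlus_eq {q s M l m : ℝ} (hq : 0 < q) (hq1 : q < 1) (h : 0 ≤ l + m + 1) :
    coeffAPlus q s M l m = q ^ m * (√(qNum q 2) * √(qNum q (l - m + 1)) * √(qNum q (l + m + 1)))
      * alphaCoeff q s M (l + 1) := by
  rw [coeffAPlus, Real.sqrt_mul' _ (qNum_nonneg hq hq1 h),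
    Real.sqrt_mul (qNum_nonneg hq hq1 zero_le_two)]

theorem coeffBPlus_eq {q s M l m : ℝ} (hq : 0 < q) (hq1 : q < 1) (h : 0 ≤ l + m + 2) :
    coeffBPlus q s M l m = q ^ (-l + m) * (√(qNum q (l + m + 1)) * √(qNum q (l + m + 2)))
      * alphaCoeff q s M (l + 1) := by
  rw [coeffBPlus, Real.sqrt_mul' _ (qNum_nonneg hq hq1 h)]

theorem coeffBZero_eq {q s M l m : ℝ} (hq : 0 < q) (hq1 : q < 1) (h : 0 ≤ l + m + 1) :
    coeffBZero q s M l m = -(q ^ (m + 2) * (√(qNum q 2) * √(qNum q (l - m)) * √(qNum q (l + m + 1)))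
      * betaCoeff q s M l) := by
  rw [coeffBZero, Real.sqrt_mul' _ (qNum_nonneg hq hq1 h),
    Real.sqrt_mul (qNum_nonneg hq hq1 zero_le_two)]

theorem coeffBMinus_eq {q s M l m : ℝ} (hq : 0 < q) (hq1 : q < 1) (h : 0 ≤ l - m) :
    coeffBMinus q s M l m = -(q ^ (l + m + 1) * (√(qNum q (l - m)) * √(qNum q (l - m - 1)))
      * alphaCoeff q s M l) := by
  rw [coeffBMinus, Real.sqrt_mul (qNum_nonneg hq hq1 h)]

/-- In the generators x₀, x₁ the relation AB = q²BA reads x₀x₁ − q²x₁x₀ = (1 − q²)(1 − s²)x₁. The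
`comm_coeff` lemmas are its five coefficients, sorted by the change of l; here both products are the
same up to the order of the factors. -/
theorem comm_coeff_up_two {q s M l m : ℝ} (hq : 0 < q) (hq1 : q < 1) (h₂ : 0 ≤ l + m) :
    coeffAPlus q s M (l + 1) (m + 1) * coeffBPlus q s M l m
      = q ^ 2 * (coeffBPlus q s M (l + 1) m * coeffAPlus q s M l m) := by
  have hX : 0 < q ^ l := Real.rpow_pos_of_pos hq _
  have hY : 0 < q ^ m := Real.rpow_pos_of_pos hq _
  have a1w : q ^ (m + 1) = (q ^ l * q ^ (-l + m) * q ^ 1) := by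
    simpa using rpow_eq_mul hq 1 1 (by push_cast; ring)
  have a1 : coeffAPlus q s M (l + 1) (m + 1) = (q ^ l * q ^ (-l + m) * q ^ 1) *
    (√(qNum q 2) * √(qNum q (l - m + 1)) * √(qNum q (l + m + 3))) * alphaCoeff q s M (l + 2) := by
    rw [coeffAPlus_eq hq hq1 (by linarith), a1w, show l + 1 - (m + 1) + 1 = l - m + 1 by ring,
      show l + 1 + (m + 1) + 1 = l + m + 3 by ring, show l + 1 + 1 = l + 2 by ring]
  have b1 : coeffBPlus q s M (l) (m) = (q ^ (-l + m)) * (√(qNum q (l + m + 1)) *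
    √(qNum q (l + m + 2))) * alphaCoeff q s M (l + 1) := by
    rw [coeffBPlus_eq hq hq1 (by linarith)]
  have b2w : q ^ (-(l + 1) + m) = (q ^ (-l + m) * (q ^ 1)⁻¹) := by
    simp only [Real.rpow_add hq, Real.rpow_sub hq, Real.rpow_neg hq.le, Real.rpow_one,
      Real.rpow_ofNat, neg_add, neg_sub]
    field_simp
  have b2 : coeffBPlus q s M (l + 1) (m) = (q ^ (-l + m) * (q ^ 1)⁻¹) *
    (√(qNum q (l + m + 2)) * √(qNum q (l + m + 3))) * alphaCoeff q s M (l + 2) := by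
    rw [coeffBPlus_eq hq hq1 (by linarith), b2w, show l + 1 + m + 1 = l + m + 2 by ring, show l +
      1 + m + 2 = l + m + 3 by ring, show l + 1 + 1 = l + 2 by ring]
  have a2w : q ^ m = (q ^ l * q ^ (-l + m)) := by
    simpa using rpow_eq_mul hq 1 0 (by push_cast; ring)
  have a2 : coeffAPlus q s M (l) (m) = (q ^ l * q ^ (-l + m)) *
    (√(qNum q 2) * √(qNum q (l - m + 1)) * √(qNum q (l + m + 1))) * alphaCoeff q s M (l + 1) := by
    rw [coeffAPlus_eq hq hq1 (by linarith), a2w]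
  rw [a1, b1, b2, a2]
  field_simp

theorem comm_coeff_up_one {q s M l m : ℝ} (hq : 0 < q) (hq1 : q < 1) (hl : 0 < l) (h₁ : 0 ≤ l - m)
    (h₂ : 0 ≤ l + m) :
    coeffAZero q s M (l + 1) (m + 1) * coeffBPlus q s M l m
      + coeffAPlus q s M l (m + 1) * coeffBZero q s M l m
      - q ^ 2 * (coeffBPlus q s M l m * coeffAZero q s M l m
        + coeffBZero q s M (l + 1) m * coeffAPlus q s M l m)
      = (1 - q ^ 2) * (1 - s ^ 2) * coeffBPlus q s M l m := by
  have hX : 0 < q ^ l := Real.rpow_pos_of_pos hq _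
  have hY : 0 < q ^ m := Real.rpow_pos_of_pos hq _
  have a1w : q ^ (l + 1 + (m + 1) + 1) = ((q ^ l) ^ 2 * q ^ (-l + m) * q ^ 3) := by
    simpa using rpow_eq_mul hq 2 3 (by push_cast; ring)
  have a1 : coeffAZero q s M (l + 1) (m + 1) = (qNum q (2 * l + 2) -
    ((q ^ l) ^ 2 * q ^ (-l + m) * q ^ 3) * qNum q 2 * qNum q (l - m)) * betaCoeff q s M (l + 1) :=
    by
    rw [coeffAZero, a1w, show 2 * (l + 1) = 2 * l + 2 by ring, show l + 1 - (m + 1) = l - m by ring]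
  have b1 : coeffBPlus q s M (l) (m) = (q ^ (-l + m)) * (√(qNum q (l + m + 1)) *
    √(qNum q (l + m + 2))) * alphaCoeff q s M (l + 1) := by
    rw [coeffBPlus_eq hq hq1 (by linarith)]
  have a2w : q ^ (m + 1) = (q ^ l * q ^ (-l + m) * q ^ 1) := by
    simpa using rpow_eq_mul hq 1 1 (by push_cast; ring)
  have a2 : coeffAPlus q s M (l) (m + 1) = (q ^ l * q ^ (-l + m) * q ^ 1) *
    (√(qNum q 2) * √(qNum q (l - m)) * √(qNum q (l + m + 2))) * alphaCoeff q s M (l + 1) := by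
    rw [coeffAPlus_eq hq hq1 (by linarith), a2w, show l - (m + 1) + 1 = l - m by ring, show l +
      (m + 1) + 1 = l + m + 2 by ring]
  have b2w : q ^ (m + 2) = (q ^ l * q ^ (-l + m) * q ^ 2) := by
    simpa using rpow_eq_mul hq 1 2 (by push_cast; ring)
  have b2 : coeffBZero q s M (l) (m) = -((q ^ l * q ^ (-l + m) * q ^ 2) *
    (√(qNum q 2) * √(qNum q (l - m)) * √(qNum q (l + m + 1))) * betaCoeff q s M l) := by
    rw [coeffBZero_eq hq hq1 (by linarith), b2w]
  have a3w : q ^ (l + m + 1) = ((q ^ l) ^ 2 * q ^ (-l + m) * q ^ 1) := by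
    simpa using rpow_eq_mul hq 2 1 (by push_cast; ring)
  have a3 : coeffAZero q s M (l) (m) = (qNum q (2 * l) - ((q ^ l) ^ 2 * q ^ (-l + m) * q ^ 1) *
    qNum q 2 * qNum q (l - m)) * betaCoeff q s M l := by
    rw [coeffAZero, a3w]
  have b3w : q ^ (m + 2) = (q ^ l * q ^ (-l + m) * q ^ 2) := by
    simpa using rpow_eq_mul hq 1 2 (by push_cast; ring)
  have b3 : coeffBZero q s M (l + 1) (m) = -((q ^ l * q ^ (-l + m) * q ^ 2) *
    (√(qNum q 2) * √(qNum q (l - m + 1)) * √(qNum q (l + m + 2))) * betaCoeff q s M (l + 1)) := by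
    rw [coeffBZero_eq hq hq1 (by linarith), b3w, show l + 1 - m = l - m + 1 by ring, show l + 1 +
      m + 1 = l + m + 2 by ring]
  have a4w : q ^ m = (q ^ l * q ^ (-l + m)) := by
    simpa using rpow_eq_mul hq 1 0 (by push_cast; ring)
  have a4 : coeffAPlus q s M (l) (m) = (q ^ l * q ^ (-l + m)) *
    (√(qNum q 2) * √(qNum q (l - m + 1)) * √(qNum q (l + m + 1))) * alphaCoeff q s M (l + 1) := by
    rw [coeffAPlus_eq hq hq1 (by linarith), a4w]
  rw [a1, b1, a2, b2, a3, b3, a4]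
  have hk := Real.mul_self_sqrt (qNum_nonneg hq hq1 zero_le_two)
  have hp0 := Real.mul_self_sqrt (qNum_nonneg hq hq1 (show 0 ≤ l - m by linarith))
  have hp1 := Real.mul_self_sqrt (qNum_nonneg hq hq1 (show 0 ≤ l - m + 1 by linarith))
  have hrec := betaCoeff_rec (s := s) (M := M) hq hq1 hl
  have hn := qNum_up_comm (l := l) (m := m) hq hq1
  linear_combination (q ^ (-l + m) * √(qNum q (l + m + 1)) * √(qNum q (l + m + 2)) *
    alphaCoeff q s M (l + 1)) * hrec + (q ^ (-l + m) * √(qNum q (l + m + 1)) *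
    √(qNum q (l + m + 2)) * alphaCoeff q s M (l + 1) * betaCoeff q s M (l + 1)) * hn
    - (q ^ l * q ^ (-l + m) * (q ^ l * q ^ (-l + m)) * q ^ 3 * √(qNum q (l + m + 1)) *
      √(qNum q (l + m + 2)) * alphaCoeff q s M (l + 1) * betaCoeff q s M l) *
      (√(qNum q (l - m)) ^ 2 * hk + qNum q 2 * hp0)
    + (q ^ l * q ^ (-l + m) * (q ^ l * q ^ (-l + m)) * q ^ 4 * √(qNum q (l + m + 1)) *
      √(qNum q (l + m + 2)) * alphaCoeff q s M (l + 1) * betaCoeff q s M (l + 1)) *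
      (√(qNum q (l - m + 1)) ^ 2 * hk + qNum q 2 * hp1)

/-- The hypotheses on α and on √[l − m − 1] isolate the boundary: for l = 1/2 the formula for α has
a zero denominator, and for m = l the number [l − m − 1] is negative, so its square root takes the
default value 0. -/
theorem comm_coeff_zero {q s M l m : ℝ} (hq : 0 < q) (hq1 : q < 1) (hl : 0 < l) (h₁ : 0 ≤ l - m)
    (h₂ : 0 ≤ l + m)
    (hα : qNum q (2 * l - 1) * alphaCoeff q s M l ^ 2 = alphaLow q s M l)
    (hα' : qNum q (2 * l + 3) * alphaCoeff q s M (l + 1) ^ 2 = alphaHigh q s M (l + 1))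
    (hp : √(qNum q (l - m)) * (√(qNum q (l - m - 1)) * √(qNum q (l - m - 1)))
      = √(qNum q (l - m)) * qNum q (l - m - 1)) :
    coeffAZero q s M l (m + 1) * coeffBZero q s M l m
      + coeffAPlus q s M l (m + 1) * coeffBPlus q s M l m
      + coeffAPlus q s M (l - 1) (m + 1) * coeffBMinus q s M l m
      - q ^ 2 * (coeffBZero q s M l m * coeffAZero q s M l m
        + coeffBMinus q s M (l + 1) m * coeffAPlus q s M l m
        + coeffBPlus q s M (l - 1) m * coeffAPlus q s M (l - 1) m)
      = (1 - q ^ 2) * (1 - s ^ 2) * coeffBZero q s M l m := by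
  have hX : 0 < q ^ l := Real.rpow_pos_of_pos hq _
  have hY : 0 < q ^ m := Real.rpow_pos_of_pos hq _
  have a1w : q ^ (l + (m + 1) + 1) = ((q ^ l) ^ 2 * q ^ (-l + m) * q ^ 2) := by
    simpa using rpow_eq_mul hq 2 2 (by push_cast; ring)
  have a1 : coeffAZero q s M (l) (m + 1) = (qNum q (2 * l) - ((q ^ l) ^ 2 * q ^ (-l + m) * q ^ 2) *
    qNum q 2 * qNum q (l - m - 1)) * betaCoeff q s M l := by
    rw [coeffAZero, a1w, show l - (m + 1) = l - m - 1 by ring]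
  have b1w : q ^ (m + 2) = (q ^ l * q ^ (-l + m) * q ^ 2) := by
    simpa using rpow_eq_mul hq 1 2 (by push_cast; ring)
  have b1 : coeffBZero q s M (l) (m) = -((q ^ l * q ^ (-l + m) * q ^ 2) *
    (√(qNum q 2) * √(qNum q (l - m)) * √(qNum q (l + m + 1))) * betaCoeff q s M l) := by
    rw [coeffBZero_eq hq hq1 (by linarith), b1w]
  have a2w : q ^ (m + 1) = (q ^ l * q ^ (-l + m) * q ^ 1) := by
    simpa using rpow_eq_mul hq 1 1 (by push_cast; ring)
  have a2 : coeffAPlus q s M (l) (m + 1) = (q ^ l * q ^ (-l + m) * q ^ 1) *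
    (√(qNum q 2) * √(qNum q (l - m)) * √(qNum q (l + m + 2))) * alphaCoeff q s M (l + 1) := by
    rw [coeffAPlus_eq hq hq1 (by linarith), a2w, show l - (m + 1) + 1 = l - m by ring, show l +
      (m + 1) + 1 = l + m + 2 by ring]
  have b2 : coeffBPlus q s M (l) (m) = (q ^ (-l + m)) * (√(qNum q (l + m + 1)) *
    √(qNum q (l + m + 2))) * alphaCoeff q s M (l + 1) := by
    rw [coeffBPlus_eq hq hq1 (by linarith)]
  have a3w : q ^ (m + 1) = (q ^ l * q ^ (-l + m) * q ^ 1) := by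
    simpa using rpow_eq_mul hq 1 1 (by push_cast; ring)
  have a3 : coeffAPlus q s M (l - 1) (m + 1) = (q ^ l * q ^ (-l + m) * q ^ 1) *
    (√(qNum q 2) * √(qNum q (l - m - 1)) * √(qNum q (l + m + 1))) * alphaCoeff q s M l := by
    rw [coeffAPlus_eq hq hq1 (by linarith), a3w, show l - 1 - (m + 1) + 1 = l - m - 1 by ring,
      show l - 1 + (m + 1) + 1 = l + m + 1 by ring, show l - 1 + 1 = l by ring]
  have b3w : q ^ (l + m + 1) = ((q ^ l) ^ 2 * q ^ (-l + m) * q ^ 1) := by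
    simpa using rpow_eq_mul hq 2 1 (by push_cast; ring)
  have b3 : coeffBMinus q s M (l) (m) = -(((q ^ l) ^ 2 * q ^ (-l + m) * q ^ 1) *
    (√(qNum q (l - m)) * √(qNum q (l - m - 1))) * alphaCoeff q s M l) := by
    rw [coeffBMinus_eq hq hq1 (by linarith), b3w]
  have a4w : q ^ (l + m + 1) = ((q ^ l) ^ 2 * q ^ (-l + m) * q ^ 1) := by
    simpa using rpow_eq_mul hq 2 1 (by push_cast; ring)
  have a4 : coeffAZero q s M (l) (m) = (qNum q (2 * l) - ((q ^ l) ^ 2 * q ^ (-l + m) * q ^ 1) *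
    qNum q 2 * qNum q (l - m)) * betaCoeff q s M l := by
    rw [coeffAZero, a4w]
  have b4w : q ^ (l + 1 + m + 1) = ((q ^ l) ^ 2 * q ^ (-l + m) * q ^ 2) := by
    simpa using rpow_eq_mul hq 2 2 (by push_cast; ring)
  have b4 : coeffBMinus q s M (l + 1) (m) = -(((q ^ l) ^ 2 * q ^ (-l + m) * q ^ 2) *
    (√(qNum q (l - m + 1)) * √(qNum q (l - m))) * alphaCoeff q s M (l + 1)) := by
    rw [coeffBMinus_eq hq hq1 (by linarith), b4w, show l + 1 - m - 1 = l - m by ring, show l + 1 -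
      m = l - m + 1 by ring]
  have a5w : q ^ m = (q ^ l * q ^ (-l + m)) := by
    simpa using rpow_eq_mul hq 1 0 (by push_cast; ring)
  have a5 : coeffAPlus q s M (l) (m) = (q ^ l * q ^ (-l + m)) *
    (√(qNum q 2) * √(qNum q (l - m + 1)) * √(qNum q (l + m + 1))) * alphaCoeff q s M (l + 1) := by
    rw [coeffAPlus_eq hq hq1 (by linarith), a5w]
  have b5w : q ^ (-(l - 1) + m) = (q ^ (-l + m) * q ^ 1) := by
    simpa using rpow_eq_mul hq 0 1 (by push_cast; ring)
  have b5 : coeffBPlus q s M (l - 1) (m) = (q ^ (-l + m) * q ^ 1) *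
    (√(qNum q (l + m)) * √(qNum q (l + m + 1))) * alphaCoeff q s M l := by
    rw [coeffBPlus_eq hq hq1 (by linarith), b5w, show l - 1 + m + 1 = l + m by ring, show l - 1 +
      m + 2 = l + m + 1 by ring, show l - 1 + 1 = l by ring]
  have a6w : q ^ m = (q ^ l * q ^ (-l + m)) := by
    simpa using rpow_eq_mul hq 1 0 (by push_cast; ring)
  have a6 : coeffAPlus q s M (l - 1) (m) = (q ^ l * q ^ (-l + m)) *
    (√(qNum q 2) * √(qNum q (l - m)) * √(qNum q (l + m))) * alphaCoeff q s M l := by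
    rw [coeffAPlus_eq hq hq1 (by linarith), a6w, show l - 1 - m + 1 = l - m by ring, show l - 1 +
      m + 1 = l + m by ring, show l - 1 + 1 = l by ring]
  rw [a1, b1, a2, b2, a3, b3, a4, b4, a5, b5, a6]
  have hk := Real.mul_self_sqrt (qNum_nonneg hq hq1 zero_le_two)
  have hp1 := Real.mul_self_sqrt (qNum_nonneg hq hq1 (show 0 ≤ l - m + 1 by linarith))
  have hr0 := Real.mul_self_sqrt (qNum_nonneg hq hq1 (show 0 ≤ l + m by linarith))
  have hr2 := Real.mul_self_sqrt (qNum_nonneg hq hq1 (show 0 ≤ l + m + 2 by linarith))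
  have hrec := alpha_rec (s := s) (M := M) hq hq1 hl
  have hn3 := qNum_alpha_up (l := l) (m := m) hq hq1
  have hn4 := qNum_alpha_down (l := l) (m := m) hq hq1
  have hn5 := qNum_pred_sub (l := l) (m := m) hq hq1
  have hV : q ^ (l - m) * q ^ (-l + m) = 1 :=
    by rw [← Real.rpow_add hq]; ring_nf; exact Real.rpow_zero q
  have hX2 : q ^ (2 * l) = (q ^ l) ^ 2 := by rw [two_mul, Real.rpow_add hq, pow_two]
  rw [hX2] at hrec
  -- The terms with α at l + 1 collect to [2l + 3]α², those with α at l to [2l − 1]α²; their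
  -- difference is given by `alpha_rec`, which also accounts for the β and β² terms.
  linear_combination (√(qNum q 2) * √(qNum q (l - m)) * √(qNum q (l + m + 1)) *
    (q ^ l * q ^ (-l + m)) * q ^ 2) * (hrec + hα' - hα)
    + (√(qNum q 2) * √(qNum q (l - m)) * √(qNum q (l + m + 1)) * (q ^ l * q ^ (-l + m)) *
      alphaCoeff q s M (l + 1) ^ 2) * hn3 - (√(qNum q 2) * √(qNum q (l - m)) *
      √(qNum q (l + m + 1)) * (q ^ l * q ^ (-l + m)) * alphaCoeff q s M l ^ 2) * hn4
    - (√(qNum q 2) * √(qNum q (l - m)) * √(qNum q (l + m + 1)) * (q ^ l * q ^ (-l + m)) *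
      betaCoeff q s M l ^ 2 * q ^ 4 * (q ^ l) ^ 2 * q ^ (-l + m) * qNum q 2) * hn5 -
      (√(qNum q 2) * √(qNum q (l - m)) * √(qNum q (l + m + 1)) * (q ^ l * q ^ (-l + m)) *
      betaCoeff q s M l ^ 2 * q ^ 4 * (q ^ l) ^ 2 * qNum q 2) * hV
    + (√(qNum q 2) * √(qNum q (l - m)) * √(qNum q (l + m + 1)) * (q ^ l * q ^ (-l + m)) *
      q ^ (-l + m) * q * alphaCoeff q s M (l + 1) ^ 2) * hr2 +
      (√(qNum q 2) * √(qNum q (l - m)) * √(qNum q (l + m + 1)) * (q ^ l * q ^ (-l + m)) *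
      (q ^ l) ^ 2 * q ^ (-l + m) * q ^ 4 * alphaCoeff q s M (l + 1) ^ 2) * hp1
    - (√(qNum q 2) * √(qNum q (l + m + 1)) * (q ^ l * q ^ (-l + m)) * (q ^ l) ^ 2 * q ^ (-l + m) *
      q ^ 2 * alphaCoeff q s M l ^ 2) * hp - (√(qNum q 2) * √(qNum q (l - m)) *
      √(qNum q (l + m + 1)) * (q ^ l * q ^ (-l + m)) * q ^ (-l + m) * q ^ 3 *
      alphaCoeff q s M l ^ 2) * hr0

/-- The recursion for β is used between l − 1 and l, hence the bound 1 < l. -/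
theorem comm_coeff_down_one {q s M l m : ℝ} (hq : 0 < q) (hq1 : q < 1) (hl : 1 < l)
    (h₁ : 0 ≤ l - m) (h₂ : 0 ≤ l + m) :
    coeffAPlus q s M (l - 1) (m + 1) * coeffBZero q s M l m
      + coeffAZero q s M (l - 1) (m + 1) * coeffBMinus q s M l m
      - q ^ 2 * (coeffBMinus q s M l m * coeffAZero q s M l m
        + coeffBZero q s M (l - 1) m * coeffAPlus q s M (l - 1) m)
      = (1 - q ^ 2) * (1 - s ^ 2) * coeffBMinus q s M l m := by
  have hX : 0 < q ^ l := Real.rpow_pos_of_pos hq _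
  have hY : 0 < q ^ m := Real.rpow_pos_of_pos hq _
  have a1w : q ^ (m + 1) = (q ^ l * q ^ (-l + m) * q ^ 1) := by
    simpa using rpow_eq_mul hq 1 1 (by push_cast; ring)
  have a1 : coeffAPlus q s M (l - 1) (m + 1) = (q ^ l * q ^ (-l + m) * q ^ 1) *
    (√(qNum q 2) * √(qNum q (l - m - 1)) * √(qNum q (l + m + 1))) * alphaCoeff q s M l := by
    rw [coeffAPlus_eq hq hq1 (by linarith), a1w, show l - 1 - (m + 1) + 1 = l - m - 1 by ring,
      show l - 1 + (m + 1) + 1 = l + m + 1 by ring, show l - 1 + 1 = l by ring]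
  have b1w : q ^ (m + 2) = (q ^ l * q ^ (-l + m) * q ^ 2) := by
    simpa using rpow_eq_mul hq 1 2 (by push_cast; ring)
  have b1 : coeffBZero q s M (l) (m) = -((q ^ l * q ^ (-l + m) * q ^ 2) *
    (√(qNum q 2) * √(qNum q (l - m)) * √(qNum q (l + m + 1))) * betaCoeff q s M l) := by
    rw [coeffBZero_eq hq hq1 (by linarith), b1w]
  have a2w : q ^ (l - 1 + (m + 1) + 1) = ((q ^ l) ^ 2 * q ^ (-l + m) * q ^ 1) := by
    simpa using rpow_eq_mul hq 2 1 (by push_cast; ring)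
  have a2 : coeffAZero q s M (l - 1) (m + 1) = (qNum q (2 * l - 2) -
    ((q ^ l) ^ 2 * q ^ (-l + m) * q ^ 1) * qNum q 2 * qNum q (l - m - 2)) * betaCoeff q s M (l - 1)
    := by
    rw [coeffAZero, a2w, show 2 * (l - 1) = 2 * l - 2 by ring, show l - 1 - (m + 1) = l - m -
      2 by ring]
  have b2w : q ^ (l + m + 1) = ((q ^ l) ^ 2 * q ^ (-l + m) * q ^ 1) := by
    simpa using rpow_eq_mul hq 2 1 (by push_cast; ring)
  have b2 : coeffBMinus q s M (l) (m) = -(((q ^ l) ^ 2 * q ^ (-l + m) * q ^ 1) *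
    (√(qNum q (l - m)) * √(qNum q (l - m - 1))) * alphaCoeff q s M l) := by
    rw [coeffBMinus_eq hq hq1 h₁, b2w]
  have a3w : q ^ (l + m + 1) = ((q ^ l) ^ 2 * q ^ (-l + m) * q ^ 1) := by
    simpa using rpow_eq_mul hq 2 1 (by push_cast; ring)
  have a3 : coeffAZero q s M (l) (m) = (qNum q (2 * l) - ((q ^ l) ^ 2 * q ^ (-l + m) * q ^ 1) *
    qNum q 2 * qNum q (l - m)) * betaCoeff q s M l := by
    rw [coeffAZero, a3w]
  have b3w : q ^ (m + 2) = (q ^ l * q ^ (-l + m) * q ^ 2) := by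
    simpa using rpow_eq_mul hq 1 2 (by push_cast; ring)
  have b3 : coeffBZero q s M (l - 1) (m) = -((q ^ l * q ^ (-l + m) * q ^ 2) *
    (√(qNum q 2) * √(qNum q (l - m - 1)) * √(qNum q (l + m))) * betaCoeff q s M (l - 1)) := by
    rw [coeffBZero_eq hq hq1 (by linarith), b3w, show l - 1 - m = l - m - 1 by ring, show l - 1 +
      m + 1 = l + m by ring]
  have a4w : q ^ m = (q ^ l * q ^ (-l + m)) := by
    simpa using rpow_eq_mul hq 1 0 (by push_cast; ring)
  have a4 : coeffAPlus q s M (l - 1) (m) = (q ^ l * q ^ (-l + m)) *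
    (√(qNum q 2) * √(qNum q (l - m)) * √(qNum q (l + m))) * alphaCoeff q s M l := by
    rw [coeffAPlus_eq hq hq1 (by linarith), a4w, show l - 1 - m + 1 = l - m by ring, show l - 1 +
      m + 1 = l + m by ring, show l - 1 + 1 = l by ring]
  rw [a1, b1, a2, b2, a3, b3, a4]
  have hk := Real.mul_self_sqrt (qNum_nonneg hq hq1 zero_le_two)
  have hr0 := Real.mul_self_sqrt (qNum_nonneg hq hq1 (show 0 ≤ l + m by linarith))
  have hr1 := Real.mul_self_sqrt (qNum_nonneg hq hq1 (show 0 ≤ l + m + 1 by linarith))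
  have hrec := betaCoeff_rec (s := s) (M := M) hq hq1 (show 0 < l - 1 by linarith)
  rw [show 2 * (l - 1) + 4 = 2 * l + 2 by ring, show 2 * (l - 1) = 2 * l - 2 by ring,
    sub_add_cancel] at hrec
  have hn6 := qNum_down_comm (l := l) (m := m) hq hq1
  have hn7 := qNum_down_comm_pred (l := l) (m := m) hq hq1
  linear_combination -((q ^ l) ^ 2 * q ^ (-l + m) * q * √(qNum q (l - m)) * √(qNum q (l - m - 1)) *
    alphaCoeff q s M l) * (hrec + betaCoeff q s M l * hn6 + betaCoeff q s M (l - 1) * hn7)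
    - ((q ^ l * q ^ (-l + m)) ^ 2 * q ^ 3 * √(qNum q (l - m)) * √(qNum q (l - m - 1)) *
      alphaCoeff q s M l * betaCoeff q s M l) * (√(qNum q (l + m + 1)) ^ 2 * hk + qNum q 2 * hr1)
    + ((q ^ l * q ^ (-l + m)) ^ 2 * q ^ 4 * √(qNum q (l - m)) * √(qNum q (l - m - 1)) *
      alphaCoeff q s M l * betaCoeff q s M (l - 1)) * (√(qNum q (l + m)) ^ 2 * hk + qNum q 2 * hr0)

theorem comm_coeff_down_two {q s M l m : ℝ} (hq : 0 < q) (hq1 : q < 1) (h₁ : 0 ≤ l - m - 1)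
    (h₂ : 0 ≤ l + m) :
    coeffAPlus q s M (l - 2) (m + 1) * coeffBMinus q s M l m
      = q ^ 2 * (coeffBMinus q s M (l - 1) m * coeffAPlus q s M (l - 1) m) := by
  have hX : 0 < q ^ l := Real.rpow_pos_of_pos hq _
  have hY : 0 < q ^ m := Real.rpow_pos_of_pos hq _
  have a1w : q ^ (m + 1) = (q ^ l * q ^ (-l + m) * q ^ 1) := by
    simpa using rpow_eq_mul hq 1 1 (by push_cast; ring)
  have a1 : coeffAPlus q s M (l - 2) (m + 1) = (q ^ l * q ^ (-l + m) * q ^ 1) *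
    (√(qNum q 2) * √(qNum q (l - m - 2)) * √(qNum q (l + m))) * alphaCoeff q s M (l - 1) := by
    rw [coeffAPlus_eq hq hq1 (by linarith), a1w, show l - 2 - (m + 1) + 1 = l - m - 2 by ring,
      show l - 2 + (m + 1) + 1 = l + m by ring, show l - 2 + 1 = l - 1 by ring]
  have b1w : q ^ (l + m + 1) = ((q ^ l) ^ 2 * q ^ (-l + m) * q ^ 1) := by
    simpa using rpow_eq_mul hq 2 1 (by push_cast; ring)
  have b1 : coeffBMinus q s M (l) (m) = -(((q ^ l) ^ 2 * q ^ (-l + m) * q ^ 1) *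
    (√(qNum q (l - m)) * √(qNum q (l - m - 1))) * alphaCoeff q s M l) := by
    rw [coeffBMinus_eq hq hq1 (by linarith), b1w]
  have b2w : q ^ (l - 1 + m + 1) = ((q ^ l) ^ 2 * q ^ (-l + m)) := by
    simpa using rpow_eq_mul hq 2 0 (by push_cast; ring)
  have b2 : coeffBMinus q s M (l - 1) (m) = -(((q ^ l) ^ 2 * q ^ (-l + m)) *
    (√(qNum q (l - m - 1)) * √(qNum q (l - m - 2))) * alphaCoeff q s M (l - 1)) := by
    rw [coeffBMinus_eq hq hq1 (by linarith), b2w, show l - 1 - m - 1 = l - m - 2 by ring, show l -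
      1 - m = l - m - 1 by ring]
  have a2w : q ^ m = (q ^ l * q ^ (-l + m)) := by
    simpa using rpow_eq_mul hq 1 0 (by push_cast; ring)
  have a2 : coeffAPlus q s M (l - 1) (m) = (q ^ l * q ^ (-l + m)) *
    (√(qNum q 2) * √(qNum q (l - m)) * √(qNum q (l + m))) * alphaCoeff q s M l := by
    rw [coeffAPlus_eq hq hq1 (by linarith), a2w, show l - 1 - m + 1 = l - m by ring, show l - 1 +
      m + 1 = l + m by ring, show l - 1 + 1 = l by ring]
  rw [a1, b1, b2, a2]
  field_simp

theorem qNum_alpha_up_mulStar {q l m : ℝ} (hq : 0 < q) (hq1 : q < 1) :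
    q ^ 3 * (q ^ l) ^ 2 * q ^ (-l + m) * qNum q (l - m + 2) + q ^ (-l + m) * qNum q (l + m + 1)
      = q ^ 2 * qNum q (2 * l + 3) := by
  have h1 : q ^ 2 - 1 ≠ 0 := by nlinarith
  have hX : 0 < q ^ l := Real.rpow_pos_of_pos hq _
  have hY : 0 < q ^ m := Real.rpow_pos_of_pos hq _
  simp only [qNum_eq hq, two_mul, Real.rpow_add hq, Real.rpow_sub hq, Real.rpow_neg hq.le,
    Real.rpow_one, Real.rpow_ofNat]
  field_simp
  ring

theorem qNum_alpha_down_mulStar {q l m : ℝ} (hq : 0 < q) (hq1 : q < 1) :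
    q * q ^ (-l + m) * qNum q (l + m - 1) + (q ^ l) ^ 2 * q ^ (-l + m) * qNum q (l - m)
      = q * qNum q (2 * l - 1) := by
  have h1 : q ^ 2 - 1 ≠ 0 := by nlinarith
  have hX : 0 < q ^ l := Real.rpow_pos_of_pos hq _
  have hY : 0 < q ^ m := Real.rpow_pos_of_pos hq _
  simp only [qNum_eq hq, two_mul, Real.rpow_add hq, Real.rpow_sub hq, Real.rpow_neg hq.le,
    Real.rpow_one, Real.rpow_ofNat]
  field_simp
  ring

/-- The `starMul_coeff` lemmas concern the relation for B*B multiplied by (q[2])² and expanded in x₀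
and x₁. That operator is symmetric with real coefficients, so the entries that raise l or keep it
suffice. -/
theorem starMul_coeff_up_two {q s M l m : ℝ} (hq : 0 < q) (hq1 : q < 1) (h₁ : 0 ≤ l - m)
    (h₂ : 0 ≤ l + m) :
    q * qNum q 2 * (coeffBPlus q s M l m * coeffBMinus q s M (l + 2) m)
      + q ^ 4 * (coeffAPlus q s M l m * coeffAPlus q s M (l + 1) m) = 0 := by
  have hX : 0 < q ^ l := Real.rpow_pos_of_pos hq _
  have hY : 0 < q ^ m := Real.rpow_pos_of_pos hq _
  have b1 : coeffBPlus q s M (l) (m) = (q ^ (-l + m)) * (√(qNum q (l + m + 1)) *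
    √(qNum q (l + m + 2))) * alphaCoeff q s M (l + 1) := by
    rw [coeffBPlus_eq hq hq1 (by linarith)]
  have b2w : q ^ (l + 2 + m + 1) = ((q ^ l) ^ 2 * q ^ (-l + m) * q ^ 3) := by
    simpa using rpow_eq_mul hq 2 3 (by push_cast; ring)
  have b2 : coeffBMinus q s M (l + 2) (m) = -(((q ^ l) ^ 2 * q ^ (-l + m) * q ^ 3) *
    (√(qNum q (l - m + 2)) * √(qNum q (l - m + 1))) * alphaCoeff q s M (l + 2)) := by
    rw [coeffBMinus_eq hq hq1 (by linarith), b2w, show l + 2 - m - 1 = l - m + 1 by ring, show l +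
      2 - m = l - m + 2 by ring]
  have a1w : q ^ m = (q ^ l * q ^ (-l + m)) := by
    simpa using rpow_eq_mul hq 1 0 (by push_cast; ring)
  have a1 : coeffAPlus q s M (l) (m) = (q ^ l * q ^ (-l + m)) *
    (√(qNum q 2) * √(qNum q (l - m + 1)) * √(qNum q (l + m + 1))) * alphaCoeff q s M (l + 1) := by
    rw [coeffAPlus_eq hq hq1 (by linarith), a1w]
  have a2w : q ^ m = (q ^ l * q ^ (-l + m)) := by
    simpa using rpow_eq_mul hq 1 0 (by push_cast; ring)
  have a2 : coeffAPlus q s M (l + 1) (m) = (q ^ l * q ^ (-l + m)) *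
    (√(qNum q 2) * √(qNum q (l - m + 2)) * √(qNum q (l + m + 2))) * alphaCoeff q s M (l + 2) := by
    rw [coeffAPlus_eq hq hq1 (by linarith), a2w, show l + 1 - m + 1 = l - m + 2 by ring, show l +
      1 + m + 1 = l + m + 2 by ring, show l + 1 + 1 = l + 2 by ring]
  rw [b1, b2, a1, a2]
  have hk := Real.mul_self_sqrt (qNum_nonneg hq hq1 zero_le_two)
  linear_combination ((q ^ l * q ^ (-l + m)) ^ 2 * q ^ 4 * √(qNum q (l - m + 1)) *
    √(qNum q (l - m + 2)) * √(qNum q (l + m + 1)) * √(qNum q (l + m + 2)) *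
    alphaCoeff q s M (l + 1) * alphaCoeff q s M (l + 2)) * hk

theorem starMul_coeff_up_one {q s M l m : ℝ} (hq : 0 < q) (hq1 : q < 1) (hl : 0 < l)
    (h₁ : 0 ≤ l - m) (h₂ : 0 ≤ l + m) :
    q * qNum q 2 * (coeffBPlus q s M l m * coeffBZero q s M (l + 1) m
        + coeffBZero q s M l m * coeffBMinus q s M (l + 1) m)
      + q ^ 4 * (coeffAPlus q s M l m * coeffAZero q s M (l + 1) m
        + coeffAZero q s M l m * coeffAPlus q s M l m)
      + (q ^ 2 * (q * qNum q 2) - 2 * q ^ 4) * (1 - s ^ 2) * coeffAPlus q s M l m = 0 := by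
  have hX : 0 < q ^ l := Real.rpow_pos_of_pos hq _
  have hY : 0 < q ^ m := Real.rpow_pos_of_pos hq _
  have b1 : coeffBPlus q s M (l) (m) = (q ^ (-l + m)) * (√(qNum q (l + m + 1)) *
    √(qNum q (l + m + 2))) * alphaCoeff q s M (l + 1) := by
    rw [coeffBPlus_eq hq hq1 (by linarith)]
  have b2w : q ^ (m + 2) = (q ^ l * q ^ (-l + m) * q ^ 2) := by
    simpa using rpow_eq_mul hq 1 2 (by push_cast; ring)
  have b2 : coeffBZero q s M (l + 1) (m) = -((q ^ l * q ^ (-l + m) * q ^ 2) *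
    (√(qNum q 2) * √(qNum q (l - m + 1)) * √(qNum q (l + m + 2))) * betaCoeff q s M (l + 1)) := by
    rw [coeffBZero_eq hq hq1 (by linarith), b2w, show l + 1 - m = l - m + 1 by ring, show l + 1 +
      m + 1 = l + m + 2 by ring]
  have b3w : q ^ (m + 2) = (q ^ l * q ^ (-l + m) * q ^ 2) := by
    simpa using rpow_eq_mul hq 1 2 (by push_cast; ring)
  have b3 : coeffBZero q s M (l) (m) = -((q ^ l * q ^ (-l + m) * q ^ 2) *
    (√(qNum q 2) * √(qNum q (l - m)) * √(qNum q (l + m + 1))) * betaCoeff q s M l) := by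
    rw [coeffBZero_eq hq hq1 (by linarith), b3w]
  have b4w : q ^ (l + 1 + m + 1) = ((q ^ l) ^ 2 * q ^ (-l + m) * q ^ 2) := by
    simpa using rpow_eq_mul hq 2 2 (by push_cast; ring)
  have b4 : coeffBMinus q s M (l + 1) (m) = -(((q ^ l) ^ 2 * q ^ (-l + m) * q ^ 2) *
    (√(qNum q (l - m + 1)) * √(qNum q (l - m))) * alphaCoeff q s M (l + 1)) := by
    rw [coeffBMinus_eq hq hq1 (by linarith), b4w, show l + 1 - m - 1 = l - m by ring, show l + 1 -
      m = l - m + 1 by ring]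
  have a1w : q ^ m = (q ^ l * q ^ (-l + m)) := by
    simpa using rpow_eq_mul hq 1 0 (by push_cast; ring)
  have a1 : coeffAPlus q s M (l) (m) = (q ^ l * q ^ (-l + m)) *
    (√(qNum q 2) * √(qNum q (l - m + 1)) * √(qNum q (l + m + 1))) * alphaCoeff q s M (l + 1) := by
    rw [coeffAPlus_eq hq hq1 (by linarith), a1w]
  have a2w : q ^ (l + 1 + m + 1) = ((q ^ l) ^ 2 * q ^ (-l + m) * q ^ 2) := by
    simpa using rpow_eq_mul hq 2 2 (by push_cast; ring)
  have a2 : coeffAZero q s M (l + 1) (m) = (qNum q (2 * l + 2) -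
    ((q ^ l) ^ 2 * q ^ (-l + m) * q ^ 2) * qNum q 2 * qNum q (l - m + 1)) * betaCoeff q s M (l + 1)
    := by
    rw [coeffAZero, a2w, show 2 * (l + 1) = 2 * l + 2 by ring, show l + 1 - m = l - m + 1 by ring]
  have a3w : q ^ (l + m + 1) = ((q ^ l) ^ 2 * q ^ (-l + m) * q ^ 1) := by
    simpa using rpow_eq_mul hq 2 1 (by push_cast; ring)
  have a3 : coeffAZero q s M (l) (m) = (qNum q (2 * l) - ((q ^ l) ^ 2 * q ^ (-l + m) * q ^ 1) *
    qNum q 2 * qNum q (l - m)) * betaCoeff q s M l := by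
    rw [coeffAZero, a3w]
  rw [b1, b2, b3, b4, a1, a2, a3]
  have hk := Real.mul_self_sqrt (qNum_nonneg hq hq1 zero_le_two)
  have hp0 := Real.mul_self_sqrt (qNum_nonneg hq hq1 (show 0 ≤ l - m by linarith))
  have hr2 := Real.mul_self_sqrt (qNum_nonneg hq hq1 (show 0 ≤ l + m + 2 by linarith))
  have hrec := betaCoeff_rec (s := s) (M := M) hq hq1 hl
  have hc : q * qNum q 2 = q ^ 2 + 1 := by rw [qNum_two hq hq1]; field_simp
  have hn := qNum_up_starMul (l := l) (m := m) hq hq1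
  linear_combination ((q ^ l * q ^ (-l + m) * √(qNum q 2) * √(qNum q (l - m + 1)) *
    √(qNum q (l + m + 1)) * alphaCoeff q s M (l + 1)) * q ^ 2) *
    ((1 - s ^ 2) * hc - betaCoeff q s M (l + 1) * hn - hrec)
    - ((q * qNum q 2) * (q ^ l * q ^ (-l + m) * √(qNum q 2) * √(qNum q (l - m + 1)) *
      √(qNum q (l + m + 1)) * alphaCoeff q s M (l + 1)) * q ^ (-l + m) * q ^ 2 *
      betaCoeff q s M (l + 1)) * hr2 + ((q * qNum q 2) * (q ^ l * q ^ (-l + m) * √(qNum q 2) *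
      √(qNum q (l - m + 1)) * √(qNum q (l + m + 1)) * alphaCoeff q s M (l + 1)) * (q ^ l) ^ 2 *
      q ^ (-l + m) * q ^ 4 * betaCoeff q s M l) * hp0

/-- The squares of A⁺ and B⁺ combine to a multiple of [2l + 3]α² at l + 1, and the squares of the
lowering elements to a multiple of [2l − 1]α² at l; what remains is `diag_star_mul`. All squares
enter with positive factors, from which boundedness will follow. -/
theorem starMul_coeff_zero {q s M l m : ℝ} (hq : 0 < q) (hq1 : q < 1) (hl : 0 < l) (h₁ : 0 ≤ l - m)
    (h₂ : 0 ≤ l + m)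
    (hα : qNum q (2 * l - 1) * alphaCoeff q s M l ^ 2 = alphaLow q s M l)
    (hα' : qNum q (2 * l + 3) * alphaCoeff q s M (l + 1) ^ 2 = alphaHigh q s M (l + 1))
    (hp : √(qNum q (l - m)) * (√(qNum q (l - m - 1)) * √(qNum q (l - m - 1)))
      = √(qNum q (l - m)) * qNum q (l - m - 1)) :
    q * qNum q 2 * (coeffBPlus q s M l m ^ 2 + coeffBZero q s M l m ^ 2
        + coeffBMinus q s M l m ^ 2)
      + q ^ 4 * (coeffAPlus q s M l m ^ 2 + coeffAZero q s M l m ^ 2 +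
        coeffAPlus q s M (l - 1) m ^ 2)
      + (q ^ 2 * (q * qNum q 2) - 2 * q ^ 4) * (1 - s ^ 2) * coeffAZero q s M l m
      + (q ^ 2 * (1 - s ^ 2) + q * qNum q 2 * s ^ 2) * (q ^ 2 * (1 - s ^ 2) - q * qNum q 2) = 0 :=
        by
  have hX : 0 < q ^ l := Real.rpow_pos_of_pos hq _
  have hY : 0 < q ^ m := Real.rpow_pos_of_pos hq _
  have b1 : coeffBPlus q s M (l) (m) = (q ^ (-l + m)) * (√(qNum q (l + m + 1)) *
    √(qNum q (l + m + 2))) * alphaCoeff q s M (l + 1) := by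
    rw [coeffBPlus_eq hq hq1 (by linarith)]
  have b2w : q ^ (m + 2) = (q ^ l * q ^ (-l + m) * q ^ 2) := by
    simpa using rpow_eq_mul hq 1 2 (by push_cast; ring)
  have b2 : coeffBZero q s M (l) (m) = -((q ^ l * q ^ (-l + m) * q ^ 2) *
    (√(qNum q 2) * √(qNum q (l - m)) * √(qNum q (l + m + 1))) * betaCoeff q s M l) := by
    rw [coeffBZero_eq hq hq1 (by linarith), b2w]
  have b3w : q ^ (l + m + 1) = ((q ^ l) ^ 2 * q ^ (-l + m) * q ^ 1) := by
    simpa using rpow_eq_mul hq 2 1 (by push_cast; ring)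
  have b3 : coeffBMinus q s M (l) (m) = -(((q ^ l) ^ 2 * q ^ (-l + m) * q ^ 1) *
    (√(qNum q (l - m)) * √(qNum q (l - m - 1))) * alphaCoeff q s M l) := by
    rw [coeffBMinus_eq hq hq1 h₁, b3w]
  have a1w : q ^ m = (q ^ l * q ^ (-l + m)) := by
    simpa using rpow_eq_mul hq 1 0 (by push_cast; ring)
  have a1 : coeffAPlus q s M (l) (m) = (q ^ l * q ^ (-l + m)) *
    (√(qNum q 2) * √(qNum q (l - m + 1)) * √(qNum q (l + m + 1))) * alphaCoeff q s M (l + 1) := by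
    rw [coeffAPlus_eq hq hq1 (by linarith), a1w]
  have a2w : q ^ m = (q ^ l * q ^ (-l + m)) := by
    simpa using rpow_eq_mul hq 1 0 (by push_cast; ring)
  have a2 : coeffAPlus q s M (l - 1) (m) = (q ^ l * q ^ (-l + m)) *
    (√(qNum q 2) * √(qNum q (l - m)) * √(qNum q (l + m))) * alphaCoeff q s M l := by
    rw [coeffAPlus_eq hq hq1 (by linarith), a2w, show l - 1 - m + 1 = l - m by ring, show l - 1 +
      m + 1 = l + m by ring, show l - 1 + 1 = l by ring]
  rw [b1, b2, b3, a1, a2]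
  have hk := Real.mul_self_sqrt (qNum_nonneg hq hq1 zero_le_two)
  have hp0 := Real.mul_self_sqrt (qNum_nonneg hq hq1 (show 0 ≤ l - m by linarith))
  have hp1 := Real.mul_self_sqrt (qNum_nonneg hq hq1 (show 0 ≤ l - m + 1 by linarith))
  have hr0 := Real.mul_self_sqrt (qNum_nonneg hq hq1 (show 0 ≤ l + m by linarith))
  have hr1 := Real.mul_self_sqrt (qNum_nonneg hq hq1 (show 0 ≤ l + m + 1 by linarith))
  have hr2 := Real.mul_self_sqrt (qNum_nonneg hq hq1 (show 0 ≤ l + m + 2 by linarith))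
  have hn3 := qNum_alpha_up (l := l) (m := m) hq hq1
  have hn4 := qNum_alpha_down (l := l) (m := m) hq hq1
  have w1 : q ^ (m - l + 1) = q ^ (-l + m) * q := by
    simpa using rpow_eq_mul hq 0 1 (by push_cast; ring)
  have w2 : q ^ (m + l + 2) = (q ^ l) ^ 2 * q ^ (-l + m) * q ^ 2 := by
    simpa using rpow_eq_mul hq 2 2 (by push_cast; ring)
  have w3 : q ^ (2 * m + 4) = (q ^ l * q ^ (-l + m)) ^ 2 * q ^ 4 := by
    simp only [Real.rpow_add hq, Real.rpow_sub hq, Real.rpow_neg hq.le, Real.rpow_one,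
      Real.rpow_ofNat, two_mul]
    field_simp
  have hd := diag_star_mul (s := s) (M := M) (m := m) hq hq1 hl
  rw [w1, w2, w3] at hd
  have hz : (q ^ 2 * (1 - s ^ 2 - coeffAZero q s M l m) + q * qNum q 2 * s ^ 2)
      * (q * (1 - s ^ 2 - coeffAZero q s M l m) - qNum q 2) / qNum q 2 * qNum q 2
      = (q ^ 2 * (1 - s ^ 2 - coeffAZero q s M l m) + q * qNum q 2 * s ^ 2)
      * (q * (1 - s ^ 2 - coeffAZero q s M l m) - qNum q 2) :=
    div_mul_cancel₀ _ (qNum_pos hq hq1 two_pos).ne'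
  linear_combination (q * qNum q 2) * hd + (qNum q 2 * q ^ (-l + m) * qNum q (l + m + 1) *
    alphaCoeff q s M (l + 1) ^ 2) * hn3 + (qNum q 2 * qNum q (l - m) * (q ^ l) ^ 2 * q ^ (-l + m) *
    q * alphaCoeff q s M l ^ 2) * hn4
    + ((q * qNum q 2) * q * q ^ (-l + m) * qNum q (l + m + 1)) * hα' +
      ((q * qNum q 2) * (q ^ l) ^ 2 * q ^ (-l + m) * q ^ 2 * qNum q (l - m)) * hα
    + ((q * qNum q 2) * (q ^ (-l + m)) ^ 2 * alphaCoeff q s M (l + 1) ^ 2) *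
      (√(qNum q (l + m + 2)) ^ 2 * hr1 + qNum q (l + m + 1) * hr2)
    + ((q * qNum q 2) * (q ^ l) ^ 4 * (q ^ (-l + m)) ^ 2 * q ^ 2 * alphaCoeff q s M l ^ 2) *
      (√(qNum q (l - m)) * hp + qNum q (l - m - 1) * hp0)
    + ((q * qNum q 2) * (q ^ l * q ^ (-l + m)) ^ 2 * q ^ 4 * betaCoeff q s M l ^ 2) *
      (√(qNum q (l - m)) ^ 2 * √(qNum q (l + m + 1)) ^ 2 * hk + qNum q 2 *
      √(qNum q (l + m + 1)) ^ 2 * hp0 + qNum q 2 * qNum q (l - m) * hr1)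
    + (q ^ 4 * (q ^ l * q ^ (-l + m)) ^ 2 * alphaCoeff q s M (l + 1) ^ 2) *
      (√(qNum q (l - m + 1)) ^ 2 * √(qNum q (l + m + 1)) ^ 2 * hk + qNum q 2 *
      √(qNum q (l + m + 1)) ^ 2 * hp1 + qNum q 2 * qNum q (l - m + 1) * hr1)
    + (q ^ 4 * (q ^ l * q ^ (-l + m)) ^ 2 * alphaCoeff q s M l ^ 2) *
      (√(qNum q (l - m)) ^ 2 * √(qNum q (l + m)) ^ 2 * hk + qNum q 2 * √(qNum q (l + m)) ^ 2 *
      hp0 + qNum q 2 * qNum q (l - m) * hr0)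
    - q * hz

/-- For BB* the adjoint acts first: it lowers m and has the transposed coefficients, so those of x₁
are evaluated at m − 1 throughout. -/
theorem mulStar_coeff_up_two {q s M l m : ℝ} (hq : 0 < q) (hq1 : q < 1) (h₁ : 0 ≤ l - m)
    (h₂ : 0 ≤ l + m) :
    q * qNum q 2 * (coeffBMinus q s M (l + 1) (m - 1) * coeffBPlus q s M (l + 1) (m - 1))
      + coeffAPlus q s M l m * coeffAPlus q s M (l + 1) m = 0 := by
  have hX : 0 < q ^ l := Real.rpow_pos_of_pos hq _
  have hY : 0 < q ^ m := Real.rpow_pos_of_pos hq _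
  have b1w : q ^ (l + 1 + (m - 1) + 1) = ((q ^ l) ^ 2 * q ^ (-l + m) * q ^ 1) := by
    simpa using rpow_eq_mul hq 2 1 (by push_cast; ring)
  have b1 : coeffBMinus q s M (l + 1) (m - 1) = -(((q ^ l) ^ 2 * q ^ (-l + m) * q ^ 1) *
    (√(qNum q (l - m + 2)) * √(qNum q (l - m + 1))) * alphaCoeff q s M (l + 1)) := by
    rw [coeffBMinus_eq hq hq1 (by linarith), b1w, show l + 1 - (m - 1) - 1 = l - m + 1 by ring,
      show l + 1 - (m - 1) = l - m + 2 by ring]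
  have b2w : q ^ (-(l + 1) + (m - 1)) = (q ^ (-l + m) * (q ^ 2)⁻¹) := by
    simp only [Real.rpow_add hq, Real.rpow_sub hq, Real.rpow_neg hq.le, Real.rpow_one,
      Real.rpow_ofNat, neg_add, neg_sub]
    field_simp
  have b2 : coeffBPlus q s M (l + 1) (m - 1) = (q ^ (-l + m) * (q ^ 2)⁻¹) *
    (√(qNum q (l + m + 1)) * √(qNum q (l + m + 2))) * alphaCoeff q s M (l + 2) := by
    rw [coeffBPlus_eq hq hq1 (by linarith), b2w, show l + 1 + (m - 1) + 1 = l + m + 1 by ring,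
      show l + 1 + (m - 1) + 2 = l + m + 2 by ring, show l + 1 + 1 = l + 2 by ring]
  have a1w : q ^ m = (q ^ l * q ^ (-l + m)) := by
    simpa using rpow_eq_mul hq 1 0 (by push_cast; ring)
  have a1 : coeffAPlus q s M (l) (m) = (q ^ l * q ^ (-l + m)) *
    (√(qNum q 2) * √(qNum q (l - m + 1)) * √(qNum q (l + m + 1))) * alphaCoeff q s M (l + 1) := by
    rw [coeffAPlus_eq hq hq1 (by linarith), a1w]
  have a2w : q ^ m = (q ^ l * q ^ (-l + m)) := by
    simpa using rpow_eq_mul hq 1 0 (by push_cast; ring)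
  have a2 : coeffAPlus q s M (l + 1) (m) = (q ^ l * q ^ (-l + m)) *
    (√(qNum q 2) * √(qNum q (l - m + 2)) * √(qNum q (l + m + 2))) * alphaCoeff q s M (l + 2) := by
    rw [coeffAPlus_eq hq hq1 (by linarith), a2w, show l + 1 - m + 1 = l - m + 2 by ring, show l +
      1 + m + 1 = l + m + 2 by ring, show l + 1 + 1 = l + 2 by ring]
  rw [b1, b2, a1, a2]
  have hk := Real.mul_self_sqrt (qNum_nonneg hq hq1 zero_le_two)
  have hqi : q ^ 2 * (q ^ 2)⁻¹ = 1 := mul_inv_cancel₀ (by positivity)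
  linear_combination ((q ^ l * q ^ (-l + m)) ^ 2 * √(qNum q (l - m + 1)) * √(qNum q (l - m + 2)) *
    √(qNum q (l + m + 1)) * √(qNum q (l + m + 2)) * alphaCoeff q s M (l + 1) *
    alphaCoeff q s M (l + 2)) * (hk - qNum q 2 * hqi)

theorem mulStar_coeff_up_one {q s M l m : ℝ} (hq : 0 < q) (hq1 : q < 1) (hl : 0 < l)
    (h₁ : 0 ≤ l - m) (h₂ : 0 ≤ l + m) :
    q * qNum q 2 * (coeffBZero q s M l (m - 1) * coeffBPlus q s M l (m - 1)
        + coeffBMinus q s M (l + 1) (m - 1) * coeffBZero q s M (l + 1) (m - 1))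
      + (coeffAPlus q s M l m * coeffAZero q s M (l + 1) m
        + coeffAZero q s M l m * coeffAPlus q s M l m)
      + (q * qNum q 2 - 2) * (1 - s ^ 2) * coeffAPlus q s M l m = 0 := by
  have hX : 0 < q ^ l := Real.rpow_pos_of_pos hq _
  have hY : 0 < q ^ m := Real.rpow_pos_of_pos hq _
  have b1w : q ^ (m - 1 + 2) = (q ^ l * q ^ (-l + m) * q ^ 1) := by
    simpa using rpow_eq_mul hq 1 1 (by push_cast; ring)
  have b1 : coeffBZero q s M (l) (m - 1) = -((q ^ l * q ^ (-l + m) * q ^ 1) *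
    (√(qNum q 2) * √(qNum q (l - m + 1)) * √(qNum q (l + m))) * betaCoeff q s M l) := by
    rw [coeffBZero_eq hq hq1 (by linarith), b1w, show l - (m - 1) = l - m + 1 by ring, show l +
      (m - 1) + 1 = l + m by ring]
  have b2w : q ^ (-l + (m - 1)) = (q ^ (-l + m) * (q ^ 1)⁻¹) := by
    simp only [Real.rpow_add hq, Real.rpow_sub hq, Real.rpow_neg hq.le, Real.rpow_one,
      Real.rpow_ofNat, neg_add, neg_sub]
    field_simp
  have b2 : coeffBPlus q s M (l) (m - 1) = (q ^ (-l + m) * (q ^ 1)⁻¹) *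
    (√(qNum q (l + m)) * √(qNum q (l + m + 1))) * alphaCoeff q s M (l + 1) := by
    rw [coeffBPlus_eq hq hq1 (by linarith), b2w, show l + (m - 1) + 1 = l + m by ring, show l +
      (m - 1) + 2 = l + m + 1 by ring]
  have b3w : q ^ (l + 1 + (m - 1) + 1) = ((q ^ l) ^ 2 * q ^ (-l + m) * q ^ 1) := by
    simpa using rpow_eq_mul hq 2 1 (by push_cast; ring)
  have b3 : coeffBMinus q s M (l + 1) (m - 1) = -(((q ^ l) ^ 2 * q ^ (-l + m) * q ^ 1) *
    (√(qNum q (l - m + 2)) * √(qNum q (l - m + 1))) * alphaCoeff q s M (l + 1)) := by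
    rw [coeffBMinus_eq hq hq1 (by linarith), b3w, show l + 1 - (m - 1) - 1 = l - m + 1 by ring,
      show l + 1 - (m - 1) = l - m + 2 by ring]
  have b4w : q ^ (m - 1 + 2) = (q ^ l * q ^ (-l + m) * q ^ 1) := by
    simpa using rpow_eq_mul hq 1 1 (by push_cast; ring)
  have b4 : coeffBZero q s M (l + 1) (m - 1) = -((q ^ l * q ^ (-l + m) * q ^ 1) *
    (√(qNum q 2) * √(qNum q (l - m + 2)) * √(qNum q (l + m + 1))) * betaCoeff q s M (l + 1)) := by
    rw [coeffBZero_eq hq hq1 (by linarith), b4w, show l + 1 - (m - 1) = l - m + 2 by ring, show l +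
      1 + (m - 1) + 1 = l + m + 1 by ring]
  have a1w : q ^ m = (q ^ l * q ^ (-l + m)) := by
    simpa using rpow_eq_mul hq 1 0 (by push_cast; ring)
  have a1 : coeffAPlus q s M (l) (m) = (q ^ l * q ^ (-l + m)) *
    (√(qNum q 2) * √(qNum q (l - m + 1)) * √(qNum q (l + m + 1))) * alphaCoeff q s M (l + 1) := by
    rw [coeffAPlus_eq hq hq1 (by linarith), a1w]
  have a2w : q ^ (l + 1 + m + 1) = ((q ^ l) ^ 2 * q ^ (-l + m) * q ^ 2) := by
    simpa using rpow_eq_mul hq 2 2 (by push_cast; ring)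
  have a2 : coeffAZero q s M (l + 1) (m) = (qNum q (2 * l + 2) -
    ((q ^ l) ^ 2 * q ^ (-l + m) * q ^ 2) * qNum q 2 * qNum q (l - m + 1)) * betaCoeff q s M (l + 1)
    := by
    rw [coeffAZero, a2w, show 2 * (l + 1) = 2 * l + 2 by ring, show l + 1 - m = l - m + 1 by ring]
  have a3w : q ^ (l + m + 1) = ((q ^ l) ^ 2 * q ^ (-l + m) * q ^ 1) := by
    simpa using rpow_eq_mul hq 2 1 (by push_cast; ring)
  have a3 : coeffAZero q s M (l) (m) = (qNum q (2 * l) - ((q ^ l) ^ 2 * q ^ (-l + m) * q ^ 1) *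
    qNum q 2 * qNum q (l - m)) * betaCoeff q s M l := by
    rw [coeffAZero, a3w]
  rw [b1, b2, b3, b4, a1, a2, a3]
  have hp2 := Real.mul_self_sqrt (qNum_nonneg hq hq1 (show 0 ≤ l - m + 2 by linarith))
  have hr0 := Real.mul_self_sqrt (qNum_nonneg hq hq1 (show 0 ≤ l + m by linarith))
  have hrec := betaCoeff_rec (s := s) (M := M) hq hq1 hl
  have hc : q * qNum q 2 = q ^ 2 + 1 := by rw [qNum_two hq hq1]; field_simp
  have hqi : q * (q ^ 1)⁻¹ = 1 := by rw [pow_one]; exact mul_inv_cancel₀ hq.ne'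
  have hn := qNum_up_mulStar_succ (l := l) (m := m) hq hq1
  have hn2 := qNum_up_mulStar (l := l) (m := m) hq hq1
  linear_combination (q ^ l * q ^ (-l + m) * √(qNum q 2) * √(qNum q (l - m + 1)) *
    √(qNum q (l + m + 1)) * alphaCoeff q s M (l + 1)) * ((1 - s ^ 2) * hc +
    betaCoeff q s M (l + 1) * hn - betaCoeff q s M l * hn2 + hrec)
    - ((q * qNum q 2) * (q ^ l * q ^ (-l + m) * √(qNum q 2) * √(qNum q (l - m + 1)) *
      √(qNum q (l + m + 1)) * alphaCoeff q s M (l + 1)) * q ^ (-l + m) * betaCoeff q s M l) *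
      (√(qNum q (l + m)) ^ 2 * hqi + hr0) + ((q * qNum q 2) *
      (q ^ l * q ^ (-l + m) * √(qNum q 2) * √(qNum q (l - m + 1)) * √(qNum q (l + m + 1)) *
      alphaCoeff q s M (l + 1)) * (q ^ l) ^ 2 * q ^ (-l + m) * q ^ 2 *
      betaCoeff q s M (l + 1)) * hp2

/-- The critical boundary is now l + m = 0, where [l + m − 1] is negative; `hr` replaces the failing
square of its root. -/
theorem mulStar_coeff_zero {q s M l m : ℝ} (hq : 0 < q) (hq1 : q < 1) (hl : 0 < l) (h₁ : 0 ≤ l - m)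
    (h₂ : 0 ≤ l + m)
    (hα : qNum q (2 * l - 1) * alphaCoeff q s M l ^ 2 = alphaLow q s M l)
    (hα' : qNum q (2 * l + 3) * alphaCoeff q s M (l + 1) ^ 2 = alphaHigh q s M (l + 1))
    (hr : √(qNum q (l + m)) * (√(qNum q (l + m - 1)) * √(qNum q (l + m - 1)))
      = √(qNum q (l + m)) * qNum q (l + m - 1)) :
    q * qNum q 2 * (coeffBPlus q s M (l - 1) (m - 1) ^ 2 + coeffBZero q s M l (m - 1) ^ 2
        + coeffBMinus q s M (l + 1) (m - 1) ^ 2)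
      + (coeffAPlus q s M l m ^ 2 + coeffAZero q s M l m ^ 2 + coeffAPlus q s M (l - 1) m ^ 2)
      + (q * qNum q 2 - 2) * (1 - s ^ 2) * coeffAZero q s M l m
      + (1 - s ^ 2 + q * qNum q 2 * s ^ 2) * (1 - s ^ 2 - q * qNum q 2) = 0 := by
  have hX : 0 < q ^ l := Real.rpow_pos_of_pos hq _
  have hY : 0 < q ^ m := Real.rpow_pos_of_pos hq _
  have b1w : q ^ (-(l - 1) + (m - 1)) = (q ^ (-l + m)) := by
    simpa using rpow_eq_mul hq 0 0 (by push_cast; ring)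
  have b1 : coeffBPlus q s M (l - 1) (m - 1) = (q ^ (-l + m)) *
    (√(qNum q (l + m - 1)) * √(qNum q (l + m))) * alphaCoeff q s M l := by
    rw [coeffBPlus_eq hq hq1 (by linarith), b1w, show l - 1 + (m - 1) + 1 = l + m - 1 by ring,
      show l - 1 + (m - 1) + 2 = l + m by ring, show l - 1 + 1 = l by ring]
  have b2w : q ^ (m - 1 + 2) = (q ^ l * q ^ (-l + m) * q ^ 1) := by
    simpa using rpow_eq_mul hq 1 1 (by push_cast; ring)
  have b2 : coeffBZero q s M (l) (m - 1) = -((q ^ l * q ^ (-l + m) * q ^ 1) *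
    (√(qNum q 2) * √(qNum q (l - m + 1)) * √(qNum q (l + m))) * betaCoeff q s M l) := by
    rw [coeffBZero_eq hq hq1 (by linarith), b2w, show l - (m - 1) = l - m + 1 by ring, show l +
      (m - 1) + 1 = l + m by ring]
  have b3w : q ^ (l + 1 + (m - 1) + 1) = ((q ^ l) ^ 2 * q ^ (-l + m) * q ^ 1) := by
    simpa using rpow_eq_mul hq 2 1 (by push_cast; ring)
  have b3 : coeffBMinus q s M (l + 1) (m - 1) = -(((q ^ l) ^ 2 * q ^ (-l + m) * q ^ 1) *
    (√(qNum q (l - m + 2)) * √(qNum q (l - m + 1))) * alphaCoeff q s M (l + 1)) := by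
    rw [coeffBMinus_eq hq hq1 (by linarith), b3w, show l + 1 - (m - 1) - 1 = l - m + 1 by ring,
      show l + 1 - (m - 1) = l - m + 2 by ring]
  have a1w : q ^ m = (q ^ l * q ^ (-l + m)) := by
    simpa using rpow_eq_mul hq 1 0 (by push_cast; ring)
  have a1 : coeffAPlus q s M (l) (m) = (q ^ l * q ^ (-l + m)) *
    (√(qNum q 2) * √(qNum q (l - m + 1)) * √(qNum q (l + m + 1))) * alphaCoeff q s M (l + 1) := by
    rw [coeffAPlus_eq hq hq1 (by linarith), a1w]
  have a2w : q ^ m = (q ^ l * q ^ (-l + m)) := by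
    simpa using rpow_eq_mul hq 1 0 (by push_cast; ring)
  have a2 : coeffAPlus q s M (l - 1) (m) = (q ^ l * q ^ (-l + m)) *
    (√(qNum q 2) * √(qNum q (l - m)) * √(qNum q (l + m))) * alphaCoeff q s M l := by
    rw [coeffAPlus_eq hq hq1 (by linarith), a2w, show l - 1 - m + 1 = l - m by ring, show l - 1 +
      m + 1 = l + m by ring, show l - 1 + 1 = l by ring]
  rw [b1, b2, b3, a1, a2]
  have hk := Real.mul_self_sqrt (qNum_nonneg hq hq1 zero_le_two)
  have hp0 := Real.mul_self_sqrt (qNum_nonneg hq hq1 (show 0 ≤ l - m by linarith))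
  have hp1 := Real.mul_self_sqrt (qNum_nonneg hq hq1 (show 0 ≤ l - m + 1 by linarith))
  have hp2 := Real.mul_self_sqrt (qNum_nonneg hq hq1 (show 0 ≤ l - m + 2 by linarith))
  have hr0 := Real.mul_self_sqrt (qNum_nonneg hq hq1 (show 0 ≤ l + m by linarith))
  have hr1 := Real.mul_self_sqrt (qNum_nonneg hq hq1 (show 0 ≤ l + m + 1 by linarith))
  have hn3 := qNum_alpha_up_mulStar (l := l) (m := m) hq hq1
  have hn4 := qNum_alpha_down_mulStar (l := l) (m := m) hq hq1
  have w1 : q ^ (m + l + 1) = (q ^ l) ^ 2 * q ^ (-l + m) * q := by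
    simpa using rpow_eq_mul hq 2 1 (by push_cast; ring)
  have w2 : q ^ (m - l) = q ^ (-l + m) := by
    simpa using rpow_eq_mul hq 0 0 (by push_cast; ring)
  have w3 : q ^ (2 * m + 2) = (q ^ l * q ^ (-l + m)) ^ 2 * q ^ 2 := by
    simp only [Real.rpow_add hq, Real.rpow_sub hq, Real.rpow_neg hq.le, Real.rpow_one,
      Real.rpow_ofNat, two_mul]
    field_simp
  have hd := diag_mul_star (s := s) (M := M) (m := m) hq hq1 hl
  rw [w1, w2, w3] at hd
  have hz : (1 - s ^ 2 - coeffAZero q s M l m + q * qNum q 2 * s ^ 2)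
      * (1 - s ^ 2 - coeffAZero q s M l m - q * qNum q 2) / (q * qNum q 2) * (q * qNum q 2)
      = (1 - s ^ 2 - coeffAZero q s M l m + q * qNum q 2 * s ^ 2)
      * (1 - s ^ 2 - coeffAZero q s M l m - q * qNum q 2) :=
    div_mul_cancel₀ _ (mul_pos hq (qNum_pos hq hq1 two_pos)).ne'
  linear_combination (q * qNum q 2) * hd + (qNum q 2 * (q ^ l) ^ 2 * q ^ (-l + m) *
    qNum q (l - m + 1) * alphaCoeff q s M (l + 1) ^ 2) * hn3 +
    (qNum q 2 * qNum q (l + m) * q ^ (-l + m) * alphaCoeff q s M l ^ 2) * hn4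
    + ((q * qNum q 2) * q * (q ^ l) ^ 2 * q ^ (-l + m) * qNum q (l - m + 1)) * hα' +
      ((q * qNum q 2) * q ^ (-l + m) * qNum q (l + m)) * hα
    + ((q * qNum q 2) * (q ^ l) ^ 4 * (q ^ (-l + m)) ^ 2 * q ^ 2 * alphaCoeff q s M (l + 1) ^ 2) *
      (√(qNum q (l - m + 2)) ^ 2 * hp1 + qNum q (l - m + 1) * hp2)
    + ((q * qNum q 2) * (q ^ (-l + m)) ^ 2 * alphaCoeff q s M l ^ 2) *
      (√(qNum q (l + m)) * hr + qNum q (l + m - 1) * hr0)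
    + ((q * qNum q 2) * (q ^ l * q ^ (-l + m)) ^ 2 * q ^ 2 * betaCoeff q s M l ^ 2) *
      (√(qNum q (l - m + 1)) ^ 2 * √(qNum q (l + m)) ^ 2 * hk + qNum q 2 * √(qNum q (l + m)) ^ 2 *
      hp1 + qNum q 2 * qNum q (l - m + 1) * hr0)
    + ((q ^ l * q ^ (-l + m)) ^ 2 * alphaCoeff q s M (l + 1) ^ 2) *
      (√(qNum q (l - m + 1)) ^ 2 * √(qNum q (l + m + 1)) ^ 2 * hk + qNum q 2 *
      √(qNum q (l + m + 1)) ^ 2 * hp1 + qNum q 2 * qNum q (l - m + 1) * hr1)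
    + ((q ^ l * q ^ (-l + m)) ^ 2 * alphaCoeff q s M l ^ 2) *
      (√(qNum q (l - m)) ^ 2 * √(qNum q (l + m)) ^ 2 * hk + qNum q 2 * √(qNum q (l + m)) ^ 2 *
      hp0 + qNum q 2 * qNum q (l - m) * hr0)
    - hz

/-! ### Basis vectors and weighted shifts on ℓ². -/

section
variable {N : ℝ}

theorem ket_apply (N : ℝ) (ε : Bool) (l m : ℝ) (y : Label N) :
    ket N ε l m y = if y.1.1.1 = l ∧ y.1.1.2 = m ∧ y.2 = ε then 1 else 0 := by
  obtain ⟨⟨⟨l', m'⟩, h'⟩, ε'⟩ := y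
  by_cases h : Valid N l m
  · rw [ket, dif_pos h, lp.single_apply]
    by_cases hy : ((⟨(l', m'), h'⟩, ε') : Label N) = (⟨(l, m), h⟩, ε)
    · have h2 : l' = l ∧ m' = m ∧ ε' = ε := by simpa [and_assoc] using hy
      rw [if_pos h2, hy, Pi.single_eq_same]
    · have h2 : ¬ (l' = l ∧ m' = m ∧ ε' = ε) := by simpa [and_assoc] using hy
      rw [if_neg h2, Pi.single_eq_of_ne hy]
  · rw [ket, dif_neg h, if_neg]
    · rfl
    · rintro ⟨rfl, rfl, -⟩
      exact h h'

theorem ket_of_not_valid {ε : Bool} {l m : ℝ} (h : ¬ Valid N l m) : ket N ε l m = 0 := by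
  rw [ket, dif_neg h]

/-- A weighted shift with boundary: the k-th entry reads v at the index whose f-image is g k, or 0
if there is none. Injectivity of f makes the reading well defined; injectivity of g ensures that no
entry is read twice, so the norm is at most that of the weight. -/
theorem exists_weightedComposition {κ β : Type} {f g : κ → β} (hf : Function.Injective f)
    (hg : Function.Injective g) (w : κ → ℂ) {C : ℝ} (hw : ∀ k, ‖w k‖ ≤ C) :
    ∃ S : lp (fun _ : κ => ℂ) 2 →L[ℂ] lp (fun _ : κ => ℂ) 2,
      ∀ v k, S v k = w k * Function.extend f v 0 (g k) := by
  have hext : ∀ (v : κ → ℂ) (b : β), ‖Function.extend f v 0 b‖ ^ 2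
      = Function.extend f (fun k => ‖v k‖ ^ 2) 0 b := by
    intro v b
    by_cases hb : ∃ a, f a = b
    · obtain ⟨a, rfl⟩ := hb
      rw [hf.extend_apply, hf.extend_apply]
    · rw [Function.extend_apply' _ _ _ hb, Function.extend_apply' _ _ _ hb]
      simp
  have hsum : ∀ v : lp (fun _ : κ => ℂ) 2, Summable fun k => ‖v k‖ ^ 2 := fun v => by
    simpa using (lp.memℓp v).summable (by norm_num)
  have hsum' : ∀ v : lp (fun _ : κ => ℂ) 2,
      Summable fun b => ‖Function.extend f v 0 b‖ ^ 2 := fun v => by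
    simp only [hext]
    exact (summable_extend_zero hf).2 (hsum v)
  have hle : ∀ (v : lp (fun _ : κ => ℂ) 2) (k : κ), ‖w k * Function.extend f v 0 (g k)‖ ^ 2
      ≤ C ^ 2 * ‖Function.extend f v 0 (g k)‖ ^ 2 := fun v k => by
    rw [norm_mul, mul_pow]
    gcongr
    exact hw k
  have hsum2 : ∀ v : lp (fun _ : κ => ℂ) 2,
      Summable fun k => C ^ 2 * ‖Function.extend f v 0 (g k)‖ ^ 2 := fun v =>
    ((hsum' v).comp_injective hg).mul_left _
  have hmem : ∀ v : lp (fun _ : κ => ℂ) 2, Memℓp (fun k => w k * Function.extend f v 0 (g k)) 2 :=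
    fun v => by
      refine memℓp_gen ?_
      simpa using Summable.of_nonneg_of_le (fun _ => by positivity) (hle v) (hsum2 v)
  -- The norm bound is |C| because C may be negative when κ is empty.
  refine ⟨LinearMap.mkContinuous
    { toFun := fun v => ⟨fun k => w k * Function.extend f v 0 (g k), hmem v⟩
      map_add' := fun v v' => ?_
      map_smul' := fun c v => ?_ } |C| (fun v => ?_), fun v k => rfl⟩
  · ext k
    change w k * _ = w k * _ + w k * _
    rw [← mul_add]
    congr 1
    by_cases hb : ∃ a, f a = g k
    · obtain ⟨a, ha⟩ := hb
      rw [← ha, hf.extend_apply, hf.extend_apply, hf.extend_apply]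
      rfl
    · rw [Function.extend_apply' _ _ _ hb, Function.extend_apply' _ _ _ hb,
        Function.extend_apply' _ _ _ hb]
      simp
  · ext k
    change w k * _ = c * (w k * _)
    rw [mul_left_comm]
    congr 1
    by_cases hb : ∃ a, f a = g k
    · obtain ⟨a, ha⟩ := hb
      rw [← ha, hf.extend_apply, hf.extend_apply]
      rfl
    · simp [Function.extend_apply' _ _ _ hb]
  · refine abs_le_of_sq_le_sq' ?_ (by positivity) |>.2
    have h2 : (0 : ℝ) < (2 : ENNReal).toReal := by norm_num
    have e1 := lp.norm_rpow_eq_tsum h2 v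
    have e2 := lp.norm_rpow_eq_tsum h2 (⟨fun k => w k * Function.extend f v 0 (g k), hmem v⟩ :
      lp (fun _ : κ => ℂ) 2)
    simp only [ENNReal.toReal_ofNat, Real.rpow_ofNat] at e1 e2
    change ‖(⟨fun k => w k * Function.extend f v 0 (g k), hmem v⟩ :
      lp (fun _ : κ => ℂ) 2)‖ ^ 2 ≤ _
    rw [e2, mul_pow, e1, sq_abs]
    have h3 : Summable fun k => ‖w k * Function.extend f v 0 (g k)‖ ^ 2 :=
      Summable.of_nonneg_of_le (fun _ => by positivity) (hle v) (hsum2 v)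
    refine (h3.tsum_le_tsum (hle v) (hsum2 v)).trans ?_
    rw [tsum_mul_left]
    refine mul_le_mul_of_nonneg_left ?_ (sq_nonneg C)
    have h4 : ∑' k, ‖v k‖ ^ 2 = ∑' b, ‖Function.extend f v 0 b‖ ^ 2 := by
      simp only [hext]
      exact (tsum_extend_zero hf _).symm
    rw [h4]
    exact tsum_comp_le_tsum_of_inj (hsum' v) (fun _ => by positivity) hg

theorem inner_ket {ε : Bool} {l m : ℝ} (h : Valid N l m) (v : Spinors N) :
    inner ℂ (ket N ε l m) v = v (⟨(l, m), h⟩, ε) := by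
  rw [ket, dif_pos h, lp.inner_single_left]
  simp
/-- The labels as triples `(l, m, ε)`. -/
def Label.triple (x : Label N) : ℝ × ℝ × Bool := (x.1.1.1, x.1.1.2, x.2)

theorem Label.triple_injective : Function.Injective (Label.triple (N := N)) := by
  rintro ⟨⟨⟨l, m⟩, h⟩, ε⟩ ⟨⟨⟨l', m'⟩, h'⟩, ε'⟩ e
  simp only [Label.triple, Prod.mk.injEq] at e
  obtain ⟨rfl, rfl, rfl⟩ := e
  rfl

open Classical in
-- Source and target are compared as triples of reals, so a shift out of the admissible labels reads
-- 0. Since the weights are real, the adjoint is the opposite shift with the weights evaluated at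
-- its target.
theorem exists_weightedShift (N d e : ℝ) (w : Bool → ℝ → ℝ → ℝ) {C : ℝ} (hC : 0 ≤ C)
    (hw : ∀ ε l m, Valid N l m → |w ε l m| ≤ C) :
    ∃ S : Spinors N →L[ℂ] Spinors N, ∀ ε l m, Valid N l m →
      S (ket N ε l m) = (w ε l m : ℂ) • ket N ε (l + d) (m + e) ∧
      star S (ket N ε l m) = (w ε (l - d) (m - e) : ℂ) • ket N ε (l - d) (m - e) := by
  obtain ⟨S, hS⟩ := exists_weightedComposition (Label.triple_injective (N := N))
    (g := fun x : Label N => (x.1.1.1 - d, x.1.1.2 - e, x.2))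
    (by
      rintro ⟨⟨⟨l, m⟩, h⟩, ε⟩ ⟨⟨⟨l', m'⟩, h'⟩, ε'⟩ e
      simp only [Prod.mk.injEq, sub_left_inj] at e
      obtain ⟨rfl, rfl, rfl⟩ := e
      rfl)
    (fun x => if Valid N (x.1.1.1 - d) (x.1.1.2 - e) then
      (w x.2 (x.1.1.1 - d) (x.1.1.2 - e) : ℂ) else 0) (C := C)
    (fun x => by
      split_ifs with h
      · rw [Complex.norm_real, Real.norm_eq_abs]
        exact hw _ _ _ h
      · simpa using hC)
  have key : ∀ ε l m, Valid N l m → S (ket N ε l m) = (w ε l m : ℂ) • ket N ε (l + d) (m + e) := by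
    intro ε l m h
    ext y
    rw [hS]
    change _ = (w ε l m : ℂ) * ket N ε (l + d) (m + e) y
    rw [ket_apply]
    obtain ⟨⟨⟨l', m'⟩, h'⟩, ε'⟩ := y
    by_cases hv : Valid N (l' - d) (m' - e)
    · have := Label.triple_injective.extend_apply (ket N ε l m) 0 (⟨(l' - d, m' - e), hv⟩, ε')
      simp only [Label.triple] at this
      rw [if_pos hv, this, ket_apply]
      simp only [sub_eq_iff_eq_add]
      by_cases hc : l' = l + d ∧ m' = m + e ∧ ε' = ε
      · obtain ⟨rfl, rfl, rfl⟩ := hc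
        simp
      · rw [if_neg hc, mul_zero, mul_zero]
    · rw [if_neg hv, if_neg]
      · simp
      · rintro ⟨rfl, rfl, -⟩
        exact hv (by simpa using h)
  refine ⟨S, fun ε l m h => ⟨key ε l m h, ?_⟩⟩
  ext y
  obtain ⟨⟨⟨l', m'⟩, h'⟩, ε'⟩ := y
  -- The adjoint is computed entrywise by pairing with a basis vector and moving the operator to the
  -- other side.
  rw [← inner_ket h', ContinuousLinearMap.star_eq_adjoint, ContinuousLinearMap.adjoint_inner_right,
    ← inner_conj_symm, inner_ket h, key _ _ _ h']
  change starRingEnd ℂ ((w ε' l' m' : ℂ) * ket N ε' (l' + d) (m' + e) _)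
    = (w ε (l - d) (m - e) : ℂ) * ket N ε (l - d) (m - e) _
  rw [ket_apply, ket_apply]
  by_cases hc : l = l' + d ∧ m = m' + e ∧ ε = ε'
  · obtain ⟨rfl, rfl, rfl⟩ := hc
    simp
  · rw [if_neg hc, if_neg]
    · simp
    · rintro ⟨rfl, rfl, rfl⟩
      simp at hc

theorem clm_ext_ket {E : Type} [NormedAddCommGroup E] [NormedSpace ℂ E]
    {S T : Spinors N →L[ℂ] E} (h : ∀ ε l m, Valid N l m → S (ket N ε l m) = T (ket N ε l m)) :
    S = T := by
  ext v
  have hv := lp.hasSum_single (by norm_num : (2 : ENNReal) ≠ ⊤) v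
  have hS := hv.mapL S
  have hT := hv.mapL T
  refine hS.unique ?_
  convert hT using 2 with x
  obtain ⟨⟨⟨l, m⟩, hx⟩, ε⟩ := x
  have e1 : (lp.single 2 ((⟨(l, m), hx⟩, ε) : Label N) (v (⟨(l, m), hx⟩, ε)) : Spinors N)
      = v (⟨(l, m), hx⟩, ε) • ket N ε l m := by
    rw [ket, dif_pos hx, ← lp.single_smul, smul_eq_mul, mul_one]
  rw [e1, map_smul, map_smul, h _ _ _ hx]

end

/-! ### Admissible labels, and coefficients that vanish at their boundary. -/

section
variable {N : ℝ}

/-- Since 2l = 2(l − |N|) + 2|N| is an integer, l − m is an integer if and only if l + m is. The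
symmetric form turns each shift of (l, m) into shifts of three natural numbers. -/
theorem valid_iff (hN : ∃ k : ℤ, N = k / 2) {l m : ℝ} :
    Valid N l m ↔ (∃ a : ℕ, l - |N| = a) ∧ (∃ b : ℕ, l - m = b) ∧ ∃ c : ℕ, l + m = c := by
  obtain ⟨k, hk⟩ := hN
  have h2N : 2 * |N| = (k.natAbs : ℝ) := by
    rw [hk, abs_div, abs_two, Nat.cast_natAbs, Int.cast_abs]
    ring
  constructor
  · rintro ⟨⟨a, ha⟩, ⟨b, hb⟩⟩
    have key : ∀ x : ℝ, 0 ≤ x → 2 * l - b = x → ∃ c : ℕ, x = c := by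
      intro x hx h
      have h3 : x = ((2 * a + k.natAbs - b : ℤ) : ℝ) := by
        push_cast
        rw [Nat.cast_natAbs, Int.cast_abs] at h2N
        linarith
      have h4 : (0 : ℤ) ≤ 2 * a + k.natAbs - b := by
        rw [h3] at hx
        exact_mod_cast hx
      obtain ⟨c, hc⟩ := Int.eq_ofNat_of_zero_le h4
      refine ⟨c, ?_⟩
      rw [h3, hc]
      simp
    have hb0 : (0 : ℝ) ≤ b := b.cast_nonneg
    refine ⟨⟨a, ha⟩, ?_⟩
    rcases le_total 0 m with hm | hm
    · rw [abs_of_nonneg hm] at hb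
      exact ⟨⟨b, hb⟩, key _ (by linarith) (by linarith)⟩
    · rw [abs_of_nonpos hm] at hb
      exact ⟨key _ (by linarith) (by linarith), ⟨b, by linarith⟩⟩
  · rintro ⟨ha, ⟨b, hb⟩, ⟨c, hc⟩⟩
    refine ⟨ha, ?_⟩
    rcases le_total 0 m with hm | hm
    · exact ⟨b, by rw [abs_of_nonneg hm, hb]⟩
    · exact ⟨c, by rw [abs_of_nonpos hm, ← hc]; ring⟩

theorem Valid.one_half_le (hN : ∃ k : ℤ, N = k / 2) (hN0 : N ≠ 0) {l m : ℝ} (h : Valid N l m) :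
    1 / 2 ≤ |N| ∧ |N| ≤ l ∧ 0 ≤ l - m ∧ 0 ≤ l + m := by
  obtain ⟨⟨a, ha⟩, ⟨b, hb⟩, ⟨c, hc⟩⟩ := (valid_iff hN).1 h
  have ha0 : (0 : ℝ) ≤ a := a.cast_nonneg
  refine ⟨?_, by linarith, by rw [hb]; positivity, by rw [hc]; positivity⟩
  obtain ⟨k, rfl⟩ := hN
  have hk : k ≠ 0 := by rintro rfl; simp at hN0
  rw [abs_div, abs_two, ← Int.cast_abs]
  have : (1 : ℝ) ≤ ((|k| : ℤ) : ℝ) := by exact_mod_cast Int.one_le_abs hk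
  linarith

theorem eq_zero_or_exists_pred {x : ℝ} (h : ∃ n : ℕ, x = n) : x = 0 ∨ ∃ n : ℕ, x - 1 = n := by
  obtain ⟨n, rfl⟩ := h
  rcases n with _ | n
  · simp
  · exact Or.inr ⟨n, by push_cast; ring⟩

theorem exists_succ {x y : ℝ} (h : ∃ n : ℕ, x = n) (e : y = x + 1) : ∃ n : ℕ, y = n := by
  obtain ⟨n, rfl⟩ := h
  exact ⟨n + 1, by push_cast; exact e⟩

/-- Only x = 0 is delicate: there [x − 1] < 0, and squaring its root does not give it back, but both
sides carry the factor √[0] = 0. -/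
theorem sqrt_mul_sqrt_pred {q x : ℝ} (hq : 0 < q) (hq1 : q < 1) (h : ∃ n : ℕ, x = n) :
    √(qNum q x) * (√(qNum q (x - 1)) * √(qNum q (x - 1))) = √(qNum q x) * qNum q (x - 1) := by
  rcases eq_zero_or_exists_pred h with rfl | ⟨n, hn⟩
  · simp [qNum]
  · rw [Real.mul_self_sqrt (qNum_nonneg hq hq1 (by rw [hn]; positivity))]

@[simp] theorem qNum_zero (q : ℝ) : qNum q 0 = 0 := by simp [qNum]

theorem abs_signed (N : ℝ) (ε : Bool) : |signed N ε| = |N| := by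
  cases ε <;> simp [signed]

theorem qNum_add_mul_sub_nonneg {q M l : ℝ} (hq : 0 < q) (hq1 : q < 1) (h : |M| ≤ l) :
    0 ≤ qNum q (l + M) ∧ 0 ≤ qNum q (l - M) := by
  have := abs_le.1 h
  exact ⟨qNum_nonneg hq hq1 (by linarith), qNum_nonneg hq hq1 (by linarith)⟩

theorem qNum_add_mul_sub_eq_zero {q M l : ℝ} (h : l = |M|) :
    qNum q (l + M) * qNum q (l - M) = 0 := by
  rcases abs_choice M with hM | hM <;> simp [h, hM]

theorem alphaCoeff_eq_zero {q s M l : ℝ} (h : l = |M|) : alphaCoeff q s M l = 0 := by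
  rw [alphaCoeff, mul_assoc (qNum q 2), qNum_add_mul_sub_eq_zero h]
  simp

theorem alphaCoeff_sq {q s M l : ℝ} (hq : 0 < q) (hq1 : q < 1) (h : |M| ≤ l) (hl : 1 / 2 ≤ l) :
    alphaCoeff q s M l ^ 2 = qNum q 2 * qNum q (l + M) * qNum q (l - M)
      / (qNum q (2 * l - 1) * qNum q (2 * l + 1))
      * ((q ^ (l + M) + q ^ (-(l + M)) * s ^ 2) * (q ^ (l - M) * s ^ 2 + q ^ (-(l - M))))
      / qNum q (2 * l) ^ 2 := by
  obtain ⟨h1, h2⟩ := qNum_add_mul_sub_nonneg hq hq1 h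
  have h3 := qNum_nonneg hq hq1 zero_le_two
  have h4 := qNum_nonneg hq hq1 (show 0 ≤ 2 * l - 1 by linarith)
  have h5 := qNum_nonneg hq hq1 (show 0 ≤ 2 * l + 1 by linarith)
  rw [alphaCoeff, mul_pow, mul_pow, Real.sq_sqrt (by positivity), Real.sq_sqrt (by positivity)]
  ring

/-- For l = 1/2 the definition of α divides by [2l − 1] = 0. There |M| = l is forced, so `alphaLow`
contains the factor [l + M][l − M] = 0 and both sides are zero. -/
theorem alphaCoeff_low {q s M l : ℝ} (hq : 0 < q) (hq1 : q < 1) (hM : 1 / 2 ≤ |M|) (h : |M| ≤ l) :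
    qNum q (2 * l - 1) * alphaCoeff q s M l ^ 2 = alphaLow q s M l := by
  rw [alphaCoeff_sq hq hq1 h (hM.trans h), alphaLow]
  have h5 := (qNum_pos hq hq1 (show 0 < 2 * l + 1 by linarith)).ne'
  have h6 := (qNum_pos hq hq1 (show 0 < 2 * l by linarith)).ne'
  rcases (hM.trans h).eq_or_lt with rfl | hl
  · rw [mul_assoc (qNum q 2), qNum_add_mul_sub_eq_zero (le_antisymm hM h)]
    simp
  · have h4 := (qNum_pos hq hq1 (show 0 < 2 * l - 1 by linarith)).ne'
    field_simp

theorem alphaCoeff_high {q s M l : ℝ} (hq : 0 < q) (hq1 : q < 1) (hM : 1 / 2 ≤ |M|) (h : |M| ≤ l) :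
    qNum q (2 * l + 3) * alphaCoeff q s M (l + 1) ^ 2 = alphaHigh q s M (l + 1) := by
  rw [alphaCoeff_sq hq hq1 (by linarith) (by linarith), alphaHigh,
    show 2 * (l + 1) + 1 = 2 * l + 3 by ring]
  have h4 := (qNum_pos hq hq1 (show 0 < 2 * (l + 1) - 1 by linarith)).ne'
  have h5 := (qNum_pos hq hq1 (show 0 < 2 * l + 3 by linarith)).ne'
  have h6 := (qNum_pos hq hq1 (show 0 < 2 * (l + 1) by linarith)).ne'
  field_simp

section Vanishing
variable {q s M l m : ℝ}

/-- A label can stop being admissible through l − |N|, l − m or l + m. The first case is killed by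
α, which vanishes at l = |M|, the others by a q-number under the square root. Hence no matrix
element leads out of the admissible labels, and the relations can be expanded as if there were no
boundary. -/
theorem coeffAPlus_pred_eq_zero (hN : ∃ k : ℤ, N = k / 2) (hM : |M| = |N|) (h : Valid N l m)
    (h' : ¬ Valid N (l - 1) m) : coeffAPlus q s M (l - 1) m = 0 := by
  obtain ⟨ha, hb, hc⟩ := (valid_iff hN).1 h
  rw [coeffAPlus, sub_add_cancel, show l - 1 - m + 1 = l - m by ring,
    show l - 1 + m + 1 = l + m by ring]
  rcases eq_zero_or_exists_pred ha with e | ha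
  · rw [alphaCoeff_eq_zero (by linarith), mul_zero]
  rcases eq_zero_or_exists_pred hb with e | hb
  · simp [e]
  rcases eq_zero_or_exists_pred hc with e | hc
  · simp [e]
  exact absurd ((valid_iff hN).2 ⟨by convert ha using 3; ring, by convert hb using 3; ring,
    by convert hc using 3; ring⟩) h'

theorem coeffBZero_eq_zero (hN : ∃ k : ℤ, N = k / 2) (h : Valid N l m)
    (h' : ¬ Valid N l (m + 1)) : coeffBZero q s M l m = 0 := by
  obtain ⟨ha, hb, hc⟩ := (valid_iff hN).1 h
  rw [coeffBZero]
  rcases eq_zero_or_exists_pred hb with e | hb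
  · simp [e]
  exact absurd ((valid_iff hN).2 ⟨ha, by convert hb using 3; ring,
    exists_succ hc (by ring)⟩) h'

theorem coeffBZero_pred_eq_zero (hN : ∃ k : ℤ, N = k / 2) (h : Valid N l m)
    (h' : ¬ Valid N l (m - 1)) : coeffBZero q s M l (m - 1) = 0 := by
  obtain ⟨ha, hb, hc⟩ := (valid_iff hN).1 h
  rw [coeffBZero, show l + (m - 1) + 1 = l + m by ring]
  rcases eq_zero_or_exists_pred hc with e | hc
  · simp [e]
  exact absurd ((valid_iff hN).2 ⟨ha, exists_succ hb (by ring), by convert hc using 3; ring⟩) h'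

theorem coeffBMinus_eq_zero (hN : ∃ k : ℤ, N = k / 2) (hM : |M| = |N|) (h : Valid N l m)
    (h' : ¬ Valid N (l - 1) (m + 1)) : coeffBMinus q s M l m = 0 := by
  obtain ⟨ha, hb, hc⟩ := (valid_iff hN).1 h
  rw [coeffBMinus]
  rcases eq_zero_or_exists_pred ha with e | ha
  · rw [alphaCoeff_eq_zero (by linarith), mul_zero, neg_zero]
  rcases eq_zero_or_exists_pred hb with e | hb
  · simp [e]
  -- The step (l − 1, m + 1) lowers l − m by two, so the value 1 has to be excluded as well as 0.
  rcases eq_zero_or_exists_pred hb with e | hb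
  · simp [e]
  exact absurd ((valid_iff hN).2 ⟨by convert ha using 3; ring, by convert hb using 3; ring,
    by convert hc using 3; ring⟩) h'

theorem coeffBPlus_pred_eq_zero (hN : ∃ k : ℤ, N = k / 2) (hM : |M| = |N|) (h : Valid N l m)
    (h' : ¬ Valid N (l - 1) (m - 1)) : coeffBPlus q s M (l - 1) (m - 1) = 0 := by
  obtain ⟨ha, hb, hc⟩ := (valid_iff hN).1 h
  rw [coeffBPlus, sub_add_cancel, show l - 1 + (m - 1) + 1 = l + m - 1 by ring,
    show l - 1 + (m - 1) + 2 = l + m by ring]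
  rcases eq_zero_or_exists_pred ha with e | ha
  · rw [alphaCoeff_eq_zero (by linarith), mul_zero]
  rcases eq_zero_or_exists_pred hc with e | hc
  · simp [e]
  rcases eq_zero_or_exists_pred hc with e | hc
  · simp [e]
  exact absurd ((valid_iff hN).2 ⟨by convert ha using 3; ring, by convert hb using 3; ring,
    by convert hc using 3; ring⟩) h'

theorem Valid.up (hN : ∃ k : ℤ, N = k / 2) (h : Valid N l m) : Valid N (l + 1) m := by
  obtain ⟨ha, hb, hc⟩ := (valid_iff hN).1 h
  exact (valid_iff hN).2 ⟨exists_succ ha (by ring), exists_succ hb (by ring),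
    exists_succ hc (by ring)⟩

theorem Valid.up_up (hN : ∃ k : ℤ, N = k / 2) (h : Valid N l m) : Valid N (l + 1) (m + 1) := by
  obtain ⟨ha, hb, hc⟩ := (valid_iff hN).1 h
  exact (valid_iff hN).2 ⟨exists_succ ha (by ring), by convert hb using 3; ring,
    exists_succ (exists_succ hc rfl) (by ring)⟩

theorem Valid.up_down (hN : ∃ k : ℤ, N = k / 2) (h : Valid N l m) : Valid N (l + 1) (m - 1) := by
  obtain ⟨ha, hb, hc⟩ := (valid_iff hN).1 h
  exact (valid_iff hN).2 ⟨exists_succ ha (by ring), exists_succ (exists_succ hb rfl) (by ring),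
    by convert hc using 3; ring⟩

end Vanishing

end

/-! ### Bounded operators with the prescribed matrix elements. -/

section
variable {N : ℝ}

theorem starMul_coeff_zero_of_valid {q s M l m : ℝ} (hq : 0 < q) (hq1 : q < 1)
    (hN : ∃ k : ℤ, N = k / 2) (hN0 : N ≠ 0) (hM : |M| = |N|) (h : Valid N l m) :
    q * qNum q 2 * (coeffBPlus q s M l m ^ 2 + coeffBZero q s M l m ^ 2
        + coeffBMinus q s M l m ^ 2)
      + q ^ 4 * (coeffAPlus q s M l m ^ 2 + coeffAZero q s M l m ^ 2 +
        coeffAPlus q s M (l - 1) m ^ 2)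
      + (q ^ 2 * (q * qNum q 2) - 2 * q ^ 4) * (1 - s ^ 2) * coeffAZero q s M l m
      + (q ^ 2 * (1 - s ^ 2) + q * qNum q 2 * s ^ 2) * (q ^ 2 * (1 - s ^ 2) - q * qNum q 2) = 0 :=
        by
  obtain ⟨h1, h2, h3, h4⟩ := h.one_half_le hN hN0
  exact starMul_coeff_zero hq hq1 (by linarith) h3 h4
    (alphaCoeff_low hq hq1 (hM ▸ h1) (hM ▸ h2)) (alphaCoeff_high hq hq1 (hM ▸ h1) (hM ▸ h2))
    (sqrt_mul_sqrt_pred hq hq1 ((valid_iff hN).1 h).2.1)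

/-- The diagonal of the relation for B*B says that a positive combination of squares, plus τ A⁰ + κ
with constants τ and κ, is zero. Completing the square absorbs the linear term, so every matrix
element is bounded uniformly in the label. -/
theorem exists_coeff_bound {q : ℝ} (s : ℝ) (hq : 0 < q) (hq1 : q < 1)
    (hN : ∃ k : ℤ, N = k / 2) (hN0 : N ≠ 0) :
    ∃ C, 0 ≤ C ∧ ∀ M, |M| = |N| → ∀ l m, Valid N l m →
      |coeffAPlus q s M l m| ≤ C ∧ |coeffAZero q s M l m| ≤ C ∧ |coeffBPlus q s M l m| ≤ C
        ∧ |coeffBZero q s M l m| ≤ C ∧ |coeffBMinus q s M l m| ≤ C := by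
  have hc : q * qNum q 2 = q ^ 2 + 1 := by rw [qNum_two hq hq1]; field_simp
  obtain ⟨τ, hτ⟩ : ∃ τ, τ = (q ^ 2 * (q * qNum q 2) - 2 * q ^ 4) * (1 - s ^ 2) := ⟨_, rfl⟩
  obtain ⟨κ, hκ⟩ : ∃ κ, κ = (q ^ 2 * (1 - s ^ 2) + q * qNum q 2 * s ^ 2)
    * (q ^ 2 * (1 - s ^ 2) - q * qNum q 2) := ⟨_, rfl⟩
  -- Half of q⁴(A⁰)² is spent on τA⁰ at the cost τ²/(2q⁴); the factor 2 restores the full square.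
  -- The weight q[2] = q² + 1 of the squares of the B elements is at least q⁴.
  obtain ⟨K, hK⟩ : ∃ K, K = 2 * (|κ| + τ ^ 2 / (2 * q ^ 4)) / q ^ 4 := ⟨_, rfl⟩
  have hq4 : 0 < q ^ 4 := by positivity
  have hq4' : q ^ 4 ≤ 1 := pow_le_one₀ hq.le hq1.le
  refine ⟨√K, by positivity, fun M hM l m h => ?_⟩
  have key := starMul_coeff_zero_of_valid (s := s) hq hq1 hN hN0 hM h
  rw [← hτ, ← hκ] at key
  have hτ2 : τ ^ 2 / (2 * q ^ 4) * (2 * q ^ 4) = τ ^ 2 := div_mul_cancel₀ _ (by positivity)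
  have hK2 : K * q ^ 4 = 2 * (|κ| + τ ^ 2 / (2 * q ^ 4)) := by
    rw [hK]; exact div_mul_cancel₀ _ hq4.ne'
  obtain ⟨t, ht⟩ : ∃ t, t = τ ^ 2 / (2 * q ^ 4) := ⟨_, rfl⟩
  rw [← ht] at hτ2 hK2
  have hsum : q ^ 4 * (coeffBPlus q s M l m ^ 2 + coeffBZero q s M l m ^ 2
      + coeffBMinus q s M l m ^ 2 + coeffAPlus q s M l m ^ 2 + coeffAPlus q s M (l - 1) m ^ 2
      + coeffAZero q s M l m ^ 2) ≤ K * q ^ 4 := by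
    have e1 : q ^ 4 ≤ q * qNum q 2 := by rw [hc]; nlinarith
    have e2 := mul_le_mul_of_nonneg_right e1 (show 0 ≤ coeffBPlus q s M l m ^ 2
      + coeffBZero q s M l m ^ 2 + coeffBMinus q s M l m ^ 2 by positivity)
    have e3 : -(t * 1) ≤ q ^ 4 / 2 * coeffAZero q s M l m ^ 2 + τ * coeffAZero q s M l m := by
      have h5 := sq_nonneg (q ^ 4 * coeffAZero q s M l m + τ)
      have h6 : 0 ≤ (2 * q ^ 4) * (q ^ 4 / 2 * coeffAZero q s M l m ^ 2
        + τ * coeffAZero q s M l m + t) := by nlinarith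
      have := nonneg_of_mul_nonneg_right h6 (by positivity)
      linarith
    have e4 := neg_abs_le κ
    have e5 : 0 ≤ q ^ 4 * (coeffAPlus q s M l m ^ 2 + coeffAPlus q s M (l - 1) m ^ 2) :=
      by positivity
    have e6 : 0 ≤ q ^ 4 * (coeffBPlus q s M l m ^ 2
      + coeffBZero q s M l m ^ 2 + coeffBMinus q s M l m ^ 2) := by positivity
    rw [hK2]
    nlinarith
  have hsum' := le_of_mul_le_mul_left (hsum.trans_eq (mul_comm _ _)) hq4
  have hb : ∀ x : ℝ, x ^ 2 ≤ K → |x| ≤ √K := fun x hx => Real.abs_le_sqrt hx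
  refine ⟨hb _ ?_, hb _ ?_, hb _ ?_, hb _ ?_, hb _ ?_⟩ <;>
  linarith [sq_nonneg (coeffBPlus q s M l m), sq_nonneg (coeffBZero q s M l m),
    sq_nonneg (coeffBMinus q s M l m), sq_nonneg (coeffAPlus q s M l m),
    sq_nonneg (coeffAPlus q s M (l - 1) m), sq_nonneg (coeffAZero q s M l m)]

/-- `T₀` acts on the basis as the generator `x₀`. -/
def ActsAsXZero (q s N : ℝ) (T : Spinors N →L[ℂ] Spinors N) : Prop :=
  ∀ (ε : Bool) (l m : ℝ), Valid N l m →
    T (ket N ε l m) = (coeffAPlus q s (signed N ε) l m : ℂ) • ket N ε (l + 1) m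
      + (coeffAZero q s (signed N ε) l m : ℂ) • ket N ε l m
      + (coeffAPlus q s (signed N ε) (l - 1) m : ℂ) • ket N ε (l - 1) m

/-- `T₁` acts on the basis as the generator `x₁`. -/
def ActsAsXOne (q s N : ℝ) (T : Spinors N →L[ℂ] Spinors N) : Prop :=
  ∀ (ε : Bool) (l m : ℝ), Valid N l m →
    T (ket N ε l m) = (coeffBPlus q s (signed N ε) l m : ℂ) • ket N ε (l + 1) (m + 1)
      + (coeffBZero q s (signed N ε) l m : ℂ) • ket N ε l (m + 1)
      + (coeffBMinus q s (signed N ε) l m : ℂ) • ket N ε (l - 1) (m + 1)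

/-- `T₁*` acts on the basis as the adjoint of the generator `x₁`. -/
def ActsAsXOneStar (q s N : ℝ) (T : Spinors N →L[ℂ] Spinors N) : Prop :=
  ∀ (ε : Bool) (l m : ℝ), Valid N l m →
    T (ket N ε l m) = (coeffBMinus q s (signed N ε) (l + 1) (m - 1) : ℂ) • ket N ε (l + 1) (m - 1)
      + (coeffBZero q s (signed N ε) l (m - 1) : ℂ) • ket N ε l (m - 1)
      + (coeffBPlus q s (signed N ε) (l - 1) (m - 1) : ℂ) • ket N ε (l - 1) (m - 1)

/-- Writing x₀ as U + V + U*, with U the part that raises l and V diagonal and real, makes it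
self-adjoint by construction and supplies the lowering coefficient. For x₁ three independent shifts
are added. -/
theorem exists_actsAs {q : ℝ} (s : ℝ) (hq : 0 < q) (hq1 : q < 1)
    (hN : ∃ k : ℤ, N = k / 2) (hN0 : N ≠ 0) :
    ∃ T₀ T₁ : Spinors N →L[ℂ] Spinors N, star T₀ = T₀ ∧ ActsAsXZero q s N T₀
      ∧ ActsAsXOne q s N T₁ ∧ ActsAsXOneStar q s N (star T₁) := by
  obtain ⟨C, hC0, hC⟩ := exists_coeff_bound s hq hq1 hN hN0
  obtain ⟨U, hU⟩ := exists_weightedShift N 1 0 (fun ε l m => coeffAPlus q s (signed N ε) l m) hC0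
    fun ε l m h => (hC _ (abs_signed N ε) l m h).1
  obtain ⟨V, hV⟩ := exists_weightedShift N 0 0 (fun ε l m => coeffAZero q s (signed N ε) l m) hC0
    fun ε l m h => (hC _ (abs_signed N ε) l m h).2.1
  obtain ⟨X, hX⟩ := exists_weightedShift N 1 1 (fun ε l m => coeffBPlus q s (signed N ε) l m) hC0
    fun ε l m h => (hC _ (abs_signed N ε) l m h).2.2.1
  obtain ⟨Y, hY⟩ := exists_weightedShift N 0 1 (fun ε l m => coeffBZero q s (signed N ε) l m) hC0
    fun ε l m h => (hC _ (abs_signed N ε) l m h).2.2.2.1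
  obtain ⟨Z, hZ⟩ := exists_weightedShift N (-1) 1 (fun ε l m => coeffBMinus q s (signed N ε) l m) hC0
    fun ε l m h => (hC _ (abs_signed N ε) l m h).2.2.2.2
  have hVs : star V = V := clm_ext_ket fun ε l m h => by
    rw [(hV ε l m h).1, (hV ε l m h).2]
    simp
  refine ⟨U + V + star U, X + Y + Z, ?_, fun ε l m h => ?_, fun ε l m h => ?_, fun ε l m h => ?_⟩
  · rw [star_add, star_add, star_star, hVs]
    abel
  · change U _ + V _ + star U _ = _
    rw [(hU ε l m h).1, (hU ε l m h).2, (hV ε l m h).1]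
    simp
  · change X _ + Y _ + Z _ = _
    rw [(hX ε l m h).1, (hY ε l m h).1, (hZ ε l m h).1, ← sub_eq_add_neg]
    simp
  · rw [star_add, star_add]
    change star X _ + star Y _ + star Z _ = _
    rw [(hX ε l m h).2, (hY ε l m h).2, (hZ ε l m h).2, sub_neg_eq_add]
    simp only [sub_zero]
    abel

end

/-! ### The relations as operator identities. -/

section
variable {N : ℝ}

section Actions
variable {q s : ℝ} {T₀ T₁ S : Spinors N →L[ℂ] Spinors N} {ε : Bool} {l m : ℝ}

/-- For the second factor of a product: the vector may have an inadmissible label, where the formula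
for T₀ is not available, but then its scalar vanishes. The labels l₁ and l₂ are kept as variables so
that shifted sums can be given one common form. -/
theorem ActsAsXZero.smul_ket (h : ActsAsXZero q s N T₀) (c : ℂ) (hc : ¬ Valid N l m → c = 0)
    {l₁ l₂ : ℝ} (h₁ : l₁ = l + 1) (h₂ : l₂ = l - 1) :
    c • T₀ (ket N ε l m) = (c * coeffAPlus q s (signed N ε) l m) • ket N ε l₁ m
      + (c * coeffAZero q s (signed N ε) l m) • ket N ε l m
      + (c * coeffAPlus q s (signed N ε) l₂ m) • ket N ε l₂ m := by
  subst h₁ h₂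
  by_cases hv : Valid N l m
  · rw [h ε l m hv]
    module
  · simp [hc hv]

theorem ActsAsXOne.smul_ket (h : ActsAsXOne q s N T₁) (c : ℂ) (hc : ¬ Valid N l m → c = 0)
    {l₁ l₂ m' : ℝ} (h₁ : l₁ = l + 1) (h₂ : l₂ = l - 1) (h₃ : m' = m + 1) :
    c • T₁ (ket N ε l m) = (c * coeffBPlus q s (signed N ε) l m) • ket N ε l₁ m'
      + (c * coeffBZero q s (signed N ε) l m) • ket N ε l m'
      + (c * coeffBMinus q s (signed N ε) l m) • ket N ε l₂ m' := by
  subst h₁ h₂ h₃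
  by_cases hv : Valid N l m
  · rw [h ε l m hv]
    module
  · simp [hc hv]

theorem ActsAsXOneStar.smul_ket (h : ActsAsXOneStar q s N S) (c : ℂ) (hc : ¬ Valid N l m → c = 0)
    {l₁ l₂ m' : ℝ} (h₁ : l₁ = l + 1) (h₂ : l₂ = l - 1) (h₃ : m' = m - 1) :
    c • S (ket N ε l m) = (c * coeffBMinus q s (signed N ε) l₁ m') • ket N ε l₁ m'
      + (c * coeffBZero q s (signed N ε) l m') • ket N ε l m'
      + (c * coeffBPlus q s (signed N ε) l₂ m') • ket N ε l₂ m' := by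
  subst h₁ h₂ h₃
  by_cases hv : Valid N l m
  · rw [h ε l m hv]
    module
  · simp [hc hv]

/-- Conversely, a coefficient identity is needed only when the target label is admissible, and this
admissibility can be used to prove it. -/
theorem smul_ket_eq_zero {c : ℝ} (h : Valid N l m → c = 0) : (c : ℂ) • ket N ε l m = 0 := by
  by_cases hv : Valid N l m
  · simp [h hv]
  · simp [ket_of_not_valid hv]

theorem comm_relation (hq : 0 < q) (hq1 : q < 1) (hN : ∃ k : ℤ, N = k / 2) (hN0 : N ≠ 0)
    (h₀ : ActsAsXZero q s N T₀) (h₁ : ActsAsXOne q s N T₁) :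
    T₀ * T₁ - ((q : ℂ) ^ 2) • (T₁ * T₀) = ((1 - (q : ℂ) ^ 2) * (1 - (s : ℂ) ^ 2)) • T₁ := by
  refine clm_ext_ket fun ε l m h => ?_
  change T₀ (T₁ _) - ((q : ℂ) ^ 2) • T₁ (T₀ _) = ((1 - (q : ℂ) ^ 2) * (1 - (s : ℂ) ^ 2)) • T₁ _
  obtain ⟨v1, v2, v3, v4⟩ := h.one_half_le hN hN0
  have hM := abs_signed N ε
  have ha := alphaCoeff_low (s := s) hq hq1 (hM ▸ v1) (hM ▸ v2)
  have ha' := alphaCoeff_high (s := s) hq hq1 (hM ▸ v1) (hM ▸ v2)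
  have l1 : 0 < l := by linarith
  have e1 := h₀.smul_ket (ε := ε) (l := l + 1) (m := m + 1) (coeffBPlus q s (signed N ε) l m : ℝ)
    (fun hv => (hv (h.up_up hN)).elim) (l₁ := l + 2) (l₂ := l) (by ring) (by ring)
  have e2 := h₀.smul_ket (ε := ε) (l := l) (m := m + 1) (coeffBZero q s (signed N ε) l m : ℝ)
    (fun hv => Complex.ofReal_eq_zero.2 (coeffBZero_eq_zero hN h hv)) (l₁ := l + 1) (l₂ := l - 1)
      (by ring) (by ring)
  have e3 := h₀.smul_ket (ε := ε) (l := l - 1) (m := m + 1) (coeffBMinus q s (signed N ε) l m : ℝ)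
    (fun hv => Complex.ofReal_eq_zero.2 (coeffBMinus_eq_zero hN hM h hv)) (l₁ := l) (l₂ := l - 2)
      (by ring) (by ring)
  have e4 := h₁.smul_ket (ε := ε) (l := l + 1) (m := m) (coeffAPlus q s (signed N ε) l m : ℝ)
    (fun hv => (hv (h.up hN)).elim) (l₁ := l + 2) (l₂ := l) (m' := m + 1) (by ring) (by ring)
      (by ring)
  have e5 := h₁.smul_ket (ε := ε) (l := l) (m := m) (coeffAZero q s (signed N ε) l m : ℝ)
    (fun hv => (hv h).elim) (l₁ := l + 1) (l₂ := l - 1) (m' := m + 1) (by ring) (by ring) (by ring)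
  have e6 := h₁.smul_ket (ε := ε) (l := l - 1) (m := m) (coeffAPlus q s (signed N ε) (l - 1) m : ℝ)
    (fun hv => Complex.ofReal_eq_zero.2 (coeffAPlus_pred_eq_zero hN hM h hv)) (l₁ := l)
      (l₂ := l - 2) (m' := m + 1) (by ring) (by ring) (by ring)
  rw [h₀ ε l m h, h₁ ε l m h]
  simp only [map_add, map_smul, e1, e2, e3, e4, e5, e6]
  have E1 : ((coeffBPlus q s (signed N ε) l m * coeffAPlus q s (signed N ε) (l + 1) (m + 1) -
    q ^ 2 * (coeffAPlus q s (signed N ε) l m * coeffBPlus q s (signed N ε) (l + 1) m) : ℝ)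
    : ℂ) • ket N ε (l + 2) (m + 1) = 0 :=
    smul_ket_eq_zero fun hv => by
      linear_combination comm_coeff_up_two (s := s) (M := signed N ε) hq hq1 v4
  have E2 : ((coeffBPlus q s (signed N ε) l m * coeffAZero q s (signed N ε) (l + 1) (m + 1) +
    coeffBZero q s (signed N ε) l m * coeffAPlus q s (signed N ε) l (m + 1) - q ^ 2 *
    (coeffAPlus q s (signed N ε) l m * coeffBZero q s (signed N ε) (l + 1) m +
    coeffAZero q s (signed N ε) l m * coeffBPlus q s (signed N ε) l m) - (1 - q ^ 2) *
    (1 - s ^ 2) * coeffBPlus q s (signed N ε) l m : ℝ) : ℂ) • ket N ε (l + 1) (m + 1) = 0 :=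
    smul_ket_eq_zero fun hv => by
      linear_combination comm_coeff_up_one (s := s) (M := signed N ε) hq hq1 l1 v3 v4
  have E3 : ((coeffBPlus q s (signed N ε) l m * coeffAPlus q s (signed N ε) l (m + 1) +
    coeffBZero q s (signed N ε) l m * coeffAZero q s (signed N ε) l (m + 1) +
    coeffBMinus q s (signed N ε) l m * coeffAPlus q s (signed N ε) (l - 1) (m + 1) - q ^ 2 *
    (coeffAPlus q s (signed N ε) l m * coeffBMinus q s (signed N ε) (l + 1) m +
    coeffAZero q s (signed N ε) l m * coeffBZero q s (signed N ε) l m +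
    coeffAPlus q s (signed N ε) (l - 1) m * coeffBPlus q s (signed N ε) (l - 1) m) -
    (1 - q ^ 2) * (1 - s ^ 2) * coeffBZero q s (signed N ε) l m : ℝ)
    : ℂ) • ket N ε l (m + 1) = 0 :=
    smul_ket_eq_zero fun hv => by
      linear_combination comm_coeff_zero (s := s) (M := signed N ε) hq hq1 l1 v3 v4 ha ha'
        (sqrt_mul_sqrt_pred hq hq1 ((valid_iff hN).1 h).2.1)
  have E4 : ((coeffBZero q s (signed N ε) l m * coeffAPlus q s (signed N ε) (l - 1) (m + 1) +
    coeffBMinus q s (signed N ε) l m * coeffAZero q s (signed N ε) (l - 1) (m + 1) - q ^ 2 *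
    (coeffAZero q s (signed N ε) l m * coeffBMinus q s (signed N ε) l m +
    coeffAPlus q s (signed N ε) (l - 1) m * coeffBZero q s (signed N ε) (l - 1) m) -
    (1 - q ^ 2) * (1 - s ^ 2) * coeffBMinus q s (signed N ε) l m : ℝ) : ℂ) • ket N ε (l - 1)
    (m + 1) = 0 :=
    smul_ket_eq_zero fun hv => by
      -- Admissibility of the target gives l − 1 ≥ 1/2, hence the bound 1 < l that the coefficient
      -- identity asks for.
      obtain ⟨w1, w2, w3, w4⟩ := hv.one_half_le hN hN0
      linear_combination comm_coeff_down_one (s := s) (M := signed N ε) hq hq1 (by linarith) v3 v4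
  have E5 : ((coeffBMinus q s (signed N ε) l m * coeffAPlus q s (signed N ε) (l - 2) (m + 1) -
    q ^ 2 * (coeffAPlus q s (signed N ε) (l - 1) m * coeffBMinus q s (signed N ε) (l - 1) m) : ℝ)
    : ℂ) • ket N ε (l - 2) (m + 1) = 0 :=
    smul_ket_eq_zero fun hv => by
      obtain ⟨w1, w2, w3, w4⟩ := hv.one_half_le hN hN0
      linear_combination comm_coeff_down_two (s := s) (M := signed N ε) hq hq1 (by linarith) v4
  push_cast at E1 E2 E3 E4 E5
  linear_combination (norm := module) E1 + E2 + E3 + E4 + E5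

theorem starMul_relation (hq : 0 < q) (hq1 : q < 1) (hN : ∃ k : ℤ, N = k / 2) (hN0 : N ≠ 0)
    (h₀ : ActsAsXZero q s N T₀) (h₁ : ActsAsXOne q s N T₁) (hS : ActsAsXOneStar q s N S) :
    (((q * qNum q 2 : ℝ)) : ℂ) • (S * T₁) + ((q ^ 4 : ℝ) : ℂ) • (T₀ * T₀)
      + (((q ^ 2 * (q * qNum q 2) - 2 * q ^ 4) * (1 - s ^ 2) : ℝ) : ℂ) • T₀ +
        (((q ^ 2 * (1 - s ^ 2) + q * qNum q 2 * s ^ 2) * (q ^ 2 * (1 - s ^ 2) - q * qNum q 2) : ℝ)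
        : ℂ) • 1 = 0 := by
  refine clm_ext_ket fun ε l m h => ?_
  change (((q * qNum q 2 : ℝ)) : ℂ) • S (T₁ (ket N ε l m)) +
    ((q ^ 4 : ℝ) : ℂ) • T₀ (T₀ (ket N ε l m))
      + (((q ^ 2 * (q * qNum q 2) - 2 * q ^ 4) * (1 - s ^ 2) : ℝ) : ℂ) • T₀ (ket N ε l m) +
        (((q ^ 2 * (1 - s ^ 2) + q * qNum q 2 * s ^ 2) * (q ^ 2 * (1 - s ^ 2) - q * qNum q 2) : ℝ)
        : ℂ) • ket N ε l m = 0
  obtain ⟨v1, v2, v3, v4⟩ := h.one_half_le hN hN0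
  have hM := abs_signed N ε
  have ha := alphaCoeff_low (s := s) hq hq1 (hM ▸ v1) (hM ▸ v2)
  have ha' := alphaCoeff_high (s := s) hq hq1 (hM ▸ v1) (hM ▸ v2)
  have l1 : 0 < l := by linarith
  have e1 := hS.smul_ket (ε := ε) (l := l + 1) (m := m + 1) (coeffBPlus q s (signed N ε) l m : ℝ)
    (fun hv => (hv (h.up_up hN)).elim) (l₁ := l + 2) (l₂ := l) (m' := m) (by ring) (by ring)
      (by ring)
  have e2 := hS.smul_ket (ε := ε) (l := l) (m := m + 1) (coeffBZero q s (signed N ε) l m : ℝ)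
    (fun hv => Complex.ofReal_eq_zero.2 (coeffBZero_eq_zero hN h hv)) (l₁ := l + 1) (l₂ := l - 1)
      (m' := m) (by ring) (by ring) (by ring)
  have e3 := hS.smul_ket (ε := ε) (l := l - 1) (m := m + 1) (coeffBMinus q s (signed N ε) l m : ℝ)
    (fun hv => Complex.ofReal_eq_zero.2 (coeffBMinus_eq_zero hN hM h hv)) (l₁ := l) (l₂ := l - 2)
      (m' := m) (by ring) (by ring) (by ring)
  have e4 := h₀.smul_ket (ε := ε) (l := l + 1) (m := m) (coeffAPlus q s (signed N ε) l m : ℝ)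
    (fun hv => (hv (h.up hN)).elim) (l₁ := l + 2) (l₂ := l) (by ring) (by ring)
  have e5 := h₀.smul_ket (ε := ε) (l := l) (m := m) (coeffAZero q s (signed N ε) l m : ℝ)
    (fun hv => (hv h).elim) (l₁ := l + 1) (l₂ := l - 1) (by ring) (by ring)
  have e6 := h₀.smul_ket (ε := ε) (l := l - 1) (m := m) (coeffAPlus q s (signed N ε) (l - 1) m : ℝ)
    (fun hv => Complex.ofReal_eq_zero.2 (coeffAPlus_pred_eq_zero hN hM h hv)) (l₁ := l)
      (l₂ := l - 2) (by ring) (by ring)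
  rw [h₀ ε l m h, h₁ ε l m h]
  simp only [map_add, map_smul, e1, e2, e3, e4, e5, e6]
  have E1 : ((q * qNum q 2 * (coeffBPlus q s (signed N ε) l m * coeffBMinus q s (signed N ε)
    (l + 2) m) + q ^ 4 * (coeffAPlus q s (signed N ε) l m * coeffAPlus q s (signed N ε) (l + 1) m)
    : ℝ) : ℂ) • ket N ε (l + 2) m = 0 :=
    smul_ket_eq_zero fun hv => by
      linear_combination starMul_coeff_up_two (s := s) (M := signed N ε) hq hq1 v3 v4
  have E2 : ((q * qNum q 2 * (coeffBPlus q s (signed N ε) l m * coeffBZero q s (signed N ε)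
    (l + 1) m + coeffBZero q s (signed N ε) l m * coeffBMinus q s (signed N ε) (l + 1) m) + q ^ 4 *
    (coeffAPlus q s (signed N ε) l m * coeffAZero q s (signed N ε) (l + 1) m +
    coeffAZero q s (signed N ε) l m * coeffAPlus q s (signed N ε) l m) +
    (q ^ 2 * (q * qNum q 2) - 2 * q ^ 4) * (1 - s ^ 2) * coeffAPlus q s (signed N ε) l m : ℝ)
    : ℂ) • ket N ε (l + 1) m = 0 :=
    smul_ket_eq_zero fun hv => by
      linear_combination starMul_coeff_up_one (s := s) (M := signed N ε) hq hq1 l1 v3 v4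
  have E3 : ((q * qNum q 2 * (coeffBPlus q s (signed N ε) l m * coeffBPlus q s (signed N ε) l m +
    coeffBZero q s (signed N ε) l m * coeffBZero q s (signed N ε) l m +
    coeffBMinus q s (signed N ε) l m * coeffBMinus q s (signed N ε) l m) + q ^ 4 *
    (coeffAPlus q s (signed N ε) l m * coeffAPlus q s (signed N ε) l m +
    coeffAZero q s (signed N ε) l m * coeffAZero q s (signed N ε) l m +
    coeffAPlus q s (signed N ε) (l - 1) m * coeffAPlus q s (signed N ε) (l - 1) m) +
    (q ^ 2 * (q * qNum q 2) - 2 * q ^ 4) * (1 - s ^ 2) *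
    coeffAZero q s (signed N ε) l m + (q ^ 2 * (1 - s ^ 2) + q * qNum q 2 * s ^ 2) *
    (q ^ 2 * (1 - s ^ 2) - q * qNum q 2) : ℝ) : ℂ) • ket N ε l m = 0 :=
    smul_ket_eq_zero fun hv => by
      linear_combination starMul_coeff_zero (s := s) (M := signed N ε) hq hq1 l1 v3 v4 ha ha'
        (sqrt_mul_sqrt_pred hq hq1 ((valid_iff hN).1 h).2.1)
  have E4 : ((q * qNum q 2 * (coeffBZero q s (signed N ε) l m * coeffBPlus q s (signed N ε)
    (l - 1) m + coeffBMinus q s (signed N ε) l m * coeffBZero q s (signed N ε) (l - 1) m) + q ^ 4 *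
    (coeffAZero q s (signed N ε) l m * coeffAPlus q s (signed N ε) (l - 1) m +
    coeffAPlus q s (signed N ε) (l - 1) m * coeffAZero q s (signed N ε) (l - 1) m) +
    (q ^ 2 * (q * qNum q 2) - 2 * q ^ 4) * (1 - s ^ 2) * coeffAPlus q s (signed N ε)
    (l - 1) m : ℝ) : ℂ) • ket N ε (l - 1) m = 0 :=
    smul_ket_eq_zero fun hv => by
      obtain ⟨w1, w2, w3, w4⟩ := hv.one_half_le hN hN0
      -- By symmetry the entry from l to l − 1 is the entry from l − 1 to l.
      have hl := starMul_coeff_up_one (s := s) (M := signed N ε) hq hq1 (show 0 < l -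
        1 by linarith) w3 w4
      rw [sub_add_cancel] at hl
      linear_combination hl
  have E5 : ((q * qNum q 2 * (coeffBMinus q s (signed N ε) l m * coeffBPlus q s (signed N ε)
    (l - 2) m) + q ^ 4 * (coeffAPlus q s (signed N ε) (l - 1) m * coeffAPlus q s (signed N ε)
    (l - 2) m) : ℝ) : ℂ) • ket N ε (l - 2) m = 0 :=
    smul_ket_eq_zero fun hv => by
      obtain ⟨w1, w2, w3, w4⟩ := hv.one_half_le hN hN0
      have hl := starMul_coeff_up_two (s := s) (M := signed N ε) hq hq1 w3 w4
      rw [sub_add_cancel, show l - 2 + 1 = l - 1 by ring] at hl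
      linear_combination hl
  push_cast at E1 E2 E3 E4 E5 ⊢
  linear_combination (norm := module) E1 + E2 + E3 + E4 + E5

theorem mulStar_relation (hq : 0 < q) (hq1 : q < 1) (hN : ∃ k : ℤ, N = k / 2) (hN0 : N ≠ 0)
    (h₀ : ActsAsXZero q s N T₀) (h₁ : ActsAsXOne q s N T₁) (hS : ActsAsXOneStar q s N S) :
    (((q * qNum q 2 : ℝ)) : ℂ) • (T₁ * S) + ((1 : ℝ) : ℂ) • (T₀ * T₀)
      + (((q * qNum q 2 - 2) * (1 - s ^ 2) : ℝ) : ℂ) • T₀ + (((1 - s ^ 2 + q * qNum q 2 * s ^ 2) *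
        (1 - s ^ 2 - q * qNum q 2) : ℝ) : ℂ) • 1 = 0 := by
  refine clm_ext_ket fun ε l m h => ?_
  change (((q * qNum q 2 : ℝ)) : ℂ) • T₁ (S (ket N ε l m)) + ((1 : ℝ) : ℂ) • T₀ (T₀ (ket N ε l m))
      + (((q * qNum q 2 - 2) * (1 - s ^ 2) : ℝ) : ℂ) • T₀ (ket N ε l m) +
        (((1 - s ^ 2 + q * qNum q 2 * s ^ 2) * (1 - s ^ 2 - q * qNum q 2) : ℝ) : ℂ) • ket N ε l m =
        0
  obtain ⟨v1, v2, v3, v4⟩ := h.one_half_le hN hN0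
  have hM := abs_signed N ε
  have ha := alphaCoeff_low (s := s) hq hq1 (hM ▸ v1) (hM ▸ v2)
  have ha' := alphaCoeff_high (s := s) hq hq1 (hM ▸ v1) (hM ▸ v2)
  have l1 : 0 < l := by linarith
  have e1 := h₁.smul_ket (ε := ε) (l := l + 1) (m := m - 1) (coeffBMinus q s (signed N ε) (l + 1)
    (m - 1) : ℝ)
    (fun hv => (hv (h.up_down hN)).elim) (l₁ := l + 2) (l₂ := l) (m' := m) (by ring) (by ring)
      (by ring)
  have e2 := h₁.smul_ket (ε := ε) (l := l) (m := m - 1) (coeffBZero q s (signed N ε) l (m - 1) : ℝ)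
    (fun hv => Complex.ofReal_eq_zero.2 (coeffBZero_pred_eq_zero hN h hv)) (l₁ := l + 1)
      (l₂ := l - 1) (m' := m) (by ring) (by ring) (by ring)
  have e3 := h₁.smul_ket (ε := ε) (l := l - 1) (m := m - 1) (coeffBPlus q s (signed N ε) (l - 1)
    (m - 1) : ℝ)
    (fun hv => Complex.ofReal_eq_zero.2 (coeffBPlus_pred_eq_zero hN hM h hv)) (l₁ := l)
      (l₂ := l - 2) (m' := m) (by ring) (by ring) (by ring)
  have e4 := h₀.smul_ket (ε := ε) (l := l + 1) (m := m) (coeffAPlus q s (signed N ε) l m : ℝ)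
    (fun hv => (hv (h.up hN)).elim) (l₁ := l + 2) (l₂ := l) (by ring) (by ring)
  have e5 := h₀.smul_ket (ε := ε) (l := l) (m := m) (coeffAZero q s (signed N ε) l m : ℝ)
    (fun hv => (hv h).elim) (l₁ := l + 1) (l₂ := l - 1) (by ring) (by ring)
  have e6 := h₀.smul_ket (ε := ε) (l := l - 1) (m := m) (coeffAPlus q s (signed N ε) (l - 1) m : ℝ)
    (fun hv => Complex.ofReal_eq_zero.2 (coeffAPlus_pred_eq_zero hN hM h hv)) (l₁ := l)
      (l₂ := l - 2) (by ring) (by ring)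
  rw [h₀ ε l m h, hS ε l m h]
  simp only [map_add, map_smul, e1, e2, e3, e4, e5, e6]
  have E1 : ((q * qNum q 2 * (coeffBMinus q s (signed N ε) (l + 1) (m - 1) *
    coeffBPlus q s (signed N ε) (l + 1) (m - 1)) + 1 * (coeffAPlus q s (signed N ε) l m *
    coeffAPlus q s (signed N ε) (l + 1) m) : ℝ) : ℂ) • ket N ε (l + 2) m = 0 :=
    smul_ket_eq_zero fun hv => by
      linear_combination mulStar_coeff_up_two (s := s) (M := signed N ε) hq hq1 v3 v4
  have E2 : ((q * qNum q 2 * (coeffBMinus q s (signed N ε) (l + 1) (m - 1) *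
    coeffBZero q s (signed N ε) (l + 1) (m - 1) + coeffBZero q s (signed N ε) l (m - 1) *
    coeffBPlus q s (signed N ε) l (m - 1)) + 1 * (coeffAPlus q s (signed N ε) l m *
    coeffAZero q s (signed N ε) (l + 1) m + coeffAZero q s (signed N ε) l m *
    coeffAPlus q s (signed N ε) l m) + (q * qNum q 2 - 2) * (1 - s ^ 2) *
    coeffAPlus q s (signed N ε) l m : ℝ) : ℂ) • ket N ε (l + 1) m = 0 :=
    smul_ket_eq_zero fun hv => by
      linear_combination mulStar_coeff_up_one (s := s) (M := signed N ε) hq hq1 l1 v3 v4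
  have E3 : ((q * qNum q 2 * (coeffBMinus q s (signed N ε) (l + 1) (m - 1) *
    coeffBMinus q s (signed N ε) (l + 1) (m - 1) + coeffBZero q s (signed N ε) l (m - 1) *
    coeffBZero q s (signed N ε) l (m - 1) + coeffBPlus q s (signed N ε) (l - 1) (m - 1) *
    coeffBPlus q s (signed N ε) (l - 1) (m - 1)) + 1 * (coeffAPlus q s (signed N ε) l m *
    coeffAPlus q s (signed N ε) l m + coeffAZero q s (signed N ε) l m *
    coeffAZero q s (signed N ε) l m + coeffAPlus q s (signed N ε) (l - 1) m *
    coeffAPlus q s (signed N ε) (l - 1) m) + (q * qNum q 2 - 2) * (1 - s ^ 2) *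
    coeffAZero q s (signed N ε) l m + (1 - s ^ 2 + q * qNum q 2 * s ^ 2) *
    (1 - s ^ 2 - q * qNum q 2) : ℝ) : ℂ) • ket N ε l m = 0 :=
    smul_ket_eq_zero fun hv => by
      linear_combination mulStar_coeff_zero (s := s) (M := signed N ε) hq hq1 l1 v3 v4 ha ha'
        (sqrt_mul_sqrt_pred hq hq1 ((valid_iff hN).1 h).2.2)
  have E4 : ((q * qNum q 2 * (coeffBZero q s (signed N ε) l (m - 1) *
    coeffBMinus q s (signed N ε) l (m - 1) + coeffBPlus q s (signed N ε) (l - 1) (m - 1) *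
    coeffBZero q s (signed N ε) (l - 1) (m - 1)) + 1 * (coeffAZero q s (signed N ε) l m *
    coeffAPlus q s (signed N ε) (l - 1) m + coeffAPlus q s (signed N ε) (l - 1) m *
    coeffAZero q s (signed N ε) (l - 1) m) + (q * qNum q 2 - 2) * (1 - s ^ 2) *
    coeffAPlus q s (signed N ε) (l - 1) m : ℝ) : ℂ) • ket N ε (l - 1) m = 0 :=
    smul_ket_eq_zero fun hv => by
      obtain ⟨w1, w2, w3, w4⟩ := hv.one_half_le hN hN0
      have hl := mulStar_coeff_up_one (s := s) (M := signed N ε) hq hq1 (show 0 < l -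
        1 by linarith) w3 w4
      rw [sub_add_cancel] at hl
      linear_combination hl
  have E5 : ((q * qNum q 2 * (coeffBPlus q s (signed N ε) (l - 1) (m - 1) *
    coeffBMinus q s (signed N ε) (l - 1) (m - 1)) + 1 * (coeffAPlus q s (signed N ε) (l - 1) m *
    coeffAPlus q s (signed N ε) (l - 2) m) : ℝ) : ℂ) • ket N ε (l - 2) m = 0 :=
    smul_ket_eq_zero fun hv => by
      obtain ⟨w1, w2, w3, w4⟩ := hv.one_half_le hN hN0
      have hl := mulStar_coeff_up_two (s := s) (M := signed N ε) hq hq1 w3 w4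
      rw [show l - 2 + 1 = l - 1 by ring] at hl
      linear_combination hl
  push_cast at E1 E2 E3 E4 E5 ⊢
  linear_combination (norm := module) E1 + E2 + E3 + E4 + E5

end Actions

end

/-! ### Existence and uniqueness of the representation. -/

section
variable {N : ℝ}

theorem induction_on_sphere {q s : ℝ} {p : Sphere q s → Prop}
    (algebraMap : ∀ c : ℂ, p (algebraMap ℂ _ c)) (hA : p (A q s)) (hB : p (B q s))
    (hBs : p (star (B q s))) (mul : ∀ a b, p a → p b → p (a * b))
    (add : ∀ a b, p a → p b → p (a + b)) (a : Sphere q s) : p a := by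
  obtain ⟨x, rfl⟩ := mk_surjective q s a
  induction x using FreeAlgebra.induction with
  | grade0 c => rw [AlgHom.commutes]; exact algebraMap c
  | grade1 g =>
    cases g
    · exact hA
    · exact hB
    · have := star_mk_gen q s .B
      rw [← B] at this
      rw [this] at hBs
      exact hBs
  | mul x y hx hy => rw [map_mul]; exact mul _ _ hx hy
  | add x y hx hy => rw [map_add]; exact add _ _ hx hy

theorem starAlgHom_ext {q s : ℝ} {R : Type} [Ring R] [Algebra ℂ R] [StarRing R]
    {π π' : Sphere q s →⋆ₐ[ℂ] R} (hA : π (A q s) = π' (A q s)) (hB : π (B q s) = π' (B q s)) :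
    π = π' := by
  ext a
  induction a using induction_on_sphere with
  | algebraMap c => rw [AlgHomClass.commutes, AlgHomClass.commutes]
  | hA => exact hA
  | hB => exact hB
  | hBs => rw [map_star, map_star, hB]
  | mul a b ha hb => rw [map_mul, map_mul, ha, hb]
  | add a b ha hb => rw [map_add, map_add, ha, hb]

theorem q_mul_qNum_two_pos {q : ℝ} (hq : 0 < q) (hq1 : q < 1) : 0 < q * qNum q 2 :=
  mul_pos hq (qNum_pos hq hq1 two_pos)

theorem A_eq {q : ℝ} (s : ℝ) (hq : 0 < q) (hq1 : q < 1) : A q s =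
    ((q * qNum q 2 : ℝ) : ℂ)⁻¹ • (algebraMap ℂ _ (1 - (s : ℂ) ^ 2) - xZero q s) := by
  have hc : ((q * qNum q 2 : ℝ) : ℂ) ≠ 0 :=
    Complex.ofReal_ne_zero.2 (q_mul_qNum_two_pos hq hq1).ne'
  rw [xZero, sub_sub_cancel, inv_smul_smul₀ hc]

theorem B_eq {q : ℝ} (s : ℝ) (hq : 0 < q) (hq1 : q < 1) : B q s =
    ((√(q * qNum q 2) : ℝ) : ℂ)⁻¹ • xOne q s := by
  have hc : ((√(q * qNum q 2) : ℝ) : ℂ) ≠ 0 :=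
    Complex.ofReal_ne_zero.2 (Real.sqrt_pos.2 (q_mul_qNum_two_pos hq hq1)).ne'
  rw [xOne, inv_smul_smul₀ hc]

theorem IsEquivariantRep.unique {q s : ℝ} (hq : 0 < q) (hq1 : q < 1)
    {π π' : Sphere q s →⋆ₐ[ℂ] (Spinors N →L[ℂ] Spinors N)} (h : IsEquivariantRep q s N π)
    (h' : IsEquivariantRep q s N π') : π = π' := by
  have h0 : π (xZero q s) = π' (xZero q s) :=
    clm_ext_ket fun ε l m hv => by rw [h.x_zero ε l m hv, h'.x_zero ε l m hv]
  have h1 : π (xOne q s) = π' (xOne q s) :=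
    clm_ext_ket fun ε l m hv => by rw [h.x_one ε l m hv, h'.x_one ε l m hv]
  refine starAlgHom_ext ?_ ?_
  · simp only [A_eq s hq hq1, map_smul, map_sub, h0, AlgHomClass.commutes]
  · rw [B_eq s hq hq1, map_smul, map_smul, h1]

/-- The images of the generators determined by the images of `A` and `B`. -/
noncomputable def genImage (a b : Spinors N →L[ℂ] Spinors N) :
    Gen → (Spinors N →L[ℂ] Spinors N)
  | .A => a
  | .B => b
  | .Bstar => star b

/-- The `*`-representation with prescribed images of `A` and `B`. -/
noncomputable def repOfGenerators {q s : ℝ} (a b : Spinors N →L[ℂ] Spinors N) (ha : star a = a)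
    (hrel : ∀ x y, Rel q s x y →
      FreeAlgebra.lift ℂ (genImage a b) x = FreeAlgebra.lift ℂ (genImage a b) y) :
    Sphere q s →⋆ₐ[ℂ] (Spinors N →L[ℂ] Spinors N) :=
  { RingQuot.liftAlgHom ℂ ⟨FreeAlgebra.lift ℂ (genImage a b), fun {x y} h => hrel x y h⟩ with
    map_star' := fun x => by
      change RingQuot.liftAlgHom ℂ ⟨FreeAlgebra.lift ℂ (genImage a b), _⟩ _
        = star (RingQuot.liftAlgHom ℂ ⟨FreeAlgebra.lift ℂ (genImage a b), _⟩ x)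
      have key : ∀ y : Free, RingQuot.liftAlgHom ℂ (s := Rel q s)
          ⟨FreeAlgebra.lift ℂ (genImage a b), fun {x y} h => hrel x y h⟩ (mk q s y)
          = FreeAlgebra.lift ℂ (genImage a b) y := fun y =>
        RingQuot.liftAlgHom_mkAlgHom_apply ℂ _ (fun {x y} h => hrel x y h) y
      obtain ⟨y, rfl⟩ := mk_surjective q s x
      induction y using FreeAlgebra.induction with
      | grade0 c =>
        rw [AlgHom.commutes, ← algebraMap_star_comm]
        erw [AlgHom.commutes, AlgHom.commutes]
        rw [← algebraMap_star_comm]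
      | grade1 g =>
        rw [star_mk_gen, key, key, FreeAlgebra.lift_ι_apply, FreeAlgebra.lift_ι_apply]
        cases g <;> simp [genImage, Gen.conj, ha]
      | mul x y hx hy =>
        rw [map_mul, star_mul]
        erw [map_mul, map_mul, hx, hy]
        rw [star_mul]
      | add x y hx hy =>
        rw [map_add, star_add]
        erw [map_add, map_add, hx, hy]
        rw [star_add] }

theorem repOfGenerators_mk {q s : ℝ} (a b : Spinors N →L[ℂ] Spinors N) (ha : star a = a)
    (hrel : ∀ x y, Rel q s x y →
      FreeAlgebra.lift ℂ (genImage a b) x = FreeAlgebra.lift ℂ (genImage a b) y) (g : Gen) :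
    repOfGenerators a b ha hrel (mk q s (gen g)) = genImage a b g := by
  refine (RingQuot.liftAlgHom_mkAlgHom_apply ℂ _ (fun {x y} h => hrel x y h) _).trans ?_
  rw [FreeAlgebra.lift_ι_apply]

/-- The operators for A and B are obtained from those for x₀ and x₁ by inverting the affine change
of generators; the relations then follow from the three operator identities by rescaling. -/
theorem exists_isEquivariantRep {q : ℝ} (s : ℝ) (hq : 0 < q) (hq1 : q < 1)
    (hN : ∃ k : ℤ, N = k / 2) (hN0 : N ≠ 0) :
    ∃ π : Sphere q s →⋆ₐ[ℂ] (Spinors N →L[ℂ] Spinors N), IsEquivariantRep q s N π := by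
  obtain ⟨T₀, T₁, hT, h₀, h₁, hS⟩ := exists_actsAs s hq hq1 hN hN0
  have r1 := comm_relation hq hq1 hN hN0 h₀ h₁
  have r2 := starMul_relation hq hq1 hN hN0 h₀ h₁ hS
  have r3 := mulStar_relation hq hq1 hN hN0 h₀ h₁ hS
  have hc0 := q_mul_qNum_two_pos hq hq1
  have hr : ((√(q * qNum q 2) : ℝ) : ℂ) * ((√(q * qNum q 2) : ℝ) : ℂ) = ((q * qNum q 2 : ℝ) : ℂ) :=
    by
    rw [← Complex.ofReal_mul, Real.mul_self_sqrt hc0.le]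
  have hr0 : ((√(q * qNum q 2) : ℝ) : ℂ) ≠ 0 := Complex.ofReal_ne_zero.2 (Real.sqrt_pos.2 hc0).ne'
  have hc0' : ((q * qNum q 2 : ℝ) : ℂ) ≠ 0 := Complex.ofReal_ne_zero.2 hc0.ne'
  have hrs : star (((√(q * qNum q 2) : ℝ) : ℂ)⁻¹) = ((√(q * qNum q 2) : ℝ) : ℂ)⁻¹ := by
    rw [← Complex.ofReal_inv]; exact Complex.conj_ofReal _
  have hcs : star (((q * qNum q 2 : ℝ) : ℂ)⁻¹) = ((q * qNum q 2 : ℝ) : ℂ)⁻¹ := by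
    rw [← Complex.ofReal_inv]; exact Complex.conj_ofReal _
  have hds : star (1 - (s : ℂ) ^ 2) = 1 - (s : ℂ) ^ 2 := by
    simp
  have hrr : ((√(q * qNum q 2) : ℝ) : ℂ)⁻¹ * ((√(q * qNum q 2) : ℝ) : ℂ)⁻¹
      = ((q * qNum q 2 : ℝ) : ℂ)⁻¹ := by rw [← mul_inv, hr]
  push_cast at r2 r3
  rw [Complex.ofReal_mul] at hc0' hrr
  obtain ⟨c, hc⟩ : ∃ c : ℂ, c = ((q * qNum q 2 : ℝ) : ℂ) := ⟨_, rfl⟩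
  rw [Complex.ofReal_mul] at hc
  rw [← hc] at r2 r3 hc0' hrr
  obtain ⟨a, ha⟩ : ∃ a : Spinors N →L[ℂ] Spinors N, a = c⁻¹ • ((1 - (s : ℂ) ^ 2) • 1 - T₀) := ⟨_,
    rfl⟩
  obtain ⟨b, hb⟩ : ∃ b : Spinors N →L[ℂ] Spinors N, b = ((√(q * qNum q 2) : ℝ) : ℂ)⁻¹ • T₁ :=
    ⟨_, rfl⟩
  have hbs : star b = ((√(q * qNum q 2) : ℝ) : ℂ)⁻¹ • star T₁ := by rw [hb, star_smul, hrs]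
  have has : star a = a := by
    rw [Complex.ofReal_mul, ← hc] at hcs
    rw [ha, star_smul, star_sub, star_smul, star_one, hT, hcs, hds]
  have s1 : a * b = ((q : ℂ) ^ 2) • (b * a) := by
    rw [ha, hb]
    simp only [smul_mul_assoc, mul_smul_comm, sub_mul, mul_sub, one_mul, mul_one, smul_smul,
      smul_sub]
    linear_combination (norm := module) (-c⁻¹ * ((√(q * qNum q 2) : ℝ) : ℂ)⁻¹) • r1
  have hrel : ∀ x y, Rel q s x y →
      FreeAlgebra.lift ℂ (genImage a b) x = FreeAlgebra.lift ℂ (genImage a b) y := by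
    intro x y h
    cases h <;>
      simp only [map_mul, map_add, map_sub, map_smul, map_one, map_zero, genImage,
        FreeAlgebra.lift_ι_apply, Algebra.algebraMap_eq_smul_one]
    · exact s1
    -- The fourth relation is the adjoint of the first, since a is self-adjoint and q is real.
    · have := congrArg star s1
      rwa [star_mul, star_smul, star_mul, has, star_pow, Complex.star_def,
        Complex.conj_ofReal] at this
    · rw [hbs, ha, hb]
      simp only [smul_mul_assoc, mul_smul_comm, sub_mul, mul_sub, add_mul, one_mul, mul_one,
        smul_smul, smul_sub, hrr]
      -- The identity in x₀ and x₁ is (q[2])² times the original relation.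
      linear_combination (norm := skip) (c⁻¹ ^ 2) • r3
      match_scalars <;> field_simp <;> ring
    · rw [hbs, ha, hb]
      simp only [smul_mul_assoc, mul_smul_comm, sub_mul, mul_sub, add_mul, one_mul, mul_one,
        smul_smul, smul_sub, hrr]
      linear_combination (norm := skip) (c⁻¹ ^ 2) • r2
      match_scalars <;> field_simp <;> ring
  have e0 : repOfGenerators a b has hrel (xZero q s) = T₀ := by
    have := repOfGenerators_mk a b has hrel .A
    rw [← A] at this
    rw [xZero, map_sub, map_smul, this, AlgHomClass.commutes, genImage, ha, Complex.ofReal_mul,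
      ← hc,
      smul_inv_smul₀ hc0', Algebra.algebraMap_eq_smul_one, sub_sub_cancel]
  have e1 : repOfGenerators a b has hrel (xOne q s) = T₁ := by
    have := repOfGenerators_mk a b has hrel .B
    rw [← B] at this
    rw [xOne, map_smul, this, genImage, hb, smul_inv_smul₀ hr0]
  exact ⟨repOfGenerators a b has hrel, fun ε l m h => by rw [e0, h₀ ε l m h],
    fun ε l m h => by rw [e1, h₁ ε l m h]⟩

end

/-! ### Dirichlet series with asymptotically affine coefficients, and their residues. -/

theorem summable_succ_pow_mul_geometric (k : ℕ) {r : ℝ} (hr : 0 < r) (hr1 : r < 1) :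
    Summable fun n : ℕ => ((n : ℝ) + 1) ^ k * r ^ n := by
  have h := summable_pow_mul_geometric_of_norm_lt_one k
    (show ‖r‖ < 1 by rwa [Real.norm_of_nonneg hr.le])
  have h2 := ((summable_nat_add_iff 1).2 h).mul_left r⁻¹
  refine h2.congr fun n => ?_
  push_cast
  rw [pow_succ]
  field_simp

theorem norm_natCast_succ_cpow (n : ℕ) (z : ℂ) :
    ‖((n : ℂ) + 1) ^ (-z)‖ = ((n : ℝ) + 1) ^ (-z.re) := by
  have := Complex.norm_cpow_eq_rpow_re_of_pos (show (0 : ℝ) < n + 1 by positivity) (-z)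
  push_cast at this
  simpa using this

section DirichletSeries
variable {g : ℕ → ℂ} {C r : ℝ}

theorem summable_dirichlet_bound (k : ℕ) (hr : 0 < r) (hr1 : r < 1) :
    Summable fun n : ℕ => ((n : ℝ) + 1) ^ k * (C * r ^ n) :=
  ((summable_succ_pow_mul_geometric k hr hr1).mul_left C).congr fun n => by ring

/-- On the disc |z| ≤ k the factor (n + 1)^(−z) grows at most like (n + 1)ᵏ, even for Re z < 0, and
the geometric factor wins. This is the majorant for uniform convergence on discs. -/
theorem norm_dirichlet_term_le (hg : ∀ n, ‖g n‖ ≤ C * r ^ n) {k : ℕ} {z : ℂ} (hz : ‖z‖ ≤ k) (n : ℕ)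
    :
    ‖((n : ℂ) + 1) ^ (-z) * g n‖ ≤ ((n : ℝ) + 1) ^ k * (C * r ^ n) := by
  rw [norm_mul, norm_natCast_succ_cpow, ← Real.rpow_natCast]
  have h1 : (1 : ℝ) ≤ n + 1 := by simp
  have h2 : -z.re ≤ k := (neg_le_abs z.re).trans ((Complex.abs_re_le_norm z).trans hz)
  gcongr
  exact hg n

theorem summable_dirichlet (hr : 0 < r) (hr1 : r < 1) (hg : ∀ n, ‖g n‖ ≤ C * r ^ n) (z : ℂ) :
    Summable fun n : ℕ => ((n : ℂ) + 1) ^ (-z) * g n := by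
  obtain ⟨k, hk⟩ := exists_nat_ge ‖z‖
  exact .of_norm_bounded (summable_dirichlet_bound k hr hr1) (norm_dirichlet_term_le hg hk)

/-- A Dirichlet series with exponentially decaying coefficients is entire. -/
theorem differentiable_dirichlet (hr : 0 < r) (hr1 : r < 1) (hg : ∀ n, ‖g n‖ ≤ C * r ^ n) :
    Differentiable ℂ fun z : ℂ => ∑' n : ℕ, ((n : ℂ) + 1) ^ (-z) * g n := by
  intro z
  obtain ⟨k, hk⟩ := exists_nat_gt ‖z‖
  have h := Complex.differentiableOn_tsum_of_summable_norm (U := Metric.ball (0 : ℂ) k)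
    (summable_dirichlet_bound (C := C) k hr hr1)
    (F := fun (n : ℕ) (z : ℂ) => ((n : ℂ) + 1) ^ (-z) * g n)
    (fun n => (Differentiable.mul_const (Differentiable.const_cpow (by fun_prop)
      (Or.inl (Nat.cast_add_one_ne_zero n))) _).differentiableOn) Metric.isOpen_ball
    (fun n w hw => norm_dirichlet_term_le hg (by simpa using (mem_ball_zero_iff.1 hw).le) n)
  exact h.differentiableAt (Metric.isOpen_ball.mem_nhds (by simpa using hk))

theorem hasSum_riemannZeta {z : ℂ} (hz : 1 < z.re) :
    HasSum (fun n : ℕ => ((n : ℂ) + 1) ^ (-z)) (riemannZeta z) := by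
  have h1 : Summable fun n : ℕ => ((n : ℂ) + 1) ^ (-z) := by
    have h := (summable_nat_add_iff 1).2 (Complex.summable_one_div_nat_cpow.2 hz)
    refine h.congr fun n => ?_
    rw [Complex.cpow_neg, one_div]
    push_cast
    rfl
  rw [zeta_eq_tsum_one_div_nat_add_one_cpow hz]
  convert h1.hasSum using 3 with n
  rw [Complex.cpow_neg, one_div]

/-- By Cauchy's theorem the holomorphic part contributes nothing on circles inside the disc. The
value of f at the centre is irrelevant, so the convention 0⁻¹ = 0 does no harm. -/
theorem HasResidue.of_eq_add {f h : ℂ → ℂ} {z₀ c : ℂ} {R : ℝ} (hR : 0 < R)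
    (hf : ∀ z, f z = c * (z - z₀)⁻¹ + h z) (hh : DifferentiableOn ℂ h (Metric.ball z₀ R)) :
    HasResidue f z₀ c := by
  have : Set.Ioo 0 R ∈ nhdsWithin (0 : ℝ) (Set.Ioi 0) := Ioo_mem_nhdsGT hR
  filter_upwards [this] with ρ hρ
  have hsub : Metric.closedBall z₀ ρ ⊆ Metric.ball z₀ R := Metric.closedBall_subset_ball hρ.2
  have hc : ContinuousOn h (Metric.closedBall z₀ ρ) := hh.continuousOn.mono hsub
  have h0 : (∮ z in C(z₀, ρ), h z) = 0 :=
    Complex.circleIntegral_eq_zero_of_differentiable_on_off_countable hρ.1.le Set.countable_empty hc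
      fun z hz => hh.differentiableAt (Metric.isOpen_ball.mem_nhds
        (hsub (Metric.ball_subset_closedBall hz.1)))
  have hi1 : CircleIntegrable (fun z => c * (z - z₀)⁻¹) z₀ ρ := by
    refine ContinuousOn.circleIntegrable hρ.1.le (continuousOn_const.mul
      (ContinuousOn.inv₀ (by fun_prop) fun z hz h => ?_))
    rw [sub_eq_zero.1 h] at hz
    simp only [Metric.mem_sphere, dist_self] at hz
    exact hρ.1.ne hz
  have hi2 : CircleIntegrable h z₀ ρ :=
    (hc.mono Metric.sphere_subset_closedBall).circleIntegrable hρ.1.le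
  rw [show f = fun z => c * (z - z₀)⁻¹ + h z from funext hf, circleIntegral.integral_add hi1 hi2,
    h0,
    circleIntegral.integral_const_mul, circleIntegral.integral_sub_center_inv _ hρ.1.ne']
  ring

/-- The sequence `f` is affine up to an exponentially small error: `f n = c (n + 1) + c' + O(rⁿ)`,
`r < 1`. -/
def IsAsymptoticallyAffine (f : ℕ → ℂ) (c : ℂ) : Prop :=
  ∃ (c' : ℂ) (C r : ℝ), 0 < r ∧ r < 1 ∧ ∀ n : ℕ, ‖f n - (c * (n + 1) + c')‖ ≤ C * r ^ n

/-- The affine part sums to c ζ(z − 1) + c' ζ(z) for Re z > 2, and the exponentially small remainder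
gives an entire function. Near z = 2 only ζ(z − 1) is singular, with a simple pole of residue 1. -/
theorem IsAsymptoticallyAffine.exists_zeta {f : ℕ → ℂ} {c : ℂ} (h : IsAsymptoticallyAffine f c) :
    ∃ ζ : ℂ → ℂ, Meromorphic ζ ∧ HasResidue ζ 2 c ∧
      ∀ z : ℂ, 2 < z.re → HasSum (fun n : ℕ => ((n : ℂ) + 1) ^ (-z) * f n) (ζ z) := by
  obtain ⟨c', C, r, hr, hr1, hf⟩ := h
  obtain ⟨E, hE⟩ : ∃ E : ℂ → ℂ, E = fun z : ℂ => ∑' n : ℕ, ((n : ℂ) + 1) ^ (-z)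
    * (f n - (c * (n + 1) + c')) := ⟨_, rfl⟩
  have hEd : Differentiable ℂ E := hE ▸ differentiable_dirichlet hr hr1 hf
  have h0 : Differentiable ℂ fun z : ℂ => riemannZeta₀ (z - 1) := by fun_prop
  have hζ : MeromorphicOn riemannZeta Set.univ := fun z _ => by
    rcases eq_or_ne z 1 with rfl | hz
    · have h1 : MeromorphicAt (fun s : ℂ => (s - 1)⁻¹ + riemannZeta₀ s) 1 :=
        ((MeromorphicAt.id 1).sub (MeromorphicAt.const 1 1)).inv.add
          (differentiable_riemannZeta₀.analyticAt 1).meromorphicAt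
      refine h1.congr ?_
      filter_upwards [self_mem_nhdsWithin] with s hs
      exact (riemannZeta_eq_inv_sub_add hs).symm
    · exact (analyticOn_riemannZeta z hz).meromorphicAt
  -- Here ζ(z − 1) is split into its polar part and the entire function `riemannZeta₀`, so that the
  -- residue can be read off.
  refine ⟨fun z => c * (z - 2)⁻¹ + (c * riemannZeta₀ (z - 1) + c' * riemannZeta z + E z),
    fun z => ?_, ?_, fun z hz => ?_⟩
  · refine MeromorphicAt.add ?_ (((MeromorphicAt.const c z).mul (h0.analyticAt z).meromorphicAt).add
      ((MeromorphicAt.const c' z).mul (hζ z trivial)) |>.add (hEd.analyticAt z).meromorphicAt)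
    exact (MeromorphicAt.const c z).mul ((MeromorphicAt.id z).sub (MeromorphicAt.const 2 z)).inv
  · refine HasResidue.of_eq_add one_pos (fun z => rfl) ?_
    refine (h0.differentiableOn.const_mul c).add (DifferentiableOn.const_mul ?_ c') |>.add
      hEd.differentiableOn
    -- The pole of ζ at 1 lies on the boundary of the open unit disc around 2.
    refine differentiableOn_riemannZeta.mono fun z hz h => ?_
    rw [Set.mem_singleton_iff.1 h, Metric.mem_ball, dist_eq_norm] at hz
    norm_num at hz
  · have h1 := (hasSum_riemannZeta (z := z - 1) (by simp; linarith)).mul_left c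
    have h2 := (hasSum_riemannZeta (z := z) (by linarith)).mul_left c'
    have h3 := (summable_dirichlet hr hr1 hf z).hasSum
    have h4 := (h1.add h2).add h3
    have hne : z - 1 ≠ 1 := fun h => by
      have := congrArg Complex.re h
      simp at this
      linarith
    rw [riemannZeta_eq_inv_sub_add hne, sub_sub, one_add_one_eq_two] at h4
    have e1 : ∀ n : ℕ, ((n : ℂ) + 1) ^ (-z) * f n = c * ((n : ℂ) + 1) ^ (-(z - 1)) + c' *
      ((n : ℂ) + 1) ^ (-z)
        + ((n : ℂ) + 1) ^ (-z) * (f n - (c * (n + 1) + c')) := fun n => by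
      have hn : ((n : ℂ) + 1) ≠ 0 := Nat.cast_add_one_ne_zero n
      rw [neg_sub, sub_eq_add_neg, Complex.cpow_add _ _ hn, Complex.cpow_one]
      ring
    have e2 : c * (z - 2)⁻¹ + (c * riemannZeta₀ (z - 1) + c' * riemannZeta z + E z)
        = c * ((z - 2)⁻¹ + riemannZeta₀ (z - 1)) + c' * riemannZeta z
          + ∑' n : ℕ, ((n : ℂ) + 1) ^ (-z) * (f n - (c * (n + 1) + c')) := by
      rw [hE]
      ring
    simp only [e1, e2]
    exact h4
end DirichletSeries

/-! ### Trace class operators and sums over shells. -/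

section
variable {N : ℝ}

section Trace
variable {H : Type} [NormedAddCommGroup H] [InnerProductSpace ℂ H]

/-- Cauchy–Schwarz followed by Bessel's inequality for x and for y. -/
theorem sum_norm_inner_mul_inner_le {ι : Type} {v : ι → H} (hv : Orthonormal ℂ v) (x y : H)
    (s : Finset ι) : ∑ i ∈ s, ‖inner ℂ y (v i) * inner ℂ (v i) x‖ ≤ ‖x‖ * ‖y‖ := by
  have h1 : ∑ i ∈ s, ‖inner ℂ (v i) x‖ ^ 2 ≤ ‖x‖ ^ 2 := hv.sum_inner_products_le x
  have h2 : ∑ i ∈ s, ‖inner ℂ (v i) y‖ ^ 2 ≤ ‖y‖ ^ 2 := hv.sum_inner_products_le y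
  calc ∑ i ∈ s, ‖inner ℂ y (v i) * inner ℂ (v i) x‖
      = ∑ i ∈ s, ‖inner ℂ (v i) x‖ * ‖inner ℂ (v i) y‖ :=
        Finset.sum_congr rfl fun i _ => by rw [norm_mul, norm_inner_symm, mul_comm]
    _ ≤ √(∑ i ∈ s, ‖inner ℂ (v i) x‖ ^ 2) * √(∑ i ∈ s, ‖inner ℂ (v i) y‖ ^ 2) :=
        Real.sum_mul_le_sqrt_mul_sqrt _ _ _
    _ ≤ ‖x‖ * ‖y‖ := by
        refine mul_le_mul ?_ ?_ (Real.sqrt_nonneg _) (norm_nonneg _)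
        · exact Real.sqrt_le_iff.2 ⟨norm_nonneg _, h1⟩
        · exact Real.sqrt_le_iff.2 ⟨norm_nonneg _, h2⟩

/-- The double series ⟨yₙ, bᵢ⟩⟨bᵢ, xₙ⟩ converges absolutely. Summed first over i it gives ∑⟨yₙ, xₙ⟩
by Parseval, summed first over n it gives the diagonal sum in the basis b; the trace therefore does
not depend on the basis. -/
theorem hasTrace_of_hasSum {T : H →L[ℂ] H} {x y : ℕ → H}
    (hxy : Summable fun n => ‖x n‖ * ‖y n‖)
    (hT : ∀ v, HasSum (fun n => inner ℂ (y n) v • x n) (T v)) {t : ℂ}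
    (ht : HasSum (fun n => inner ℂ (y n) (x n)) t) : HasTrace T t := by
  refine ⟨⟨x, y, hxy, hT⟩, fun ι b => ?_⟩
  have hs : Summable fun p : ℕ × ι => inner ℂ (y p.1) (b p.2) * inner ℂ (b p.2) (x p.1) := by
    refine Summable.of_norm ((summable_prod_of_nonneg fun _ => norm_nonneg _).2 ⟨fun n => ?_, ?_⟩)
    · exact summable_of_sum_le (fun _ => norm_nonneg _)
        fun s => sum_norm_inner_mul_inner_le b.orthonormal (x n) (y n) s
    · refine Summable.of_nonneg_of_le (fun n => tsum_nonneg fun _ => norm_nonneg _)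
        (fun n => ?_) hxy
      exact Real.tsum_le_of_sum_le (fun _ => norm_nonneg _)
        fun s => sum_norm_inner_mul_inner_le b.orthonormal (x n) (y n) s
  have h1 := hs.hasSum.prod_fiberwise fun n => b.hasSum_inner_mul_inner (y n) (x n)
  have h2 := ((Equiv.prodComm ι ℕ).hasSum_iff.2 hs.hasSum).prod_fiberwise
    (g := fun i => inner ℂ (b i) (T (b i))) fun i => by
      have := (hT (b i)).mapL (innerSL ℂ (b i))
      simpa [inner_smul_right] using this
  rwa [h1.unique ht] at h2
end Trace

section Labels
theorem exists_two_mul_abs (hN : ∃ k : ℤ, N = k / 2) : ∃ K : ℕ, 2 * |N| = K := by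
  obtain ⟨k, rfl⟩ := hN
  refine ⟨k.natAbs, ?_⟩
  rw [abs_div, abs_two, Nat.cast_natAbs, Int.cast_abs]
  ring

/-- Coordinates adapted to the asymptotics: the shell n = l − |N| and the position i = l + m, which
runs from 0 to 2l = 2n + K. The limits of the matrix elements depend on i, not on m. -/
theorem exists_label_equiv (hN : ∃ k : ℤ, N = k / 2) {K : ℕ} (hK : 2 * |N| = K) :
    ∃ e : (Σ n : ℕ, Fin (2 * n + K + 1) × Bool) ≃ Label N, ∀ x, (e x).1.1.1 = x.1 + |N|
      ∧ (e x).1.1.1 + (e x).1.1.2 = ((x.2.1 : ℕ) : ℝ) ∧ (e x).2 = x.2.2 := by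
  have hv : ∀ x : (Σ n : ℕ, Fin (2 * n + K + 1) × Bool),
      Valid N (x.1 + |N|) (((x.2.1 : ℕ) : ℝ) - (x.1 + |N|)) := fun x => by
    refine (valid_iff hN).2 ⟨⟨x.1, by ring⟩, ⟨2 * x.1 + K - x.2.1, ?_⟩, ⟨x.2.1, by ring⟩⟩
    rw [Nat.cast_sub (Nat.lt_succ_iff.1 x.2.1.2)]
    push_cast
    linarith
  refine ⟨Equiv.ofBijective
    (fun x => (⟨(x.1 + |N|, ((x.2.1 : ℕ) : ℝ) - (x.1 + |N|)), hv x⟩, x.2.2)) ⟨?_, ?_⟩,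
    fun x => ⟨rfl, ?_, rfl⟩⟩
  · rintro ⟨n, i, ε⟩ ⟨n', i', ε'⟩ h
    simp only [Prod.mk.injEq, Subtype.mk.injEq, add_left_inj, Nat.cast_inj] at h
    obtain ⟨⟨rfl, h2⟩, rfl⟩ := h
    have : i = i' := by
      rw [sub_left_inj, Nat.cast_inj] at h2
      exact Fin.ext h2
    rw [this]
  · rintro ⟨⟨⟨l, m⟩, h⟩, ε⟩
    obtain ⟨⟨a, ha⟩, ⟨b, hb⟩, ⟨c, hc⟩⟩ := (valid_iff hN).1 h
    have hlt : c < 2 * a + K + 1 := by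
      have : (c : ℝ) + b = 2 * a + K := by rw [← hc, ← hb, ← ha, ← hK]; ring
      have : c + b = 2 * a + K := by exact_mod_cast this
      omega
    refine ⟨⟨a, ⟨c, hlt⟩, ε⟩, ?_⟩
    have e1 : (a : ℝ) + |N| = l := by linarith
    have e2 : (c : ℝ) - l = m := by linarith
    simp [e1, e2]
  · exact add_sub_cancel _ _
end Labels

/-- The diagonal matrix element of `T` at a label. -/
noncomputable def diag (T : Spinors N →L[ℂ] Spinors N) (x : Label N) : ℂ :=
  T (lp.single 2 x (1 : ℂ)) x

theorem norm_diag_le (T : Spinors N →L[ℂ] Spinors N) (x : Label N) : ‖diag T x‖ ≤ ‖T‖ := by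
  refine (lp.norm_apply_le_norm two_ne_zero _ x).trans ((T.le_opNorm _).trans ?_)
  simp [lp.norm_single]

/-- The shell n has 2(2n + K + 1) vectors, each scaled by (n + 1)^(−z), so the norms are summable
exactly in the range where ∑(n + 1)^(1 − Re z) converges. This gives a nuclear expansion along the
basis and allows the diagonal to be summed shell by shell. -/
theorem hasTrace_comp_absDiracPow {K : ℕ}
    {e : (Σ n : ℕ, Fin (2 * n + K + 1) × Bool) ≃ Label N}
    (he : ∀ x, (e x).1.1.1 = x.1 + |N|) (T : Spinors N →L[ℂ] Spinors N) {z : ℂ} (hz : 2 < z.re)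
    {t : ℂ} (ht : HasSum (fun n : ℕ => ((n : ℂ) + 1) ^ (-z) * ∑ y, diag T (e ⟨n, y⟩)) t) :
    HasTrace (T ∘L absDiracPow N z (by linarith)) t := by
  have heig : ∀ x, eigenvalue (e x) = x.1 + 1 := fun x => by
    rw [eigenvalue, Label.l, he]; ring
  have hnorm : ∀ x, ‖(eigenvalue (e x) : ℂ) ^ (-z)‖ = ((x.1 : ℝ) + 1) ^ (-z.re) := fun x => by
    rw [heig]
    push_cast
    exact norm_natCast_succ_cpow _ _
  have hs : Summable fun x => ‖(eigenvalue (e x) : ℂ) ^ (-z)‖ := by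
    refine (summable_sigma_of_nonneg fun _ => norm_nonneg _).2 ⟨fun n => Summable.of_finite, ?_⟩
    simp only [hnorm, tsum_fintype, Finset.sum_const, Finset.card_univ, Fintype.card_prod,
      Fintype.card_fin, Fintype.card_bool, nsmul_eq_mul]
    have h1 : Summable fun n : ℕ => ((n : ℝ) + 1) ^ (1 - z.re) := by
      have := (summable_nat_add_iff 1).2
        (Real.summable_nat_rpow.2 (show 1 - z.re < -1 by linarith))
      simpa using this
    refine Summable.of_nonneg_of_le (fun n => by positivity) (fun n => ?_)
      (h1.mul_left (2 * (K + 2 : ℝ)))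
    have hn : (0 : ℝ) < n + 1 := by positivity
    rw [sub_eq_add_neg, Real.rpow_add hn, Real.rpow_one, ← mul_assoc]
    refine mul_le_mul_of_nonneg_right ?_ (by positivity)
    push_cast
    have : (0 : ℝ) ≤ n * K := by positivity
    nlinarith
  have hs' : Summable fun x => ‖(eigenvalue x : ℂ) ^ (-z)‖ := e.summable_iff.1 hs
  have hsum : HasSum (fun x => (eigenvalue x : ℂ) ^ (-z) * diag T x) t := by
    have hb : Summable fun x => (eigenvalue (e x) : ℂ) ^ (-z) * diag T (e x) := by
      refine Summable.of_norm_bounded (hs.mul_right ‖T‖) fun x => ?_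
      rw [norm_mul]
      exact mul_le_mul_of_nonneg_left (norm_diag_le T _) (norm_nonneg _)
    have h2 := hb.hasSum.sigma fun n => hasSum_fintype _
    have h3 : HasSum (fun n : ℕ => ((n : ℂ) + 1) ^ (-z) * ∑ y, diag T (e ⟨n, y⟩))
        (∑' x, (eigenvalue (e x) : ℂ) ^ (-z) * diag T (e x)) := by
      convert h2 using 1
      funext n
      rw [Finset.mul_sum]
      refine Finset.sum_congr rfl fun y _ => ?_
      rw [heig]
      push_cast
      rfl
    have h4 := hb.hasSum
    rw [h3.unique ht] at h4
    exact e.hasSum_iff.1 h4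
  have : Infinite (Σ n : ℕ, Fin (2 * n + K + 1) × Bool) :=
    Infinite.of_injective (fun n : ℕ => ⟨n, 0, true⟩) fun a b h => by
      simpa using congrArg Sigma.fst h
  have : Infinite (Label N) := Infinite.of_injective e e.injective
  have : Countable (Label N) := e.symm.injective.countable
  -- Trace class is expressed through sequences, so the labels are enumerated by ℕ.
  obtain ⟨d⟩ := nonempty_equiv_of_countable (α := ℕ) (β := Label N)
  have hinner : ∀ (x : Label N) (v : Spinors N), inner ℂ (lp.single 2 x (1 : ℂ) : Spinors N) v =
    v x :=
    fun x v => by rw [lp.inner_single_left]; simp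
  refine hasTrace_of_hasSum
    (x := fun n => (eigenvalue (d n) : ℂ) ^ (-z) • T (lp.single 2 (d n) (1 : ℂ)))
    (y := fun n => lp.single 2 (d n) (1 : ℂ)) ?_ (fun v => ?_) ?_
  · refine Summable.of_nonneg_of_le (fun n => by positivity) (fun n => ?_)
      ((d.summable_iff.2 hs').mul_right ‖T‖)
    rw [norm_smul, lp.norm_single (by norm_num), norm_one, mul_one]
    refine mul_le_mul_of_nonneg_left ((T.le_opNorm _).trans ?_) (norm_nonneg _)
    rw [lp.norm_single (by norm_num), norm_one, mul_one]
  · have h := (lp.hasSum_single (by norm_num : (2 : ENNReal) ≠ ⊤)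
      (absDiracPow N z (by linarith) v)).mapL T
    have h2 := d.hasSum_iff.2 h
    convert h2 using 1
    · funext n
      simp only [Function.comp]
      rw [hinner, absDiracPow_apply, smul_smul, ← map_smul, ← lp.single_smul, smul_eq_mul,
        mul_one, mul_comm]
    · rfl
  · have h2 := d.hasSum_iff.2 hsum
    convert h2 using 1
    funext n
    simp only [Function.comp]
    rw [inner_smul_right, hinner, diag]

theorem hasNCIntegral_of_isAsymptoticallyAffine {K : ℕ}
    {e : (Σ n : ℕ, Fin (2 * n + K + 1) × Bool) ≃ Label N}
    (he : ∀ x, (e x).1.1.1 = x.1 + |N|) (T : Spinors N →L[ℂ] Spinors N) {c : ℂ}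
    (h : IsAsymptoticallyAffine (fun n => ∑ y, diag T (e ⟨n, y⟩)) c) : HasNCIntegral N T c := by
  obtain ⟨ζ, h1, h2, h3⟩ := h.exists_zeta
  exact ⟨ζ, ⟨h1, fun z hz => hasTrace_comp_absDiracPow he T hz (h3 z hz)⟩, h2⟩

end

/-! ### Asymptotics of the matrix elements of x₀. -/

section
open Asymptotics Filter
variable {N : ℝ}

section BigO
variable {ι : Type*} {𝓁 : Filter ι} {f f' g g' u : ι → ℝ}

/-- From fg − f'g' = f(g − g') + (f − f')g': factors can be replaced by their limits one at a time.
-/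
theorem isBigO_mul_sub_mul (hf : (fun x => f x - f' x) =O[𝓁] u) (hg : (fun x => g x - g' x) =O[𝓁] u)
    (hf0 : f =O[𝓁] fun _ => (1 : ℝ)) (hg0 : g' =O[𝓁] fun _ => (1 : ℝ)) :
    (fun x => f x * g x - f' x * g' x) =O[𝓁] u := by
  have h1 := hf0.mul hg
  have h2 := hf.mul hg0
  simp only [one_mul, mul_one] at h1 h2
  exact (h1.add h2).congr_left fun x => by ring

theorem isBigO_one_mul_one (hf : f =O[𝓁] fun _ => (1 : ℝ)) (hg : g =O[𝓁] fun _ => (1 : ℝ)) :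
    (fun x => f x * g x) =O[𝓁] fun _ => (1 : ℝ) :=
  (hf.mul hg).congr_right fun _ => one_mul 1

theorem isBigO_one_of_sub (hu : u =O[𝓁] fun _ => (1 : ℝ)) (hf : (fun x => f x - f' x) =O[𝓁] u)
    (hf0 : f' =O[𝓁] fun _ => (1 : ℝ)) : f =O[𝓁] fun _ => (1 : ℝ) :=
  ((hf.trans hu).add hf0).congr_left fun x => by ring

theorem isBigO_mul_const_sub_mul_const (hu : u =O[𝓁] fun _ => (1 : ℝ)) {a b : ℝ}
    (hf : (fun x => f x - a) =O[𝓁] u) (hg : (fun x => g x - b) =O[𝓁] u) :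
    (fun x => f x * g x - a * b) =O[𝓁] u :=
  isBigO_mul_sub_mul hf hg (isBigO_one_of_sub hu hf (isBigO_const_const _ one_ne_zero _))
    (isBigO_const_const _ one_ne_zero _)

theorem isBigO_inv_sub_one {δ : ℝ} (hδ : 0 < δ) (hδf : ∀ᶠ x in 𝓁, δ ≤ f x)
    (hf : (fun x => f x - 1) =O[𝓁] u) : (fun x => (f x)⁻¹ - 1) =O[𝓁] u := by
  refine IsBigO.trans ?_ hf
  refine IsBigO.of_bound δ⁻¹ ?_
  filter_upwards [hδf] with x hx
  have h0 : 0 < f x := hδ.trans_le hx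
  rw [show (f x)⁻¹ - 1 = (f x)⁻¹ * -(f x - 1) by field_simp; ring, norm_mul, norm_neg,
    Real.norm_of_nonneg (inv_nonneg.2 h0.le)]
  gcongr

/-- From (√a − √b)² ≤ |a − b|. No lower bound on a or b is needed, at the price that an error v²
becomes v; the limits here do come close to 0. -/
theorem isBigO_sqrt_sub_sqrt {v : ι → ℝ} (hf : (fun x => f x - f' x) =O[𝓁] fun x => v x ^ 2)
    (hf0 : ∀ᶠ x in 𝓁, 0 ≤ f x) (hf0' : ∀ᶠ x in 𝓁, 0 ≤ f' x) : (fun x => √(f x) - √(f' x)) =O[𝓁] v := by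
  obtain ⟨C, hC, h⟩ := hf.exists_pos
  refine IsBigO.of_bound √C ?_
  filter_upwards [h.bound, hf0, hf0'] with x hx h1 h2
  have h3 : (√(f x) - √(f' x)) ^ 2 ≤ |f x - f' x| := by
    have e1 := Real.sq_sqrt h1
    have e2 := Real.sq_sqrt h2
    have p1 := Real.sqrt_nonneg (f x)
    have p2 := Real.sqrt_nonneg (f' x)
    rcases le_total (√(f x)) (√(f' x)) with h | h
    · rw [abs_sub_comm]
      refine le_trans ?_ (le_abs_self _)
      nlinarith
    · refine le_trans ?_ (le_abs_self _)
      nlinarith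
  rw [Real.norm_eq_abs, Real.norm_eq_abs, ← Real.sqrt_sq_eq_abs, ← Real.sqrt_sq_eq_abs (v x),
    ← Real.sqrt_mul hC.le]
  refine Real.sqrt_le_sqrt (h3.trans (hx.trans_eq ?_))
  rw [Real.norm_of_nonneg (by positivity)]
end BigO

section Formulas
variable {q s M l m : ℝ}

theorem qNum_eq' (hq : 0 < q) (x : ℝ) :
    qNum q x = (1 - (q ^ x) ^ 2) / (q ^ x * (q⁻¹ - q)) := by
  have h := (Real.rpow_pos_of_pos hq x).ne'
  rw [qNum, Real.rpow_neg hq.le, ← neg_div_neg_eq, neg_sub, neg_sub, ← div_div]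
  congr 1
  field_simp

/-- Written in X = q^l, Y = q^(l+m) and T = q^M, the growing powers of q⁻¹ cancel. Apart from a
constant and a factor that contains Y, only factors tending to constants as X → 0 are left. -/
theorem coeffAPlus_pred_sq (hq : 0 < q) (hq1 : q < 1) (hl : 1 ≤ l) (hM : |M| ≤ l)
    (h1 : 0 ≤ l - m) (h2 : 0 ≤ l + m) :
    coeffAPlus q s M (l - 1) m ^ 2 = qNum q 2 ^ 2
      * (((q ^ (l + m)) ^ 2 - (q ^ l) ^ 4) * (1 - (q ^ (l + m)) ^ 2))
      * ((1 - (q ^ l) ^ 2 * (q ^ M) ^ 2) * (1 - (q ^ l) ^ 2 * ((q ^ M)⁻¹) ^ 2)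
        * (((q ^ l) ^ 2 * (q ^ M) ^ 2 + s ^ 2) * ((q ^ l) ^ 2 * ((q ^ M)⁻¹) ^ 2 * s ^ 2 + 1)))
      * ((1 - (q ^ l) ^ 4 / q ^ 2) * (1 - (q ^ l) ^ 4 * q ^ 2)
        * ((1 - (q ^ l) ^ 4) * (1 - (q ^ l) ^ 4)))⁻¹ := by
  have n1 := qNum_nonneg hq hq1 h1
  have n2 := qNum_nonneg hq hq1 h2
  have n3 := qNum_nonneg hq hq1 zero_le_two
  rw [coeffAPlus, sub_add_cancel, show l - 1 - m + 1 = l - m by ring,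
    show l - 1 + m + 1 = l + m by ring, mul_pow, mul_pow, Real.sq_sqrt (by positivity),
    alphaCoeff_sq hq hq1 hM (by linarith)]
  have hx := Real.rpow_pos_of_pos hq l
  have hy := Real.rpow_pos_of_pos hq m
  have ht := Real.rpow_pos_of_pos hq M
  have hκ : 0 < q⁻¹ - q := by
    have := one_lt_inv_iff₀.2 ⟨hq, hq1⟩
    linarith
  have hlt : (q ^ l) ≤ q := by
    simpa using Real.rpow_le_rpow_of_exponent_ge hq hq1.le hl
  have e2 : q ^ (2 * l) = (q ^ l) ^ 2 := by
    rw [mul_comm, Real.rpow_mul hq.le, Real.rpow_two]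
  have p2 : (q ^ l) ^ 2 ≤ q ^ 2 := by gcongr
  have q2 : q ^ 2 < 1 := pow_lt_one₀ hq.le hq1 two_ne_zero
  have p4 : (q ^ l) ^ 4 ≤ q ^ 4 := by gcongr
  have q4 : q ^ 4 < q ^ 2 := pow_lt_pow_right_of_lt_one₀ hq hq1 (by norm_num)
  rw [qNum_eq' hq (l - m), qNum_eq' hq (l + m), qNum_eq' hq (l + M), qNum_eq' hq (l - M),
    qNum_eq' hq (2 * l - 1), qNum_eq' hq (2 * l + 1), qNum_eq' hq (2 * l), Real.rpow_neg hq.le,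
    Real.rpow_neg hq.le]
  simp only [Real.rpow_add hq, Real.rpow_sub hq, e2, Real.rpow_one]
  generalize q ^ l = x at *
  generalize q ^ m = y at *
  generalize q ^ M = t at *
  have d1 : 1 - x ^ 4 ≠ 0 := by linarith
  have d2 : q ^ 2 - x ^ 4 ≠ 0 := by linarith
  have d3 : 1 - x ^ 4 * q ^ 2 ≠ 0 := by nlinarith
  have d4 : 1 - x ^ 4 / q ^ 2 ≠ 0 := by
    have : x ^ 4 / q ^ 2 < 1 := by rw [div_lt_one (by positivity)]; linarith
    linarith
  rw [show 1 - (x ^ 2 / q) ^ 2 = 1 - x ^ 4 / q ^ 2 by ring,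
    show 1 - (x ^ 2 * q) ^ 2 = 1 - x ^ 4 * q ^ 2 by ring,
    show 1 - (x ^ 2) ^ 2 = 1 - x ^ 4 by ring]
  generalize 1 - x ^ 4 / q ^ 2 = D1 at *
  generalize 1 - x ^ 4 * q ^ 2 = D2 at *
  generalize q⁻¹ - q = κ at *
  rw [show (x * y) ^ 2 - x ^ 4 = (x * y) ^ 2 * (1 - (x / y) ^ 2) by field_simp]
  generalize hD : 1 - x ^ 4 = D3 at *
  clear hD
  field_simp

theorem coeffAZero_eq_of_pow (hq : 0 < q) (hq1 : q < 1) (hl : 0 < l) :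
    coeffAZero q s M l m
      = (1 - (q ^ l) ^ 4 - (q ^ 2 + 1) * ((q ^ (l + m)) ^ 2 - (q ^ l) ^ 4))
        * (((1 - (q ^ l) ^ 4) - (q ^ 2 + 1) * (q ^ l) ^ 2 * ((q ^ M) ^ 2 - (q ^ l) ^ 2)) *
          (1 - s ^ 2)
          + (q ^ 2 + 1) * (q ^ l) ^ 2 * (((q ^ M)⁻¹) ^ 2 - (q ^ M) ^ 2) * s ^ 2)
        * ((1 - (q ^ l) ^ 4) * (1 - (q ^ l) ^ 4 * q ^ 4))⁻¹ := by
  have hx := Real.rpow_pos_of_pos hq l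
  have hy := Real.rpow_pos_of_pos hq m
  have ht := Real.rpow_pos_of_pos hq M
  have hκ : 0 < q⁻¹ - q := by
    have := one_lt_inv_iff₀.2 ⟨hq, hq1⟩
    linarith
  have hlt : q ^ l < 1 := Real.rpow_lt_one hq.le hq1 hl
  have e2 : q ^ (2 * l) = (q ^ l) ^ 2 := by
    rw [mul_comm, Real.rpow_mul hq.le, Real.rpow_two]
  have e2' : q ^ (2 * M) = (q ^ M) ^ 2 := by
    rw [mul_comm, Real.rpow_mul hq.le, Real.rpow_two]
  rw [coeffAZero, betaCoeff, qNum_eq' hq (l - m), qNum_eq' hq (l - M), qNum_eq' hq (2 * M),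
    qNum_eq' hq (2 * l), qNum_eq' hq (2 * l + 2), qNum_two hq hq1]
  simp only [Real.rpow_add hq, Real.rpow_sub hq, e2, e2', Real.rpow_one, Real.rpow_two]
  generalize q ^ l = x at *
  generalize q ^ m = y at *
  generalize q ^ M = t at *
  have d1 : 1 - x ^ 4 ≠ 0 := by have := pow_lt_one₀ hx.le hlt four_ne_zero; linarith
  have d2 : 1 - x ^ 4 * q ^ 4 ≠ 0 := by
    have h1 := pow_lt_one₀ hx.le hlt four_ne_zero
    have h2 := pow_lt_one₀ hq.le hq1 four_ne_zero
    nlinarith [pow_pos hx 4]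
  rw [show 1 - (x ^ 2 * q ^ 2) ^ 2 = 1 - x ^ 4 * q ^ 4 by ring,
    show 1 - (x ^ 2) ^ 2 = 1 - x ^ 4 by ring]
  generalize 1 - x ^ 4 * q ^ 4 = D2 at *
  have hκ' : q⁻¹ - q ≠ 0 := hκ.ne'
  generalize hD : 1 - x ^ 4 = D3 at *
  generalize q⁻¹ - q = κ at *
  field_simp
end Formulas

end

section
open Asymptotics Filter
variable {q s M N : ℝ}

theorem coeffAPlus_pred_nonneg {l m : ℝ} (hq : 0 < q) (hq1 : q < 1) (hl : 1 / 2 ≤ l) :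
    0 ≤ coeffAPlus q s M (l - 1) m := by
  have h1 := (qNum_pos hq hq1 (show 0 < 2 * l by linarith)).le
  have h2 := (Real.rpow_pos_of_pos hq m).le
  rw [coeffAPlus, sub_add_cancel, alphaCoeff]
  positivity

section
variable {𝓁 : Filter (ℝ × ℝ)}

theorem isBigO_rpow_two_one (hq : 0 < q) (hq1 : q < 1) (h0 : ∀ᶠ p in 𝓁, 0 ≤ p.1) :
    (fun p : ℝ × ℝ => (q ^ p.1) ^ 2) =O[𝓁] fun _ => (1 : ℝ) := by
  refine IsBigO.of_bound 1 ?_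
  filter_upwards [h0] with p hp
  rw [norm_pow, Real.norm_of_nonneg (Real.rpow_nonneg hq.le _), norm_one, mul_one]
  exact pow_le_one₀ (Real.rpow_nonneg hq.le _) (Real.rpow_le_one hq.le hq1.le hp)

theorem isBigO_rpow_four (hq : 0 < q) (hq1 : q < 1) (h0 : ∀ᶠ p in 𝓁, 0 ≤ p.1) :
    (fun p : ℝ × ℝ => (q ^ p.1) ^ 4) =O[𝓁] fun p => (q ^ p.1) ^ 2 := by
  refine IsBigO.of_bound 1 ?_
  filter_upwards [h0] with p hp
  have h1 := Real.rpow_nonneg hq.le p.1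
  rw [norm_pow, norm_pow, Real.norm_of_nonneg h1, one_mul]
  exact pow_le_pow_of_le_one h1 (Real.rpow_le_one hq.le hq1.le hp) (by norm_num)

theorem isBigO_rpow_add_sq_one (hq : 0 < q) (hq1 : q < 1) (h0 : ∀ᶠ p in 𝓁, 0 ≤ p.1 + p.2) :
    (fun p : ℝ × ℝ => (q ^ (p.1 + p.2)) ^ 2) =O[𝓁] fun _ => (1 : ℝ) := by
  refine IsBigO.of_bound 1 ?_
  filter_upwards [h0] with p hp
  rw [norm_pow, Real.norm_of_nonneg (Real.rpow_nonneg hq.le _), norm_one, mul_one]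
  exact pow_le_one₀ (Real.rpow_nonneg hq.le _) (Real.rpow_le_one hq.le hq1.le hp)

/-- Put X = 0 in the closed form, factor by factor. The bound 1 ≤ l keeps away from the zero of 1 −
q^(4l − 2) at l = 1/2. -/
theorem isBigO_coeffAPlus_pred_sq (hq : 0 < q) (hq1 : q < 1) (h0 : ∀ᶠ p in 𝓁, 1 ≤ p.1)
    (hM : ∀ᶠ p in 𝓁, |M| ≤ p.1) (h1 : ∀ᶠ p in 𝓁, 0 ≤ p.1 - p.2) (h2 : ∀ᶠ p in 𝓁, 0 ≤ p.1 + p.2) :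
    (fun p : ℝ × ℝ => coeffAPlus q s M (p.1 - 1) p.2 ^ 2
      - qNum q 2 ^ 2 * ((q ^ (p.1 + p.2)) ^ 2 * (1 - (q ^ (p.1 + p.2)) ^ 2)) * s ^ 2)
      =O[𝓁] fun p => (q ^ p.1) ^ 2 := by
  have h0' : ∀ᶠ p in 𝓁, 0 ≤ p.1 := h0.mono fun p h => by linarith
  have hu := isBigO_rpow_two_one hq hq1 h0'
  have hx4 := isBigO_rpow_four hq hq1 h0'
  have hy := isBigO_rpow_add_sq_one hq hq1 h2
  have hx2 := isBigO_refl (fun p : ℝ × ℝ => (q ^ p.1) ^ 2) 𝓁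
  have h1y : (fun p : ℝ × ℝ => 1 - (q ^ (p.1 + p.2)) ^ 2) =O[𝓁] fun _ => (1 : ℝ) :=
    (isBigO_refl _ _).sub hy
  have sub1 : ∀ {f : ℝ × ℝ → ℝ} (c : ℝ), f =O[𝓁] (fun p => (q ^ p.1) ^ 2) →
      (fun p => 1 - f p * c - 1) =O[𝓁] fun p => (q ^ p.1) ^ 2 := fun c h =>
    ((h.const_mul_left c).neg_left).congr_left fun p => by ring
  have k1 : (fun p : ℝ × ℝ => qNum q 2 ^ 2
        * (((q ^ (p.1 + p.2)) ^ 2 - (q ^ p.1) ^ 4) * (1 - (q ^ (p.1 + p.2)) ^ 2))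
      - qNum q 2 ^ 2 * ((q ^ (p.1 + p.2)) ^ 2 * (1 - (q ^ (p.1 + p.2)) ^ 2)))
      =O[𝓁] fun p => (q ^ p.1) ^ 2 := by
    have := (hx4.mul h1y).const_mul_left (-qNum q 2 ^ 2)
    simp only [mul_one] at this
    exact this.congr_left fun p => by ring
  have k2 := isBigO_mul_const_sub_mul_const hu
    (isBigO_mul_const_sub_mul_const hu (sub1 ((q ^ M) ^ 2) hx2) (sub1 (((q ^ M)⁻¹) ^ 2) hx2))
    (isBigO_mul_const_sub_mul_const (b := 1) (a := s ^ 2) hu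
      (f := fun p => (q ^ p.1) ^ 2 * (q ^ M) ^ 2 + s ^ 2)
      (g := fun p => (q ^ p.1) ^ 2 * ((q ^ M)⁻¹) ^ 2 * s ^ 2 + 1)
      ((hx2.const_mul_left ((q ^ M) ^ 2)).congr_left fun p => by ring)
      ((hx2.const_mul_left (((q ^ M)⁻¹) ^ 2 * s ^ 2)).congr_left fun p => by ring))
  have k3 := isBigO_mul_const_sub_mul_const hu
    (isBigO_mul_const_sub_mul_const hu
      (((hx4.const_mul_left (-(q ^ 2)⁻¹))).congr_left fun p => show _ = 1 - (q ^ p.1) ^ 4 / q ^ 2 -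
        1 by ring)
      (sub1 (q ^ 2) hx4))
    (isBigO_mul_const_sub_mul_const hu (hx4.neg_left.congr_left fun p => show _ = 1 -
      (q ^ p.1) ^ 4 - 1 by ring)
      (hx4.neg_left.congr_left fun p => show _ = 1 - (q ^ p.1) ^ 4 - 1 by ring))
  simp only [mul_one, one_mul] at k2 k3
  have q2 : q ^ 2 < 1 := pow_lt_one₀ hq.le hq1 two_ne_zero
  -- For l ≥ 1 one has q^(4l − 2) ≤ q², so each of the four factors of the denominator is at least 1
  -- − q².
  have k4 := isBigO_inv_sub_one (δ := (1 - q ^ 2) * (1 - q ^ 2) * ((1 - q ^ 2) * (1 - q ^ 2)))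
    (by have : 0 < 1 - q ^ 2 := by linarith
        positivity) (by
      filter_upwards [h0] with p hp
      have hx : q ^ p.1 ≤ q := by simpa using Real.rpow_le_rpow_of_exponent_ge hq hq1.le hp
      have hx0 := Real.rpow_nonneg hq.le p.1
      have h4 : (q ^ p.1) ^ 4 ≤ q ^ 4 := by gcongr
      have h5 : q ^ 4 ≤ q ^ 2 := pow_le_pow_of_le_one hq.le hq1.le (by norm_num)
      have h6 : (q ^ p.1) ^ 4 / q ^ 2 ≤ q ^ 2 := by
        rw [div_le_iff₀ (by positivity)]; linarith
      have h7 : (q ^ p.1) ^ 4 * q ^ 2 ≤ q ^ 2 :=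
        mul_le_of_le_one_left (by positivity) (by linarith)
      have h8 : 0 ≤ 1 - q ^ 2 := by linarith
      exact mul_le_mul (mul_le_mul (by linarith) (by linarith) h8 (by linarith))
        (mul_le_mul (by linarith) (by linarith) h8 (by linarith)) (mul_nonneg h8 h8)
        (mul_nonneg (by linarith) (by linarith))) k3
  have hc : ∀ c : ℝ, (fun _ : ℝ × ℝ => c) =O[𝓁] fun _ => (1 : ℝ) := fun c =>
    isBigO_const_const _ one_ne_zero _
  have b0 : (fun p : ℝ × ℝ => qNum q 2 ^ 2 * ((q ^ (p.1 + p.2)) ^ 2 * (1 - (q ^ (p.1 + p.2)) ^ 2)))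
      =O[𝓁] fun _ => (1 : ℝ) := (isBigO_one_mul_one hy h1y).const_mul_left _
  have b1 := isBigO_one_of_sub hu k1 b0
  have k5 := isBigO_mul_sub_mul k1 k2 b1 (hc _)
  have b2 := isBigO_one_of_sub hu k5 (isBigO_one_mul_one b0 (hc (s ^ 2)))
  have k6 := isBigO_mul_sub_mul k5 k4 b2 (hc _)
  refine k6.congr' ?_ EventuallyEq.rfl
  filter_upwards [h0, hM, h1, h2] with p e0 e1 e2 e3
  rw [coeffAPlus_pred_sq hq hq1 e0 e1 e2 e3, mul_one]

theorem isBigO_coeffAZero (hq : 0 < q) (hq1 : q < 1) (h0 : ∀ᶠ p in 𝓁, 1 / 2 ≤ p.1)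
    (h2 : ∀ᶠ p in 𝓁, 0 ≤ p.1 + p.2) :
    (fun p : ℝ × ℝ => coeffAZero q s M p.1 p.2
      - (1 - (q ^ 2 + 1) * (q ^ (p.1 + p.2)) ^ 2) * (1 - s ^ 2)) =O[𝓁] fun p => (q ^ p.1) ^ 2 := by
  have h0' : ∀ᶠ p in 𝓁, 0 ≤ p.1 := h0.mono fun p h => by linarith
  have hu := isBigO_rpow_two_one hq hq1 h0'
  have hx4 := isBigO_rpow_four hq hq1 h0'
  have hy := isBigO_rpow_add_sq_one hq hq1 h2
  have hx2 := isBigO_refl (fun p : ℝ × ℝ => (q ^ p.1) ^ 2) 𝓁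
  have hc : ∀ c : ℝ, (fun _ : ℝ × ℝ => c) =O[𝓁] fun _ => (1 : ℝ) := fun c =>
    isBigO_const_const _ one_ne_zero _
  have b0 : (fun p : ℝ × ℝ => 1 - (q ^ 2 + 1) * (q ^ (p.1 + p.2)) ^ 2) =O[𝓁] fun _ => (1 : ℝ) :=
    (hc 1).sub (hy.const_mul_left _)
  have k1 : (fun p : ℝ × ℝ => (1 - (q ^ p.1) ^ 4 - (q ^ 2 + 1) *
    ((q ^ (p.1 + p.2)) ^ 2 - (q ^ p.1) ^ 4))
      - (1 - (q ^ 2 + 1) * (q ^ (p.1 + p.2)) ^ 2)) =O[𝓁] fun p => (q ^ p.1) ^ 2 :=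
    (hx4.const_mul_left (q ^ 2)).congr_left fun p => by ring
  have k2 : (fun p : ℝ × ℝ => (((1 - (q ^ p.1) ^ 4) - (q ^ 2 + 1) * (q ^ p.1) ^ 2
        * ((q ^ M) ^ 2 - (q ^ p.1) ^ 2)) * (1 - s ^ 2)
        + (q ^ 2 + 1) * (q ^ p.1) ^ 2 * (((q ^ M)⁻¹) ^ 2 - (q ^ M) ^ 2) * s ^ 2) - (1 - s ^ 2))
      =O[𝓁] fun p => (q ^ p.1) ^ 2 :=
    ((hx4.const_mul_left (q ^ 2 * (1 - s ^ 2))).add (hx2.const_mul_left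
      (-((q ^ 2 + 1) * (q ^ M) ^ 2 * (1 - s ^ 2))
        + (q ^ 2 + 1) * (((q ^ M)⁻¹) ^ 2 - (q ^ M) ^ 2) * s ^ 2))).congr_left fun p => by ring
  have k3 := isBigO_mul_const_sub_mul_const hu
    (hx4.neg_left.congr_left fun p => show _ = 1 - (q ^ p.1) ^ 4 - 1 by ring)
    ((hx4.const_mul_left (-q ^ 4)).congr_left fun p => show _ = 1 - (q ^ p.1) ^ 4 * q ^ 4 -
      1 by ring)
  simp only [mul_one] at k3
  have q2 : q ^ 2 < 1 := pow_lt_one₀ hq.le hq1 two_ne_zero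
  have k4 := isBigO_inv_sub_one (δ := (1 - q ^ 2) * (1 - q ^ 2))
    (by have : 0 < 1 - q ^ 2 := by linarith
        positivity) (by
      filter_upwards [h0] with p hp
      have hx : (q ^ p.1) ^ 4 ≤ q ^ 2 := by
        rw [← Real.rpow_mul_natCast hq.le, ← Real.rpow_natCast q 2]
        exact Real.rpow_le_rpow_of_exponent_ge hq hq1.le (by push_cast; linarith)
      have h7 : (q ^ p.1) ^ 4 * q ^ 4 ≤ q ^ 2 :=
        (mul_le_of_le_one_right (by positivity) (pow_le_one₀ hq.le hq1.le)).trans hx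
      have h8 : 0 ≤ 1 - q ^ 2 := by linarith
      exact mul_le_mul (by linarith) (by linarith) h8 (by linarith)) k3
  have b1 := isBigO_one_of_sub hu k1 b0
  have k5 := isBigO_mul_sub_mul k1 k2 b1 (hc _)
  have b2 := isBigO_one_of_sub hu k5 (isBigO_one_mul_one b0 (hc (1 - s ^ 2)))
  have k6 := isBigO_mul_sub_mul k5 k4 b2 (hc _)
  refine k6.congr' ?_ EventuallyEq.rfl
  filter_upwards [h0] with p e0
  rw [coeffAZero_eq_of_pow hq hq1 (by linarith), mul_one]

end

/-- The admissible labels `(l, m)`, as a filter. -/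
def validFilter (N : ℝ) : Filter (ℝ × ℝ) := 𝓟 {p | Valid N p.1 p.2}

/-- Over the principal filter of the admissible labels, O means a bound uniform in all of them, so
the lowest shell cannot be neglected. For l ≥ 1 the square roots are compared; for l < 1 one has l =
|N|, the coefficient is zero, and its bounded limit is dominated because q^l ≥ q. -/
theorem isBigO_coeffAPlus_pred (hq : 0 < q) (hq1 : q < 1) (hN : ∃ k : ℤ, N = k / 2) (hN0 : N ≠ 0)
    (hM : |M| = |N|) : (fun p : ℝ × ℝ => coeffAPlus q s M (p.1 - 1) p.2
      - √(qNum q 2 ^ 2 * ((q ^ (p.1 + p.2)) ^ 2 * (1 - (q ^ (p.1 + p.2)) ^ 2)) * s ^ 2))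
      =O[validFilter N] fun p => q ^ p.1 := by
  have hsplit : validFilter N = 𝓟 {p | Valid N p.1 p.2 ∧ 1 ≤ p.1} ⊔ 𝓟 {p | Valid N p.1 p.2 ∧ p.1 < 1} := by
    rw [sup_principal, validFilter]
    congr 1
    ext p
    simp only [Set.mem_ofPred_eq, Set.mem_union, ← and_or_left, le_or_gt, and_true]
  rw [hsplit]
  have hy : ∀ p : ℝ × ℝ, 0 ≤ p.1 + p.2 → (q ^ (p.1 + p.2)) ^ 2 ≤ 1 := fun p h =>
    pow_le_one₀ (Real.rpow_nonneg hq.le _) (Real.rpow_le_one hq.le hq1.le h)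
  refine IsBigO.sup ?_ ?_
  · have h := isBigO_sqrt_sub_sqrt (𝓁 := 𝓟 {p | Valid N p.1 p.2 ∧ 1 ≤ p.1})
      (isBigO_coeffAPlus_pred_sq (s := s) (M := M) hq hq1 ?_ ?_ ?_ ?_) ?_ ?_
    · refine h.congr' ?_ EventuallyEq.rfl
      refine eventually_principal.2 fun p hp => ?_
      dsimp only
      rw [Real.sqrt_sq (coeffAPlus_pred_nonneg hq hq1 (by linarith [hp.2]))]
    · exact eventually_principal.2 fun p hp => hp.2
    · exact eventually_principal.2 fun p hp => hM ▸ (hp.1.one_half_le hN hN0).2.1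
    · exact eventually_principal.2 fun p hp => (hp.1.one_half_le hN hN0).2.2.1
    · exact eventually_principal.2 fun p hp => (hp.1.one_half_le hN hN0).2.2.2
    · exact eventually_principal.2 fun p hp => sq_nonneg _
    · refine eventually_principal.2 fun p hp => ?_
      have := hy p (hp.1.one_half_le hN hN0).2.2.2
      have : 0 ≤ 1 - (q ^ (p.1 + p.2)) ^ 2 := by linarith
      positivity
  · refine IsBigO.of_bound (√(qNum q 2 ^ 2 * s ^ 2) / q) (eventually_principal.2 fun p hp => ?_)
    obtain ⟨g1, g2, g3, g4⟩ := hp.1.one_half_le hN hN0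
    obtain ⟨⟨n, hn⟩, -⟩ := hp.1
    have hn0 : n = 0 := by
      have : (n : ℝ) < 1 := by linarith [hp.2]
      exact Nat.lt_one_iff.1 (by exact_mod_cast this)
    have hl : p.1 = |M| := by rw [hM]; rw [hn0] at hn; simpa [sub_eq_zero] using hn
    have hy0 := hy p g4
    have hy1 : 0 ≤ (q ^ (p.1 + p.2)) ^ 2 := sq_nonneg _
    rw [coeffAPlus, sub_add_cancel, alphaCoeff_eq_zero hl, mul_zero, zero_sub, norm_neg,
      Real.norm_of_nonneg (Real.sqrt_nonneg _), Real.norm_of_nonneg (Real.rpow_nonneg hq.le _),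
      div_mul_eq_mul_div, le_div_iff₀ hq]
    refine mul_le_mul (Real.sqrt_le_sqrt ?_) ?_ hq.le (Real.sqrt_nonneg _)
    · refine mul_le_mul_of_nonneg_right (mul_le_of_le_one_right (sq_nonneg _) ?_) (sq_nonneg _)
      nlinarith
    · simpa using Real.rpow_le_rpow_of_exponent_ge hq hq1.le hp.2.le

end

/-! ### Powers of asymptotically tridiagonal operators. -/

section
variable {q N : ℝ}

/-- From ac − wF = a(c − F) + (a − w)F. The variable x stands for q^l, and the weaker bound x/q on c
− F accounts for the inductive estimate at l − 1. -/
theorem norm_ofReal_mul_sub_le {q a w C C₁ x : ℝ} {c F : ℂ} (hx1 : x ≤ 1)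
    (hC : 0 ≤ C) (ha : |a - w| ≤ C * x) (hw : |w| ≤ C) (hc : ‖c - F‖ ≤ C₁ * (x / q))
    (hF : ‖F‖ ≤ C₁) : ‖(a : ℂ) * c - w * F‖ ≤ (2 * C * C₁ / q + C * C₁) * x := by
  have h1 : |a| ≤ 2 * C := by
    have := abs_add_le (a - w) w
    rw [sub_add_cancel] at this
    nlinarith
  have h2 : (a : ℂ) * c - w * F = a * (c - F) + ((a - w : ℝ) : ℂ) * F := by push_cast; ring
  rw [h2]
  refine (norm_add_le _ _).trans ?_
  rw [norm_mul, norm_mul, Complex.norm_real, Complex.norm_real]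
  refine (add_le_add (mul_le_mul h1 hc (norm_nonneg _) (by positivity))
    (mul_le_mul ha hF (norm_nonneg _) ((abs_nonneg _).trans ha))).trans_eq ?_
  ring

/-- On the sector `ε`, `T` is a symmetric tridiagonal operator whose coefficients `p`, `r` tend
to limits `w`, `v` depending on `l + m` only. -/
structure IsAsymptoticJacobi (q N : ℝ) (ε : Bool) (T : Spinors N →L[ℂ] Spinors N)
    (p r : ℝ → ℝ → ℝ) (w v : ℕ → ℝ) (C : ℝ) : Prop where
  nonneg : 0 ≤ C
  apply_ket : ∀ l m, Valid N l m → T (ket N ε l m) = (p (l + 1) m : ℂ) • ket N ε (l + 1) m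
    + (r l m : ℂ) • ket N ε l m + (p l m : ℂ) • ket N ε (l - 1) m
  eq_zero : ∀ l m, Valid N l m → ¬ Valid N (l - 1) m → p l m = 0
  abs_p_sub_le : ∀ l m (i : ℕ), Valid N l m → l + m = i → |p l m - w i| ≤ C * q ^ l
  abs_r_sub_le : ∀ l m (i : ℕ), Valid N l m → l + m = i → |r l m - v i| ≤ C * q ^ l
  abs_w_le : ∀ i, |w i| ≤ C * q ^ i
  abs_v_le : ∀ i, |v i| ≤ C * q ^ i

/-- Apply T first: it moves l to l ± 1 at fixed m, so i = l + m moves along with l, and the limits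
obey a three-term recursion. From k = 1 on every term contains a factor w or v, whence the decay in
i; for k = 0 the limit is a Kronecker delta and does not decay. -/
theorem IsAsymptoticJacobi.exists_limit {ε : Bool} {T : Spinors N →L[ℂ] Spinors N} {p r : ℝ → ℝ → ℝ}
    {w v : ℕ → ℝ} {C : ℝ} (h : IsAsymptoticJacobi q N ε T p r w v C) (hq : 0 < q) (hq1 : q < 1)
    (hN : ∃ k : ℤ, N = k / 2) (hN0 : N ≠ 0) (k : ℕ) (d : ℤ) :
    ∃ (F : ℕ → ℂ) (C' : ℝ), 0 ≤ C' ∧ (∀ i, ‖F i‖ ≤ C') ∧ (k ≠ 0 → ∀ i, ‖F i‖ ≤ C' * q ^ i) ∧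
      ∀ l m (i : ℕ), Valid N l m → l + m = i →
        ‖inner ℂ (ket N ε (l + d) m) ((T ^ k) (ket N ε l m)) - F i‖ ≤ C' * q ^ l := by
  -- The target stays at l + d while the source moves, so the offset takes the values d − 1, d and d
  -- + 1.
  induction k generalizing d with
  | zero =>
    refine ⟨fun _ => if d = 0 then 1 else 0, 1, zero_le_one, fun i => ?_, fun h => absurd rfl h,
      fun l m i hv _ => ?_⟩
    · dsimp only
      split_ifs <;> simp
    · refine (le_of_eq ?_).trans (mul_nonneg zero_le_one (Real.rpow_nonneg hq.le l))
      rw [norm_eq_zero, sub_eq_zero, pow_zero, one_apply_eq_self]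
      by_cases hv' : Valid N (l + d) m
      · rw [inner_ket hv', ket_apply]
        simp
      · rw [ket_of_not_valid hv', inner_zero_left, if_neg]
        rintro rfl
        exact hv' (by simpa using hv)
  | succ k ih =>
    obtain ⟨F₁, C₁, hC₁, hF₁, -, hc₁⟩ := ih (d - 1)
    obtain ⟨F₂, C₂, hC₂, hF₂, -, hc₂⟩ := ih d
    obtain ⟨F₃, C₃, hC₃, hF₃, -, hc₃⟩ := ih (d + 1)
    have hC := h.nonneg
    obtain ⟨E, hE⟩ : ∃ E, E = C₁ + C₂ + C₃ := ⟨_, rfl⟩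
    have hE0 : 0 ≤ E := by rw [hE]; positivity
    have h1E : C₁ ≤ E := by linarith
    have h2E : C₂ ≤ E := by linarith
    have h3E : C₃ ≤ E := by linarith
    obtain ⟨K, hK⟩ : ∃ K, K = 2 * C * E / q + C * E := ⟨_, rfl⟩
    have hK0 : C * E ≤ K := by
      rw [hK, le_add_iff_nonneg_left]
      positivity
    have hCE : 0 ≤ C * E := by positivity
    have hF : ∀ i : ℕ, ‖(w (i + 1) : ℂ) * F₁ (i + 1) + v i * F₂ i + w i * F₃ (i - 1)‖
        ≤ 3 * K * q ^ i := fun i => by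
      have hqi : 0 ≤ q ^ i := by positivity
      have b : ∀ (a : ℝ) (G : ℂ), |a| ≤ C * q ^ i → ‖G‖ ≤ E → ‖(a : ℂ) * G‖ ≤ K * q ^ i :=
        fun a G ha hG => by
        rw [norm_mul, Complex.norm_real]
        refine (mul_le_mul ha hG (norm_nonneg _) (by positivity)).trans ?_
        rw [mul_right_comm]
        gcongr
      have hw1 : |w (i + 1)| ≤ C * q ^ i := (h.abs_w_le _).trans (by
        gcongr _ * ?_
        exact pow_le_pow_of_le_one hq.le hq1.le i.le_succ)
      have b1 := b _ _ hw1 ((hF₁ (i + 1)).trans h1E)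
      have b2 := b _ _ (h.abs_v_le i) ((hF₂ i).trans h2E)
      have b3 := b _ _ (h.abs_w_le i) ((hF₃ (i - 1)).trans h3E)
      refine norm_add₃_le.trans ?_
      linarith
    have hle1 : ∀ i : ℕ, q ^ i ≤ 1 := fun i => pow_le_one₀ hq.le hq1.le
    -- At i = 0 the truncated i − 1 gives F₃ 0. This is harmless, since there the label (l − 1, m)
    -- is inadmissible and the term is estimated without using what F₃ is the limit of.
    refine ⟨fun i => w (i + 1) * F₁ (i + 1) + v i * F₂ i + w i * F₃ (i - 1), 3 * K,
      by linarith, fun i => (hF i).trans (mul_le_of_le_one_right (by linarith) (hle1 i)),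
      fun _ => hF, fun l m i hv hi => ?_⟩
    obtain ⟨hN1, hl1, -, -⟩ := hv.one_half_le hN hN0
    obtain ⟨x, hx⟩ : ∃ x, x = q ^ l := ⟨_, rfl⟩
    have hx0 : 0 < x := hx ▸ Real.rpow_pos_of_pos hq l
    have hx1 : x ≤ 1 := hx ▸ Real.rpow_le_one hq.le hq1.le (by linarith)
    have hxq : x ≤ x / q := by rw [le_div_iff₀ hq]; nlinarith
    have hup : q ^ (l + 1) ≤ x := by
      rw [Real.rpow_add hq, Real.rpow_one, ← hx]
      nlinarith
    have hdown : q ^ (l - 1) = x / q := by rw [Real.rpow_sub hq, Real.rpow_one, hx]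
    have hwC : ∀ i, |w i| ≤ C := fun i => (h.abs_w_le i).trans (mul_le_of_le_one_right hC (hle1 i))
    have hvC : |v i| ≤ C := (h.abs_v_le i).trans (mul_le_of_le_one_right hC (hle1 i))
    rw [pow_succ, mul_apply_eq_comp, h.apply_ket l m hv]
    simp only [map_add, map_smul, inner_add_right, inner_smul_right]
    have t1 : ‖(p (l + 1) m : ℂ) * inner ℂ (ket N ε (l + d) m) ((T ^ k) (ket N ε (l + 1) m))
        - w (i + 1) * F₁ (i + 1)‖ ≤ K * x := by
      have hi' : l + 1 + m = ((i + 1 : ℕ) : ℝ) := by push_cast; linarith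
      have hc := hc₁ (l + 1) m (i + 1) (Valid.up hN hv) hi'
      rw [show l + 1 + ((d - 1 : ℤ) : ℝ) = l + d by push_cast; ring] at hc
      rw [hK]
      refine norm_ofReal_mul_sub_le hx1 hC ((h.abs_p_sub_le _ _ _ (Valid.up hN hv) hi').trans ?_)
        (hwC _)
        (hc.trans ?_) ((hF₁ _).trans h1E)
      · gcongr
      · exact mul_le_mul h1E (hup.trans hxq) (Real.rpow_nonneg hq.le _) hE0
    have t2 : ‖(r l m : ℂ) * inner ℂ (ket N ε (l + d) m) ((T ^ k) (ket N ε l m))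
        - v i * F₂ i‖ ≤ K * x := by
      rw [hK]
      refine norm_ofReal_mul_sub_le hx1 hC (hx ▸ h.abs_r_sub_le _ _ _ hv hi) hvC
        ((hc₂ l m i hv hi).trans ?_) ((hF₂ _).trans h2E)
      rw [← hx]
      exact mul_le_mul h2E hxq hx0.le hE0
    have t3 : ‖(p l m : ℂ) * inner ℂ (ket N ε (l + d) m) ((T ^ k) (ket N ε (l - 1) m))
        - w i * F₃ (i - 1)‖ ≤ K * x := by
      have hp := h.abs_p_sub_le _ _ _ hv hi
      rw [← hx] at hp
      by_cases hv' : Valid N (l - 1) m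
      · obtain ⟨j, hj⟩ := ((valid_iff hN).1 hv').2.2
        obtain rfl : i = j + 1 := by
          have : (i : ℝ) = j + 1 := by linarith
          exact_mod_cast this
        have hc := hc₃ (l - 1) m j hv' hj
        rw [show l - 1 + ((d + 1 : ℤ) : ℝ) = l + d by push_cast; ring, hdown] at hc
        rw [hK]
        exact norm_ofReal_mul_sub_le hx1 hC hp (hwC _) (hc.trans (by gcongr)) ((hF₃ _).trans h3E)
      -- At the boundary p vanishes, so the limit weight w i is itself at most C q^l and the product
      -- with F₃ is small.
      · rw [h.eq_zero l m hv hv'] at hp ⊢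
        rw [zero_sub, abs_neg] at hp
        rw [Complex.ofReal_zero, zero_mul, zero_sub, norm_neg, norm_mul, Complex.norm_real]
        refine (mul_le_mul hp ((hF₃ _).trans h3E) (norm_nonneg _) (by positivity)).trans ?_
        rw [mul_right_comm]
        gcongr
    have e : ∀ a b c a' b' c' : ℂ, a + b + c - (a' + b' + c') = (a - a') + (b - b') + (c - c') :=
      fun _ _ _ _ _ _ => by ring
    rw [e, ← hx]
    refine norm_add₃_le.trans ?_
    linarith

end

/-! ### Traces over shells. -/

section
variable {q N : ℝ}

theorem IsAsymptoticallyAffine.add {f g : ℕ → ℂ} {c d : ℂ} (hf : IsAsymptoticallyAffine f c)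
    (hg : IsAsymptoticallyAffine g d) : IsAsymptoticallyAffine (fun n => f n + g n) (c + d) := by
  obtain ⟨c', C, r, hr, hr1, h⟩ := hf
  obtain ⟨d', D, t, ht, ht1, h'⟩ := hg
  refine ⟨c' + d', |C| + |D|, max r t, lt_max_of_lt_left hr, max_lt hr1 ht1, fun n => ?_⟩
  have e : f n + g n - ((c + d) * (n + 1) + (c' + d'))
      = (f n - (c * (n + 1) + c')) + (g n - (d * (n + 1) + d')) := by ring
  rw [e, add_mul]
  refine (norm_add_le _ _).trans (add_le_add ((h n).trans ?_) ((h' n).trans ?_))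
  · exact mul_le_mul (le_abs_self C) (pow_le_pow_left₀ hr.le (le_max_left _ _) n) (by positivity)
      (abs_nonneg _)
  · exact mul_le_mul (le_abs_self D) (pow_le_pow_left₀ ht.le (le_max_right _ _) n) (by positivity)
      (abs_nonneg _)

theorem IsAsymptoticallyAffine.const_mul {f : ℕ → ℂ} {c : ℂ} (hf : IsAsymptoticallyAffine f c)
    (a : ℂ) : IsAsymptoticallyAffine (fun n => a * f n) (a * c) := by
  obtain ⟨c', C, r, hr, hr1, h⟩ := hf
  refine ⟨a * c', ‖a‖ * C, r, hr, hr1, fun n => ?_⟩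
  rw [show a * f n - (a * c * (n + 1) + a * c') = a * (f n - (c * (n + 1) + c')) by ring, norm_mul,
    mul_assoc]
  exact mul_le_mul_of_nonneg_left (h n) (norm_nonneg _)

theorem isAsymptoticallyAffine_affine (c c' : ℂ) :
    IsAsymptoticallyAffine (fun n => c * (n + 1) + c') c :=
  ⟨c', 0, 1 / 2, by norm_num, by norm_num, fun n => by simp⟩

/-- One factor √qⁿ absorbs the polynomial, the other remains as the rate; a term of a convergent
positive series is at most its sum. -/
theorem exists_succ_mul_pow_le (hq : 0 < q) (hq1 : q < 1) :
    ∃ C, 0 ≤ C ∧ ∀ n : ℕ, ((n : ℝ) + 1) * q ^ n ≤ C * √q ^ n := by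
  have h0 : 0 < √q := Real.sqrt_pos.2 hq
  have h1 : √q < 1 := by rwa [Real.sqrt_lt' one_pos, one_pow]
  have h := summable_succ_pow_mul_geometric 1 h0 h1
  refine ⟨∑' n : ℕ, ((n : ℝ) + 1) ^ 1 * √q ^ n, tsum_nonneg fun n => by positivity, fun n => ?_⟩
  have := h.le_tsum n fun n _ => by positivity
  rw [pow_one] at this
  calc ((n : ℝ) + 1) * q ^ n = ((n + 1) * √q ^ n) * √q ^ n := by
        rw [mul_assoc, ← mul_pow, Real.mul_self_sqrt hq.le]
    _ ≤ _ := mul_le_mul_of_nonneg_right this (by positivity)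

/-- Replacing the entries by F costs at most (2n + K + 1) C qⁿ, and completing the sum of F costs a
geometric tail from 2n + K + 1 on. Both are O(√qⁿ), so the shell sums tend to ∑F without a linear
term. -/
theorem isAsymptoticallyAffine_sum_of_limit (hq : 0 < q) (hq1 : q < 1) (K : ℕ) {F : ℕ → ℂ} {C : ℝ}
    (hF : ∀ i, ‖F i‖ ≤ C * q ^ i) {f : (n : ℕ) → Fin (2 * n + K + 1) → ℂ}
    (hf : ∀ n i, ‖f n i - F i‖ ≤ C * q ^ n) :
    IsAsymptoticallyAffine (fun n => ∑ i, f n i) 0 := by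
  obtain ⟨D, hD, hDn⟩ := exists_succ_mul_pow_le hq hq1
  have hC : 0 ≤ C := by simpa using (norm_nonneg _).trans (hF 0)
  have h1 : √q < 1 := by rwa [Real.sqrt_lt' one_pos, one_pow]
  have hs : Summable F :=
    .of_norm_bounded ((summable_geometric_of_lt_one hq.le hq1).mul_left C) hF
  refine ⟨∑' i, F i, C * (K + 2) * D + C * (1 - q)⁻¹ , √q, Real.sqrt_pos.2 hq, h1, fun n => ?_⟩
  have h2 : ‖∑ i : Fin (2 * n + K + 1), (f n i - F i)‖ ≤ C * (K + 2) * D * √q ^ n := by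
    refine (norm_sum_le_of_le _ fun i _ => hf n i).trans ?_
    rw [Finset.sum_const, Finset.card_univ, Fintype.card_fin, nsmul_eq_mul]
    have h3 : ((2 * n + K + 1 : ℕ) : ℝ) ≤ (K + 2) * (n + 1) := by
      push_cast
      have : (0 : ℝ) ≤ K * n := by positivity
      linarith
    calc ((2 * n + K + 1 : ℕ) : ℝ) * (C * q ^ n) ≤ (K + 2) * (n + 1) * (C * q ^ n) :=
          mul_le_mul_of_nonneg_right h3 (by positivity)
      _ = C * (K + 2) * ((n + 1) * q ^ n) := by ring
      _ ≤ C * (K + 2) * (D * √q ^ n) := mul_le_mul_of_nonneg_left (hDn n) (by positivity)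
      _ = _ := by ring
  have h4 : ‖∑ i : Fin (2 * n + K + 1), F i - ∑' i, F i‖ ≤ C * (1 - q)⁻¹ * √q ^ n := by
    rw [Fin.sum_univ_eq_sum_range F, ← hs.sum_add_tsum_nat_add (2 * n + K + 1), sub_add_cancel_left,
      norm_neg]
    have h5 : HasSum (fun i => C * q ^ (2 * n + K + 1) * q ^ i)
      (C * q ^ (2 * n + K + 1) * (1 - q)⁻¹) :=
      (hasSum_geometric_of_lt_one hq.le hq1).mul_left _
    refine (tsum_of_norm_bounded h5 fun i => (hF _).trans_eq ?_).trans ?_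
    · rw [pow_add]; ring
    · have h6 : q ^ (2 * n + K + 1) ≤ √q ^ n := by
        have hle : q ≤ √q := by
          rw [Real.le_sqrt' hq]
          nlinarith
        calc q ^ (2 * n + K + 1) ≤ q ^ n := pow_le_pow_of_le_one hq.le hq1.le (by omega)
          _ ≤ √q ^ n := pow_le_pow_left₀ hq.le hle n
      have h7 : 0 ≤ (1 - q)⁻¹ := inv_nonneg.2 (by linarith)
      rw [mul_right_comm]
      gcongr
  rw [show ∑ i, f n i - (0 * ((n : ℂ) + 1) + ∑' i, F i)
      = ∑ i : Fin (2 * n + K + 1), (f n i - F i) + (∑ i : Fin (2 * n + K + 1), F i - ∑' i, F i) by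
    rw [Finset.sum_sub_distrib]; ring, add_mul]
  exact (norm_add_le _ _).trans (add_le_add h2 h4)

theorem diag_eq_inner (T : Spinors N →L[ℂ] Spinors N) (x : Label N) :
    diag T x = inner ℂ (ket N x.2 x.1.1.1 x.1.1.2) (T (ket N x.2 x.1.1.1 x.1.1.2)) := by
  obtain ⟨⟨⟨l, m⟩, h⟩, ε⟩ := x
  rw [inner_ket h, diag, ket, dif_pos h]

theorem isAsymptoticallyAffine_sum_diag_pow (hq : 0 < q) (hq1 : q < 1) (hN : ∃ k : ℤ, N = k / 2)
    (hN0 : N ≠ 0) {K : ℕ} {e : (Σ n : ℕ, Fin (2 * n + K + 1) × Bool) ≃ Label N}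
    (he : ∀ x, (e x).1.1.1 = x.1 + |N| ∧ (e x).1.1.1 + (e x).1.1.2 = ((x.2.1 : ℕ) : ℝ)
      ∧ (e x).2 = x.2.2) {T : Spinors N →L[ℂ] Spinors N} {p r : Bool → ℝ → ℝ → ℝ}
    {w v : ℕ → ℝ} {C : Bool → ℝ}
    (hT : ∀ ε, IsAsymptoticJacobi q N ε T (p ε) (r ε) w v (C ε)) {k : ℕ} (hk : k ≠ 0) :
    IsAsymptoticallyAffine (fun n => ∑ y, diag (T ^ k) (e ⟨n, y⟩)) 0 := by
  have key : ∀ ε, IsAsymptoticallyAffine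
      (fun n => ∑ i : Fin (2 * n + K + 1), diag (T ^ k) (e ⟨n, i, ε⟩)) 0 := fun ε => by
    obtain ⟨F, C', hC', -, hF, h⟩ := (hT ε).exists_limit hq hq1 hN hN0 k 0
    refine isAsymptoticallyAffine_sum_of_limit hq hq1 K (hF hk) fun n i => ?_
    obtain ⟨h1, h2, h3⟩ := he ⟨n, i, ε⟩
    have h4 := h _ _ i (e ⟨n, i, ε⟩).1.2 h2
    rw [Int.cast_zero, add_zero] at h4
    rw [diag_eq_inner, h3]
    refine h4.trans (mul_le_mul_of_nonneg_left ?_ hC')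
    rw [h1, ← Real.rpow_natCast]
    exact Real.rpow_le_rpow_of_exponent_ge hq hq1.le (by simp)
  have h := (key true).add (key false)
  simp only [Fintype.sum_prod_type_right, Fintype.sum_bool]
  simpa using h

/-- The shell dimension is 2(2n + K + 1) = 4(n + 1) + 2K − 2. This is the only source of a nonzero
residue. -/
theorem isAsymptoticallyAffine_sum_diag_one {K : ℕ}
    {e : (Σ n : ℕ, Fin (2 * n + K + 1) × Bool) ≃ Label N} :
    IsAsymptoticallyAffine (fun n => ∑ y, diag 1 (e ⟨n, y⟩)) 4 := by
  convert isAsymptoticallyAffine_affine 4 (2 * K - 2) using 1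
  funext n
  have : ∀ x : Label N, diag 1 x = 1 := fun x => by simp [diag]
  simp only [this, Finset.sum_const, Finset.card_univ, Fintype.card_prod, Fintype.card_fin,
    Fintype.card_bool, nsmul_eq_mul, mul_one]
  push_cast
  ring

end

/-! ### The operator of A is asymptotically tridiagonal; weights of A and B. -/

section
open MeasureTheory
variable {q s N : ℝ}

section Jacobi

/-- The diagonal of x₀ tends to (1 − s²)(1 − (q² + 1)q^(2i)), which does not decay in i. Passing to
A removes exactly the constant 1 − s², in accordance with σ_s(A) = 0. -/
theorem IsEquivariantRep.isAsymptoticJacobi_A {π : Sphere q s →⋆ₐ[ℂ] (Spinors N →L[ℂ] Spinors N)}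
    (h : IsEquivariantRep q s N π) (hq : 0 < q) (hq1 : q < 1) (hN : ∃ k : ℤ, N = k / 2)
    (hN0 : N ≠ 0) (ε : Bool) :
    ∃ C, IsAsymptoticJacobi q N ε (π (A q s))
      (fun l m => -coeffAPlus q s (signed N ε) (l - 1) m / (q * qNum q 2))
      (fun l m => (1 - s ^ 2 - coeffAZero q s (signed N ε) l m) / (q * qNum q 2))
      (fun i => -√(qNum q 2 ^ 2 * ((q ^ i) ^ 2 * (1 - (q ^ i) ^ 2)) * s ^ 2) / (q * qNum q 2))
      (fun i => (1 - s ^ 2) * (q ^ 2 + 1) * (q ^ i) ^ 2 / (q * qNum q 2)) C := by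
  obtain ⟨c, hc⟩ : ∃ c, c = q * qNum q 2 := ⟨_, rfl⟩
  have hc0 : 0 < c := hc ▸ q_mul_qNum_two_pos hq hq1
  obtain ⟨C₁, h₁⟩ := Asymptotics.isBigO_principal.1
    (isBigO_coeffAPlus_pred (s := s) hq hq1 hN hN0 (abs_signed N ε))
  obtain ⟨C₂, h₂⟩ := Asymptotics.isBigO_principal.1
    (isBigO_coeffAZero (s := s) (M := signed N ε) (𝓁 := validFilter N) hq hq1
      (Filter.eventually_principal.2 fun p hp => by
        have := Valid.one_half_le hN hN0 hp
        linarith)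
      (Filter.eventually_principal.2 fun p hp => (Valid.one_half_le hN hN0 hp).2.2.2))
  have hqi : ∀ i : ℕ, (q ^ i) ^ 2 ≤ q ^ i := fun i => by
    rw [pow_two]
    exact mul_le_of_le_one_left (by positivity) (pow_le_one₀ hq.le hq1.le)
  -- One constant for all four estimates: the two implied constants of the asymptotics and the sizes
  -- of the two limit sequences.
  obtain ⟨E, hE⟩ : ∃ E, E = |C₁| + |C₂| + √(qNum q 2 ^ 2 * s ^ 2)
    + |(1 - s ^ 2) * (q ^ 2 + 1)| := ⟨_, rfl⟩
  have p1 := abs_nonneg C₁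
  have p2 := abs_nonneg C₂
  have p3 := Real.sqrt_nonneg (qNum q 2 ^ 2 * s ^ 2)
  have p4 := abs_nonneg ((1 - s ^ 2) * (q ^ 2 + 1))
  have key : ∀ x y : ℝ, 0 ≤ y → |x| ≤ E * y → |x / c| ≤ E / c * y := fun x y hy hx => by
    rw [abs_div, abs_of_pos hc0, div_mul_eq_mul_div]
    gcongr
  rw [← hc]
  refine ⟨E / c, ⟨by rw [hE]; positivity, fun l m hv => ?_, fun l m hv hv' => ?_,
    fun l m i hv hi => ?_,
    fun l m i hv hi => ?_, fun i => key _ _ (by positivity) ?_,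
      fun i => key _ _ (by positivity) ?_⟩⟩
  · rw [A_eq s hq hq1, map_smul, map_sub, AlgHomClass.commutes, ← hc,
      Algebra.algebraMap_eq_smul_one]
    change (c : ℂ)⁻¹ • ((1 - (s : ℂ) ^ 2) • ket N ε l m - π (xZero q s) (ket N ε l m)) = _
    rw [h.x_zero ε l m hv, add_sub_cancel_right]
    push_cast
    module
  · rw [coeffAPlus_pred_eq_zero hN (abs_signed N ε) hv hv']
    simp
  · rw [← sub_div]
    refine key _ _ (Real.rpow_nonneg hq.le l) ?_
    have h3 := h₁ (l, m) hv
    simp only [hi, Real.rpow_natCast, Real.norm_eq_abs,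
      abs_of_pos (Real.rpow_pos_of_pos hq l)] at h3
    rw [neg_sub_neg, abs_sub_comm]
    refine h3.trans (mul_le_mul_of_nonneg_right ?_ (Real.rpow_nonneg hq.le l))
    linarith [le_abs_self C₁]
  · rw [← sub_div]
    refine key _ _ (Real.rpow_nonneg hq.le l) ?_
    have h3 := h₂ (l, m) hv
    simp only [hi, Real.rpow_natCast, Real.norm_eq_abs, abs_pow,
      abs_of_pos (Real.rpow_pos_of_pos hq l)] at h3
    rw [show 1 - s ^ 2 - coeffAZero q s (signed N ε) l m - (1 - s ^ 2) * (q ^ 2 + 1) * (q ^ i) ^ 2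
      = -(coeffAZero q s (signed N ε) l m - (1 - (q ^ 2 + 1) * (q ^ i) ^ 2) * (1 - s ^ 2)) by ring,
      abs_neg]
    have hl : (q ^ l) ^ 2 ≤ q ^ l := by
      rw [pow_two]
      exact mul_le_of_le_one_left (Real.rpow_nonneg hq.le l) (Real.rpow_le_one hq.le hq1.le
        (by have := hv.one_half_le hN hN0; linarith))
    calc _ ≤ C₂ * (q ^ l) ^ 2 := h3
      _ ≤ |C₂| * (q ^ l) ^ 2 := mul_le_mul_of_nonneg_right (le_abs_self _) (sq_nonneg _)
      _ ≤ E * q ^ l := mul_le_mul (by linarith) hl (sq_nonneg _) (by linarith)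
  · rw [abs_neg, abs_of_nonneg (Real.sqrt_nonneg _)]
    calc _ ≤ √((qNum q 2 ^ 2 * s ^ 2) * (q ^ i) ^ 2) := by
          refine Real.sqrt_le_sqrt ?_
          rw [mul_right_comm]
          refine mul_le_mul_of_nonneg_left (mul_le_of_le_one_right (sq_nonneg _) ?_) (by positivity)
          linarith [sq_nonneg (q ^ i)]
      _ = √(qNum q 2 ^ 2 * s ^ 2) * q ^ i := by
          rw [Real.sqrt_mul (by positivity), Real.sqrt_sq (by positivity)]
      _ ≤ _ := mul_le_mul_of_nonneg_right (by linarith) (by positivity)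
  · rw [abs_mul, abs_of_nonneg (sq_nonneg (q ^ i))]
    exact mul_le_mul (by linarith) (hqi i) (by positivity) (by linarith)
end Jacobi

section Weights

/-- `T` maps vectors of weight `m` to vectors of weight `m + d`. -/
def ShiftsWeight (d : ℝ) (T : Spinors N →L[ℂ] Spinors N) : Prop :=
  ∀ (m : ℝ) (v : Spinors N), (∀ y : Label N, y.1.1.2 ≠ m → v y = 0) →
    ∀ y : Label N, y.1.1.2 ≠ m + d → T v y = 0

theorem single_eq_ket (x : Label N) : lp.single 2 x (1 : ℂ) = ket N x.2 x.1.1.1 x.1.1.2 := by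
  rw [ket, dif_pos x.1.2]

theorem shiftsWeight_of_ket {d : ℝ} {T : Spinors N →L[ℂ] Spinors N}
    (h : ∀ ε l m, Valid N l m → ∀ y : Label N, y.1.1.2 ≠ m + d → T (ket N ε l m) y = 0) :
    ShiftsWeight d T := by
  intro m v hv y hy
  have h1 := ((lp.hasSum_single (by norm_num : (2 : ENNReal) ≠ ⊤) v).mapL T).mapL
    (innerSL ℂ (lp.single 2 y (1 : ℂ) : Spinors N))
  have h2 : ∀ w : Spinors N, innerSL ℂ (lp.single 2 y (1 : ℂ) : Spinors N) w = w y := fun w => by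
    rw [innerSL_apply_apply, lp.inner_single_left]
    simp
  simp only [h2] at h1
  refine h1.unique ?_
  convert hasSum_zero using 1
  funext x
  by_cases hx : x.1.1.2 = m
  · have e : (lp.single 2 x (v x) : Spinors N) = v x • ket N x.2 x.1.1.1 x.1.1.2 := by
      rw [← single_eq_ket, ← lp.single_smul, smul_eq_mul, mul_one]
    rw [e, map_smul, lp.coeFn_smul, Pi.smul_apply, h _ _ _ x.1.2 y (by rwa [hx]), smul_zero]
  · rw [hv x hx, lp.single_zero, map_zero]
    rfl

theorem ShiftsWeight.smul {d : ℝ} {T : Spinors N →L[ℂ] Spinors N} (h : ShiftsWeight d T) (c : ℂ) :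
    ShiftsWeight d (c • T) := fun m v hv y hy => by
  change (c • T v) y = 0
  rw [lp.coeFn_smul, Pi.smul_apply, h m v hv y hy, smul_zero]

theorem ShiftsWeight.mul {d e : ℝ} {S T : Spinors N →L[ℂ] Spinors N} (hS : ShiftsWeight d S)
    (hT : ShiftsWeight e T) : ShiftsWeight (d + e) (S * T) := fun m v hv y hy =>
  hS (m + e) (T v) (hT m v hv) y (by rwa [add_assoc, add_comm e d])

theorem ShiftsWeight.pow {d : ℝ} {T : Spinors N →L[ℂ] Spinors N} (hT : ShiftsWeight d T) (k : ℕ) :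
    ShiftsWeight (k * d) (T ^ k) := by
  induction k with
  | zero =>
    intro m v hv y hy
    exact hv y (by simpa using hy)
  | succ k ih =>
    have := ih.mul hT
    rw [pow_succ]
    convert this using 1
    push_cast
    ring

theorem ShiftsWeight.star {d : ℝ} {T : Spinors N →L[ℂ] Spinors N} (hT : ShiftsWeight d T) :
    ShiftsWeight (-d) (star T) := by
  intro m v hv y hy
  have h1 : inner ℂ (lp.single 2 y (1 : ℂ) : Spinors N) (Star.star T v) = Star.star T v y := by
    rw [lp.inner_single_left]
    simp
  rw [← h1, ContinuousLinearMap.star_eq_adjoint, ContinuousLinearMap.adjoint_inner_right,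
    lp.inner_eq_tsum]
  refine (tsum_congr fun x => ?_).trans tsum_zero
  by_cases hx : x.1.1.2 = m
  · have h2 : T (lp.single 2 y (1 : ℂ)) x = 0 := by
      refine hT y.1.1.2 _ (fun z hz => ?_) x fun h => hy ?_
      · rw [single_eq_ket, ket_apply, if_neg]
        exact fun h => hz h.2.1
      · linarith
    rw [h2, inner_zero_left]
  · rw [hv x hx, inner_zero_right]

theorem ShiftsWeight.diag_eq_zero {d : ℝ} {T : Spinors N →L[ℂ] Spinors N} (hT : ShiftsWeight d T)
    (hd : d ≠ 0) (x : Label N) : diag T x = 0 := by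
  refine hT x.1.1.2 _ (fun z hz => ?_) x (by simpa using hd)
  rw [single_eq_ket, ket_apply, if_neg]
  exact fun h => hz h.2.1

theorem smul_ket_apply_eq_zero {ε : Bool} {l m : ℝ} (c : ℂ) {y : Label N} (h : y.1.1.2 ≠ m) :
    (c • ket N ε l m) y = 0 := by
  rw [lp.coeFn_smul, Pi.smul_apply, ket_apply, if_neg fun h' => h h'.2.1, smul_zero]

variable {π : Sphere q s →⋆ₐ[ℂ] (Spinors N →L[ℂ] Spinors N)}

theorem IsEquivariantRep.shiftsWeight_A (h : IsEquivariantRep q s N π) (hq : 0 < q) (hq1 : q < 1) :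
    ShiftsWeight 0 (π (A q s)) := by
  rw [A_eq s hq hq1, map_smul, map_sub, AlgHomClass.commutes, Algebra.algebraMap_eq_smul_one]
  refine ShiftsWeight.smul (shiftsWeight_of_ket fun ε l m hv y hy => ?_) _
  change ((1 - (s : ℂ) ^ 2) • ket N ε l m - π (xZero q s) (ket N ε l m)) y = 0
  rw [add_zero] at hy
  rw [h.x_zero ε l m hv]
  simp only [lp.coeFn_sub, lp.coeFn_add, Pi.sub_apply, Pi.add_apply, smul_ket_apply_eq_zero _ hy]
  ring

theorem IsEquivariantRep.shiftsWeight_B (h : IsEquivariantRep q s N π) (hq : 0 < q) (hq1 : q < 1) :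
    ShiftsWeight 1 (π (B q s)) := by
  rw [B_eq s hq hq1, map_smul]
  refine ShiftsWeight.smul (shiftsWeight_of_ket fun ε l m hv y hy => ?_) _
  rw [h.x_one ε l m hv]
  simp only [lp.coeFn_add, Pi.add_apply, smul_ket_apply_eq_zero _ hy]
  ring
end Weights

end

/-! ### Ordered monomials and the integral over the circle. -/

section
open MeasureTheory
variable {q s N : ℝ}

section Basis

theorem A_mul_B (q s : ℝ) : A q s * B q s = ((q : ℂ) ^ 2) • (B q s * A q s) := by
  simpa [A, B] using mk_eq_of_rel (Rel.comm (q := q) (s := s))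

theorem mk_gen_Bstar (q s : ℝ) : mk q s (gen .Bstar) = star (B q s) := (star_mk_gen q s .B).symm

theorem star_B_mul_A (q s : ℝ) : star (B q s) * A q s = ((q : ℂ) ^ 2) • (A q s * star (B q s)) := by
  rw [← mk_gen_Bstar]
  simpa [A] using mk_eq_of_rel (Rel.comm_star (q := q) (s := s))

theorem B_mul_star_B (q s : ℝ) : B q s * star (B q s)
    = -((A q s + algebraMap ℂ _ ((s : ℂ) ^ 2)) * (A q s - 1)) := by
  have := mk_eq_of_rel (Rel.B_Bstar (q := q) (s := s))
  rw [map_add, map_mul, map_mul, map_add, map_sub, map_one, map_zero, AlgHom.commutes,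
    mk_gen_Bstar] at this
  exact eq_neg_of_add_eq_zero_left this

theorem star_B_mul_B (q s : ℝ) : star (B q s) * B q s
    = -((((q : ℂ) ^ 2) • A q s + algebraMap ℂ _ ((s : ℂ) ^ 2)) * (((q : ℂ) ^ 2) • A q s - 1)) := by
  have := mk_eq_of_rel (Rel.Bstar_B (q := q) (s := s))
  rw [map_add, map_mul, map_mul, map_add, map_sub, map_one, map_zero, AlgHom.commutes, map_smul,
    mk_gen_Bstar] at this
  exact eq_neg_of_add_eq_zero_left this

theorem B_mul_A_pow (hq : 0 < q) (s : ℝ) (k : ℕ) :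
    B q s * A q s ^ k = (((q : ℂ) ^ 2)⁻¹ ^ k) • (A q s ^ k * B q s) := by
  have hq0 : ((q : ℂ) ^ 2) ≠ 0 := pow_ne_zero 2 (Complex.ofReal_ne_zero.2 hq.ne')
  have h1 : B q s * A q s = ((q : ℂ) ^ 2)⁻¹ • (A q s * B q s) := by
    rw [A_mul_B, inv_smul_smul₀ hq0]
  induction k with
  | zero => simp
  | succ k ih =>
    rw [pow_succ, ← mul_assoc, ih, smul_mul_assoc, mul_assoc, h1, mul_smul_comm, smul_smul,
      ← pow_succ, mul_assoc]

theorem star_B_mul_A_pow (q s : ℝ) (k : ℕ) :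
    star (B q s) * A q s ^ k = (((q : ℂ) ^ 2) ^ k) • (A q s ^ k * star (B q s)) := by
  induction k with
  | zero => simp
  | succ k ih =>
    rw [pow_succ, ← mul_assoc, ih, smul_mul_assoc, mul_assoc, star_B_mul_A, mul_smul_comm,
      smul_smul,
      ← pow_succ, mul_assoc]

/-- The span of the ordered monomials `Aᵏ Bʲ` and `Aᵏ B*ʲ`. -/
noncomputable def monomialSpan (q s : ℝ) : Submodule ℂ (Sphere q s) :=
  Submodule.span ℂ (Set.range (fun p : ℕ × ℕ => A q s ^ p.1 * B q s ^ p.2)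
    ∪ Set.range (fun p : ℕ × ℕ => A q s ^ p.1 * star (B q s) ^ p.2))

theorem A_pow_mul_B_pow_mem (q s : ℝ) (k j : ℕ) : A q s ^ k * B q s ^ j ∈ monomialSpan q s :=
  Submodule.subset_span (Or.inl ⟨(k, j), rfl⟩)

theorem A_pow_mul_star_B_pow_mem (q s : ℝ) (k j : ℕ) :
    A q s ^ k * star (B q s) ^ j ∈ monomialSpan q s :=
  Submodule.subset_span (Or.inr ⟨(k, j), rfl⟩)

theorem mul_mem_monomialSpan {a : Sphere q s}
    (h1 : ∀ k j, a * (A q s ^ k * B q s ^ j) ∈ monomialSpan q s)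
    (h2 : ∀ k j, a * (A q s ^ k * star (B q s) ^ j) ∈ monomialSpan q s) {x : Sphere q s}
    (hx : x ∈ monomialSpan q s) : a * x ∈ monomialSpan q s := by
  induction hx using Submodule.span_induction with
  | mem x hx =>
    rcases hx with ⟨p, rfl⟩ | ⟨p, rfl⟩
    · exact h1 _ _
    · exact h2 _ _
  | zero => rw [mul_zero]; exact Submodule.zero_mem _
  | add x y _ _ hx hy => rw [mul_add]; exact Submodule.add_mem _ hx hy
  | smul c x _ hx => rw [mul_smul_comm]; exact Submodule.smul_mem _ _ hx

theorem A_mul_mem_monomialSpan {x : Sphere q s} (hx : x ∈ monomialSpan q s) :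
    A q s * x ∈ monomialSpan q s := by
  refine mul_mem_monomialSpan (fun k j => ?_) (fun k j => ?_) hx
  · rw [← mul_assoc, ← pow_succ']
    exact A_pow_mul_B_pow_mem _ _ _ _
  · rw [← mul_assoc, ← pow_succ']
    exact A_pow_mul_star_B_pow_mem _ _ _ _

theorem A_pow_mul_mem_monomialSpan {x : Sphere q s} (hx : x ∈ monomialSpan q s) (k : ℕ) :
    A q s ^ k * x ∈ monomialSpan q s := by
  induction k with
  | zero => rwa [pow_zero, one_mul]
  | succ k ih => rw [pow_succ', mul_assoc]; exact A_mul_mem_monomialSpan ih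

/-- Both BB* and B*B have this form, with b = 1 and b = q² respectively. -/
theorem quadratic_mul_mem_monomialSpan (b c : ℂ) {x : Sphere q s} (hx : x ∈ monomialSpan q s) :
    -((b • A q s + algebraMap ℂ _ c) * (b • A q s - 1)) * x ∈ monomialSpan q s := by
  have h1 : b • A q s * x - x ∈ monomialSpan q s :=
    Submodule.sub_mem _ (by rw [smul_mul_assoc]; exact Submodule.smul_mem _ _ (A_mul_mem_monomialSpan hx)) hx
  rw [neg_mul, mul_assoc, sub_mul, one_mul, add_mul, smul_mul_assoc, ← Algebra.smul_def]
  exact Submodule.neg_mem _ (Submodule.add_mem _ (Submodule.smul_mem _ _ (A_mul_mem_monomialSpan h1))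
    (Submodule.smul_mem _ _ h1))

/-- B passes Aᵏ at the cost of a scalar; then it either lengthens a power of B or meets one B*, and
BB* is a polynomial in A. -/
theorem B_mul_mem_monomialSpan (hq : 0 < q) {x : Sphere q s} (hx : x ∈ monomialSpan q s) :
    B q s * x ∈ monomialSpan q s := by
  have h1 : ∀ k j, B q s * (A q s ^ k * B q s ^ j) ∈ monomialSpan q s := fun k j => by
    rw [← mul_assoc, B_mul_A_pow hq, smul_mul_assoc, mul_assoc, ← pow_succ']
    exact Submodule.smul_mem _ _ (A_pow_mul_B_pow_mem _ _ _ _)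
  refine mul_mem_monomialSpan h1 (fun k j => ?_) hx
  rcases j with _ | j
  · simpa using h1 k 0
  · rw [← mul_assoc, B_mul_A_pow hq, smul_mul_assoc, mul_assoc, pow_succ' _ j, ← mul_assoc (B q s),
      B_mul_star_B]
    refine Submodule.smul_mem _ _ (A_pow_mul_mem_monomialSpan ?_ k)
    have := quadratic_mul_mem_monomialSpan 1 ((s : ℂ) ^ 2) (A_pow_mul_star_B_pow_mem q s 0 j)
    simpa only [one_smul, pow_zero, one_mul] using this

theorem star_B_mul_mem_monomialSpan {x : Sphere q s} (hx : x ∈ monomialSpan q s) :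
    star (B q s) * x ∈ monomialSpan q s := by
  have h1 : ∀ k j, star (B q s) * (A q s ^ k * star (B q s) ^ j) ∈ monomialSpan q s := fun k j => by
    rw [← mul_assoc, star_B_mul_A_pow, smul_mul_assoc, mul_assoc, ← pow_succ']
    exact Submodule.smul_mem _ _ (A_pow_mul_star_B_pow_mem _ _ _ _)
  refine mul_mem_monomialSpan (fun k j => ?_) h1 hx
  rcases j with _ | j
  · simpa using h1 k 0
  · rw [← mul_assoc, star_B_mul_A_pow, smul_mul_assoc, mul_assoc, pow_succ' _ j,
      ← mul_assoc (star (B q s)),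
      star_B_mul_B]
    refine Submodule.smul_mem _ _ (A_pow_mul_mem_monomialSpan ?_ k)
    have := quadratic_mul_mem_monomialSpan ((q : ℂ) ^ 2) ((s : ℂ) ^ 2) (A_pow_mul_B_pow_mem q s 0 j)
    simpa only [pow_zero, one_mul] using this

theorem mem_monomialSpan (hq : 0 < q) (a : Sphere q s) : a ∈ monomialSpan q s := by
  -- Stability under left multiplication passes to products of generators, whereas membership alone
  -- would not; applying it to 1 gives the claim.
  have key : ∀ x ∈ monomialSpan q s, a * x ∈ monomialSpan q s := by
    induction a using induction_on_sphere with
    | algebraMap c =>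
      intro x hx
      rw [← Algebra.smul_def]
      exact Submodule.smul_mem _ _ hx
    | hA => exact fun x hx => A_mul_mem_monomialSpan hx
    | hB => exact fun x hx => B_mul_mem_monomialSpan hq hx
    | hBs => exact fun x hx => star_B_mul_mem_monomialSpan hx
    | mul a b ha hb => intro x hx; rw [mul_assoc]; exact ha _ (hb _ hx)
    | add a b ha hb => intro x hx; rw [add_mul]; exact Submodule.add_mem _ (ha _ hx) (hb _ hx)
  simpa using key 1 (by simpa using A_pow_mul_B_pow_mem q s 0 0)
end Basis

section Integral

/-- The right-hand side `(2/π) ∫ σ_s(a)(θ) dθ`. -/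
noncomputable def circleTrace (q s : ℝ) (a : Sphere q s) : ℂ :=
  2 / Real.pi * ∫ θ in (0 : ℝ)..(2 * Real.pi), sigma q s a (Circle.exp θ)

theorem circleTrace_add (a b : Sphere q s) :
    circleTrace q s (a + b) = circleTrace q s a + circleTrace q s b := by
  have hi : ∀ a : Sphere q s, IntervalIntegrable (fun θ => sigma q s a (Circle.exp θ)) volume 0
      (2 * Real.pi) := fun a =>
    ((sigma q s a).continuous.comp Circle.exp.continuous).intervalIntegrable _ _
  rw [circleTrace, circleTrace, circleTrace, ← mul_add, ← intervalIntegral.integral_add (hi a)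
    (hi b)]
  simp

theorem circleTrace_smul (c : ℂ) (a : Sphere q s) :
    circleTrace q s (c • a) = c * circleTrace q s a := by
  rw [circleTrace, circleTrace, mul_left_comm, ← intervalIntegral.integral_const_mul]
  simp

/-- The factor is (2/π)·2π = 4. -/
theorem circleTrace_of_sigma_eq {a : Sphere q s} {c : ℂ} (h : sigma q s a = algebraMap ℂ _ c) :
    circleTrace q s a = 4 * c := by
  have hπ : (Real.pi : ℂ) ≠ 0 := Complex.ofReal_ne_zero.2 Real.pi_ne_zero
  rw [circleTrace, h]
  simp only [algebraMap_apply, intervalIntegral.integral_const]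
  rw [sub_zero, Complex.real_smul, smul_eq_mul, mul_one]
  push_cast
  field_simp
  ring

theorem integral_exp_int_mul {n : ℤ} (hn : n ≠ 0) :
    ∫ θ in (0 : ℝ)..(2 * Real.pi), Complex.exp (n * Complex.I * θ) = 0 := by
  have h0 : (n : ℂ) * Complex.I ≠ 0 := mul_ne_zero (Int.cast_ne_zero.2 hn) Complex.I_ne_zero
  rw [integral_exp_mul_complex h0]
  have : Complex.exp (n * Complex.I * ((2 * Real.pi : ℝ) : ℂ)) = 1 := by
    rw [← Complex.exp_int_mul_two_pi_mul_I n]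
    congr 1
    push_cast
    ring
  rw [this]
  simp

theorem circleTrace_B_pow {j : ℕ} (hj : j ≠ 0) : circleTrace q s (B q s ^ j) = 0 := by
  have : ∀ θ : ℝ, sigma q s (B q s ^ j) (Circle.exp θ)
      = (s : ℂ) ^ j * Complex.exp (((j : ℤ) : ℂ) * Complex.I * θ) := fun θ => by
    rw [map_pow, sigma_B, smul_pow, ContinuousMap.smul_apply, ContinuousMap.pow_apply, smul_eq_mul]
    change _ * (Circle.exp θ : ℂ) ^ j = _
    rw [Circle.coe_exp, ← Complex.exp_nat_mul]
    push_cast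
    ring_nf
  rw [circleTrace]
  simp only [this]
  rw [intervalIntegral.integral_const_mul, integral_exp_int_mul (by exact_mod_cast hj), mul_zero,
    mul_zero]

theorem circleTrace_star_B_pow {j : ℕ} (hj : j ≠ 0) : circleTrace q s (star (B q s) ^ j) = 0 := by
  have : ∀ θ : ℝ, sigma q s (star (B q s) ^ j) (Circle.exp θ)
      = (s : ℂ) ^ j * Complex.exp (((-j : ℤ) : ℂ) * Complex.I * θ) := fun θ => by
    rw [map_pow, map_star, sigma_B, ← star_pow, smul_pow]
    change star ((s : ℂ) ^ j * (Circle.exp θ : ℂ) ^ j) = _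
    rw [Circle.coe_exp, ← Complex.exp_nat_mul, star_mul', Complex.star_def, map_pow,
      Complex.conj_ofReal, ← Complex.exp_conj]
    congr 2
    simp
    ring
  rw [circleTrace]
  simp only [this]
  rw [intervalIntegral.integral_const_mul, integral_exp_int_mul (by simpa using hj), mul_zero,
    mul_zero]

theorem circleTrace_A_pow_mul {k : ℕ} (hk : k ≠ 0) (a : Sphere q s) :
    circleTrace q s (A q s ^ k * a) = 0 := by
  rw [circleTrace_of_sigma_eq (c := 0), mul_zero]
  rw [map_mul, map_pow, sigma_A, zero_pow hk, zero_mul, map_zero]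

theorem circleTrace_one : circleTrace q s 1 = 4 := by
  rw [circleTrace_of_sigma_eq (c := 1), mul_one]
  rw [map_one, map_one]

theorem exists_sigma_eq_algebraMap (q : ℝ) (a : Sphere q 0) :
    ∃ c : ℂ, sigma q 0 a = algebraMap ℂ C(Circle, ℂ) c := by
  induction a using induction_on_sphere with
  | algebraMap c => exact ⟨c, AlgHomClass.commutes _ c⟩
  | hA => exact ⟨0, by rw [sigma_A, map_zero]⟩
  | hB => exact ⟨0, by rw [sigma_B, Complex.ofReal_zero, zero_smul, map_zero]⟩
  | hBs => exact ⟨0, by rw [map_star, sigma_B, Complex.ofReal_zero, zero_smul, star_zero, map_zero]⟩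
  | mul a b ha hb =>
    obtain ⟨c, hc⟩ := ha
    obtain ⟨d, hd⟩ := hb
    exact ⟨c * d, by rw [map_mul, hc, hd, map_mul]⟩
  | add a b ha hb =>
    obtain ⟨c, hc⟩ := ha
    obtain ⟨d, hd⟩ := hb
    exact ⟨c + d, by rw [map_add, hc, hd, map_add]⟩
end Integral

theorem diag_add (S T : Spinors N →L[ℂ] Spinors N) (x : Label N) :
    diag (S + T) x = diag S x + diag T x := rfl

theorem diag_smul (c : ℂ) (T : Spinors N →L[ℂ] Spinors N) (x : Label N) :
    diag (c • T) x = c * diag T x := rfl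

theorem diag_zero (x : Label N) : diag (0 : Spinors N →L[ℂ] Spinors N) x = 0 := rfl

theorem isAsymptoticallyAffine_zero : IsAsymptoticallyAffine (fun _ => 0) 0 := by
  simpa using isAsymptoticallyAffine_affine 0 0

/-- Both sides are linear in a, so ordered monomials suffice. Powers of B or B* shift the weight and
give zero on both sides; pure powers of A reduce to the unit and to the tridiagonal asymptotics. -/
theorem IsEquivariantRep.isAsymptoticallyAffine_sum_diag
    {π : Sphere q s →⋆ₐ[ℂ] (Spinors N →L[ℂ] Spinors N)} (h : IsEquivariantRep q s N π) (hq : 0 < q)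
    (hq1 : q < 1) (hN : ∃ k : ℤ, N = k / 2) (hN0 : N ≠ 0) {K : ℕ}
    {e : (Σ n : ℕ, Fin (2 * n + K + 1) × Bool) ≃ Label N}
    (he : ∀ x, (e x).1.1.1 = x.1 + |N| ∧ (e x).1.1.1 + (e x).1.1.2 = ((x.2.1 : ℕ) : ℝ)
      ∧ (e x).2 = x.2.2) (a : Sphere q s) :
    IsAsymptoticallyAffine (fun n => ∑ y, diag (π a) (e ⟨n, y⟩)) (circleTrace q s a) := by
  have hA : ∀ k, IsAsymptoticallyAffine (fun n => ∑ y, diag (π (A q s ^ k)) (e ⟨n, y⟩))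
      (circleTrace q s (A q s ^ k)) := fun k => by
    rcases eq_or_ne k 0 with rfl | hk
    · rw [pow_zero, circleTrace_one, map_one]
      exact isAsymptoticallyAffine_sum_diag_one
    · choose C hC using h.isAsymptoticJacobi_A hq hq1 hN hN0
      rw [← mul_one (A q s ^ k), circleTrace_A_pow_mul hk, mul_one, map_pow]
      exact isAsymptoticallyAffine_sum_diag_pow hq hq1 hN hN0 he hC hk
  -- A nonzero shift of the weight makes every diagonal element zero, so the shell traces vanish
  -- identically.
  have hoff : ∀ (d : ℝ) (a : Sphere q s), ShiftsWeight d (π a) → d ≠ 0 → circleTrace q s a = 0 →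
      IsAsymptoticallyAffine (fun n => ∑ y, diag (π a) (e ⟨n, y⟩)) (circleTrace q s a) :=
    fun d a ha hd h0 => by
    simp only [ha.diag_eq_zero hd, Finset.sum_const_zero, h0]
    exact isAsymptoticallyAffine_zero
  have hmono : ∀ (k : ℕ) (b : Sphere q s), circleTrace q s b = 0 →
      circleTrace q s (A q s ^ k * b) = 0 := fun k b hb => by
    rcases eq_or_ne k 0 with rfl | hk
    · rwa [pow_zero, one_mul]
    · exact circleTrace_A_pow_mul hk b
  have hwA := h.shiftsWeight_A hq hq1
  have hwB := h.shiftsWeight_B hq hq1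
  have ha := mem_monomialSpan hq a
  induction ha using Submodule.span_induction with
  | mem x hx =>
    rcases hx with ⟨⟨k, j⟩, rfl⟩ | ⟨⟨k, j⟩, rfl⟩
    · rcases eq_or_ne j 0 with rfl | hj
      · simpa using hA k
      · refine hoff _ _ (by rw [map_mul, map_pow, map_pow]; exact (hwA.pow k).mul (hwB.pow j))
          (by simpa using hj) (hmono k _ (circleTrace_B_pow hj))
    · rcases eq_or_ne j 0 with rfl | hj
      · simpa using hA k
      · refine hoff _ _ (by
            rw [map_mul, map_pow, map_pow, map_star]
            exact (hwA.pow k).mul (hwB.star.pow j))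
          (by simpa using hj) (hmono k _ (circleTrace_star_B_pow hj))
  | zero =>
    have : circleTrace q s 0 = 0 := by simpa using circleTrace_smul (q := q) (s := s) 0 0
    simp only [map_zero, diag_zero, Finset.sum_const_zero, this]
    exact isAsymptoticallyAffine_zero
  | add x y _ _ hx hy =>
    simp only [map_add, diag_add, Finset.sum_add_distrib, circleTrace_add]
    exact hx.add hy
  | smul c x _ hx =>
    simp only [map_smul, diag_smul, ← Finset.mul_sum, circleTrace_smul]
    exact hx.const_mul c

end

end Podles

theorem mainTheorem3 (q s N : ℝ) (hq : 0 < q) (hq1 : q < 1) (hs : 0 ≤ s) (hs1 : s ≤ 1)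
    (hN : ∃ k : ℤ, N = k / 2) (hN0 : N ≠ 0) :
    (∃! π : Podles.Sphere q s →⋆ₐ[ℂ] (Podles.Spinors N →L[ℂ] Podles.Spinors N),
      Podles.IsEquivariantRep q s N π) ∧
    ∀ π : Podles.Sphere q s →⋆ₐ[ℂ] (Podles.Spinors N →L[ℂ] Podles.Spinors N),
      Podles.IsEquivariantRep q s N π → ∀ a : Podles.Sphere q s,
        Podles.HasNCIntegral N (π a)
          (2 / Real.pi * ∫ θ in (0 : ℝ)..(2 * Real.pi), Podles.sigma q s a (Circle.exp θ)) ∧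
        (s = 0 → ∃ c : ℂ, Podles.sigma q s a = algebraMap ℂ C(Circle, ℂ) c ∧
          Podles.HasNCIntegral N (π a) (4 * c)) := by
  refine ⟨?_, fun π h a => ?_⟩
  · obtain ⟨π, h⟩ := Podles.exists_isEquivariantRep s hq hq1 hN hN0
    exact ⟨π, h, fun π' h' => h'.unique hq hq1 h⟩
  · obtain ⟨K, hK⟩ := Podles.exists_two_mul_abs hN
    obtain ⟨e, he⟩ := Podles.exists_label_equiv hN hK
    have key : Podles.HasNCIntegral N (π a) (Podles.circleTrace q s a) :=
      Podles.hasNCIntegral_of_isAsymptoticallyAffine (fun x => (he x).1) (π a)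
        (h.isAsymptoticallyAffine_sum_diag hq hq1 hN hN0 he a)
    refine ⟨key, ?_⟩
    rintro rfl
    -- For s = 0 the symbols of both generators vanish, so only the scalar part of a survives.
    obtain ⟨c, hc⟩ := Podles.exists_sigma_eq_algebraMap q a
    exact ⟨c, hc, Podles.circleTrace_of_sigma_eq hc ▸ key⟩
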